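/- Let $\Delta=\{\zeta\in\mathbb C:|\zeta-1|<1\}$ and $\mathcal R=\{z\in\mathbb C:\operatorname{Re}z>0\}$. Let $A^2(\Delta)$ be the Bergman space of holomorphic functions $f$ on $\Delta$ with $\|f\|_{A^2(\Delta)}^2=\frac1\pi\int_\Delta|f|^2\,dA<\infty$, where $dA$ is Lebesgue measure, and for $f\in A^2(\Delta)$, $z\in\mathcal R$ let $$M_\Delta f(z)=\frac1\pi\int_\Delta f(\zeta)\,\overline\zeta^{\,z-1}\,dA(\zeta)$$ be its Mellin--Bergman transform (principal branch). Let $\mathcal M^2_\omega(\mathcal R)$ be the space of holomorphic functions $F$ on $\mathcal R$ such that $\sup_{0<x<b}\int_{\mathbb R}|F(x+iy)|^2\,dy<\infty$ for every $0<b<\infty$ and $$\|F\|_{\mathcal M^2_\omega}^2=\sum_{n=0}^\infty\frac{2^n}{n!}\int_{\mathbb R}\bigl|F(\tfrac n2+iy)\bigr|^2\,dy<\infty ,$$ where $F(0+i\,\cdot)$ denotes the limit of $F(x+i\,\cdot)$ in $L^2(\mathbb R)$ as $x\to0^+$; that is, $F\in L^2(\overline{\mathcal R},d\omega)$ with $\omega=\sum_n\frac{2^n}{n!}\delta_{n/2}(x)\otimes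 dy$. Let $$\mathcal H=\bigl\{g\text{ holomorphic on }\mathcal R:\ \Gamma(1+z)2^{-z}g\in\mathcal M^2_\omega(\mathcal R)\bigr\},\qquad \langle g,h\rangle_{\mathcal H}=\bigl\langle\Gamma(1+z)2^{-z}g,\ \Gamma(1+z)2^{-z}h\bigr\rangle_{L^2(\overline{\mathcal R},d\omega)} .$$ Then: 1. The boundary values $\lim_{x\to0^+}F(x+i\,\cdot)$ in $L^2(\mathbb R)$ of $F=\Gamma(1+z)2^{-z}g$ exist for every $g\in\mathcal H$; $\langle\cdot,\cdot\rangle_{\mathcal H}$ is an inner product on $\mathcal H$, and $\mathcal H$ is complete, i.e. a Hilbert space. 2. $M_\Delta$ is a linear bijection of $A^2(\Delta)$ onto $\mathcal H$, and $\|M_\Delta f\|_{\mathcal H}=\sqrt{2\pi}\,\|f\|_{A^2(\Delta)}$ for all $f\in A^2(\Delta)$; that is, $(2\pi)^{-1/2}M_\Delta$ is a surjective isometry from $A^2(\Delta)$ onto $\mathcal H$. 3. Every $g\in\mathcal H$ is of exponential type at most $\pi/2$ in $\mathcal R$, in the following sense: for all $\delta,\varepsilon>0$ there is a constant $C$ with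 $|g(z)|\le Ce^{(\pi/2+\varepsilon)|z|}$ for all $z$ with $\operatorname{Re}z\ge\delta$. 4. The (restrictions to $\mathcal R$ of) polynomials in $z$ belong to $\mathcal H$ and are dense in $\mathcal H$. 5. $\mathcal H$ is a reproducing kernel Hilbert space of functions on $\mathcal R$, with kernel $$H(z,w)=\frac1{2\pi}\,\frac{\Gamma(z+\overline w)}{\Gamma(1+z)\,\Gamma(1+\overline w)},\qquad z,w\in\mathcal R.$$ -/

import Mathlib

open MeasureTheory Set Filter Topology ComplexConjugate
open scoped ENNReal NNReal Nat

namespace MellinBergman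

noncomputable section

/-- The disc `Δ = {ζ : |ζ - 1| < 1}`. -/
def disc : Set ℂ := Metric.ball 1 1

/-- The right half-plane `{z : Re z > 0}`. -/
def rightHalfPlane : Set ℂ := {z | 0 < z.re}

/-- A function on `U ⊆ ℂ`, extended by `0` to the whole plane. It is only ever used on `U`. -/
def zeroExt {U : Set ℂ} (f : U → ℂ) : ℂ → ℂ := Function.extend Subtype.val f 0

theorem zeroExt_apply {U : Set ℂ} (f : U → ℂ) (z : U) : zeroExt f z = f z :=
  Subtype.val_injective.extend_apply f 0 z

theorem zeroExt_of_mem {U : Set ℂ} (f : U → ℂ) {z : ℂ} (hz : z ∈ U) :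
    zeroExt f z = f ⟨z, hz⟩ := zeroExt_apply f ⟨z, hz⟩

theorem zeroExt_of_notMem {U : Set ℂ} (f : U → ℂ) {z : ℂ} (hz : z ∉ U) :
    zeroExt f z = 0 :=
  Function.extend_apply' f (0 : ℂ → ℂ) z (fun ⟨a, ha⟩ => hz (ha ▸ a.2))

theorem zeroExt_zero {U : Set ℂ} : zeroExt (U := U) 0 = 0 := by
  funext z
  by_cases hz : z ∈ U
  · simp [zeroExt_of_mem _ hz]
  · simp [zeroExt_of_notMem _ hz]

theorem zeroExt_add {U : Set ℂ} (f g : U → ℂ) : zeroExt (f + g) = zeroExt f + zeroExt g := by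
  funext z
  by_cases hz : z ∈ U
  · simp [zeroExt_of_mem _ hz]
  · simp [zeroExt_of_notMem _ hz]

theorem zeroExt_smul {U : Set ℂ} (c : ℂ) (f : U → ℂ) : zeroExt (c • f) = c • zeroExt f := by
  funext z
  by_cases hz : z ∈ U
  · simp [zeroExt_of_mem _ hz]
  · simp [zeroExt_of_notMem _ hz]

/-! ### The Bergman space of the disc -/

/-- The Bergman space `A²(Δ)`: the holomorphic functions on `Δ` that are square integrable
with respect to area. -/
def bergmanSpace : Submodule ℂ (disc → ℂ) where
  carrier := {f | DifferentiableOn ℂ (zeroExt f) disc ∧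
    MemLp (zeroExt f) 2 (volume.restrict disc)}
  add_mem' := by
    rintro f g ⟨hf, hf'⟩ ⟨hg, hg'⟩
    rw [mem_ofPred_eq, zeroExt_add]
    exact ⟨hf.add hg, hf'.add hg'⟩
  zero_mem' := by
    rw [mem_ofPred_eq, zeroExt_zero]
    exact ⟨differentiableOn_const 0, MemLp.zero⟩
  smul_mem' := by
    rintro c f ⟨hf, hf'⟩
    rw [mem_ofPred_eq, zeroExt_smul]
    exact ⟨hf.const_smul c, hf'.const_smul c⟩

/-- The norm of `A²(Δ)`, with area normalized to be a probability measure: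
`‖f‖² = (1/π) ∫_Δ |f|² dA`. -/
def bergmanNorm (f : bergmanSpace) : ℝ :=
  Real.sqrt ((1 / Real.pi) * ∫ ζ in disc, ‖zeroExt f.1 ζ‖ ^ 2)

/-- The Mellin–Bergman transform `M_Δ f (z) = (1/π) ∫_Δ f(ζ) (conj ζ)^(z-1) dA(ζ)`. -/
def mellinBergman (f : bergmanSpace) (z : ℂ) : ℂ :=
  (1 / (Real.pi : ℂ)) * ∫ ζ in disc, zeroExt f.1 ζ * (conj ζ) ^ (z - 1)

/-! ### The space `M²_ω` -/

/-- `F` belongs to the Hardy space `H²(S_b)` of the strip `0 < Re z < b`. -/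
def IsHardyStrip (b : ℝ) (F : ℂ → ℂ) : Prop :=
  DifferentiableOn ℂ F {z | 0 < z.re ∧ z.re < b} ∧
    ∃ C : ℝ≥0, ∀ x ∈ Ioo (0 : ℝ) b, ∫⁻ y : ℝ, ‖F ((x : ℂ) + y * Complex.I)‖ₑ ^ 2 ≤ C

/-- `u` is the boundary value of `F` on the imaginary axis, in the sense of `L²(ℝ)`:
`F(x + i ·) → u` in `L²(ℝ)` as `x → 0⁺`. -/
def IsBoundaryValue (F : ℂ → ℂ) (u : ℝ → ℂ) : Prop :=
  MemLp u 2 volume ∧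
    Tendsto (fun x : ℝ => eLpNorm (fun y : ℝ => F ((x : ℂ) + y * Complex.I) - u y) 2 volume)
      (𝓝[>] 0) (𝓝 0)

open Classical in
/-- The boundary value of `F` on the imaginary axis (unique up to null sets). -/
def boundaryValue (F : ℂ → ℂ) : ℝ → ℂ :=
  if h : ∃ u, IsBoundaryValue F u then h.choose else 0

/-- The function `F`, given on the open right half-plane, as a function on the closed right
half-plane: on the imaginary axis it is the boundary value. -/
def closedExt (F : ℂ → ℂ) (z : ℂ) : ℂ :=
  if 0 < z.re then F z else if z.re = 0 then boundaryValue F z.im else 0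

/-- The measure `ω = ∑ₙ (2ⁿ / n!) δ_{n/2}(x) ⊗ dy`. -/
def omega : Measure ℂ :=
  Measure.sum fun n : ℕ => ENNReal.ofReal (2 ^ n / (n ! : ℝ)) •
    (volume : Measure ℝ).map (fun y : ℝ => (n : ℂ) / 2 + y * Complex.I)

theorem memLp_boundaryValue (F : ℂ → ℂ) : MemLp (boundaryValue F) 2 volume := by
  unfold boundaryValue
  split_ifs with h
  · exact h.choose_spec.1
  · exact MemLp.zero

theorem measurableSet_rightHalfPlane : MeasurableSet rightHalfPlane :=
  measurableSet_lt measurable_const Complex.measurable_re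

theorem measurableSet_axis : MeasurableSet {z : ℂ | z.re = 0} :=
  measurableSet_eq_fun Complex.measurable_re measurable_const

theorem measurable_line (n : ℕ) :
    Measurable (fun y : ℝ => (n : ℂ) / 2 + y * Complex.I) := by fun_prop

theorem re_line (n : ℕ) (y : ℝ) : ((n : ℂ) / 2 + y * Complex.I).re = n / 2 := by
  simp

theorem im_line (n : ℕ) (y : ℝ) : ((n : ℂ) / 2 + y * Complex.I).im = y := by
  simp

theorem omega_restrict_axis_le : omega.restrict {z : ℂ | z.re = 0} ≤
    (volume : Measure ℝ).map (fun y : ℝ => ((0 : ℕ) : ℂ) / 2 + y * Complex.I) := by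
  refine Measure.le_iff.2 fun s hs => ?_
  rw [Measure.restrict_apply hs, omega,
    Measure.sum_apply _ (hs.inter measurableSet_axis), tsum_eq_single 0]
  · simp only [Measure.smul_apply]
    simp only [pow_zero, Nat.factorial_zero, Nat.cast_one, div_one, ENNReal.ofReal_one, one_smul]
    exact measure_mono inter_subset_left
  · intro n hn
    rw [Measure.smul_apply, Measure.map_apply (measurable_line n) (hs.inter measurableSet_axis)]
    have : (fun y : ℝ => (n : ℂ) / 2 + y * Complex.I) ⁻¹' (s ∩ {z : ℂ | z.re = 0}) = ∅ := by
      ext y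
      simp only [mem_preimage, mem_inter_iff, mem_ofPred_eq, re_line, mem_empty_iff_false,
        iff_false, not_and]
      intro _
      positivity
    rw [this]
    simp

theorem memLp_axis (F : ℂ → ℂ) :
    MemLp ({z : ℂ | z.re = 0}.indicator fun z => boundaryValue F z.im) 2 omega := by
  rw [memLp_indicator_iff_restrict measurableSet_axis]
  have hmap : MemLp (fun z : ℂ => boundaryValue F z.im) 2
      ((volume : Measure ℝ).map (fun y : ℝ => ((0 : ℕ) : ℂ) / 2 + y * Complex.I)) := by
    have hq : Measure.map Complex.im
        ((volume : Measure ℝ).map (fun y : ℝ => ((0 : ℕ) : ℂ) / 2 + y * Complex.I)) = volume := by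
      rw [Measure.map_map Complex.measurable_im (measurable_line 0)]
      have : (Complex.im ∘ fun y : ℝ => ((0 : ℕ) : ℂ) / 2 + y * Complex.I) = id := by
        funext y
        simp
      rw [this, Measure.map_id]
    have h := memLp_boundaryValue F
    rw [← hq] at h
    exact h.comp_of_map Complex.measurable_im.aemeasurable
  exact hmap.mono_measure omega_restrict_axis_le

theorem memLp_closedExt_iff (F : ℂ → ℂ) :
    MemLp (closedExt F) 2 omega ↔ MemLp (rightHalfPlane.indicator F) 2 omega := by
  have h : closedExt F = rightHalfPlane.indicator F +
      {z : ℂ | z.re = 0}.indicator fun z => boundaryValue F z.im := by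
    funext z
    rw [Pi.add_apply]
    by_cases h1 : 0 < z.re
    · simp [closedExt, rightHalfPlane, indicator, h1, h1.ne']
    · by_cases h2 : z.re = 0
      · simp [closedExt, rightHalfPlane, indicator, h2]
      · simp [closedExt, rightHalfPlane, indicator, h1, h2]
  constructor
  · intro hc
    have := hc.sub (memLp_axis F)
    rwa [h, add_sub_cancel_right] at this
  · intro hc
    rw [h]
    exact hc.add (memLp_axis F)

theorem IsHardyStrip.add {b : ℝ} {F G : ℂ → ℂ} (hF : IsHardyStrip b F) (hG : IsHardyStrip b G) :
    IsHardyStrip b (F + G) := by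
  obtain ⟨hF, C, hC⟩ := hF
  obtain ⟨hG, D, hD⟩ := hG
  refine ⟨hF.add hG, 2 * (C + D), fun x hx => ?_⟩
  have hline : ∀ {K : ℂ → ℂ}, DifferentiableOn ℂ K {z | 0 < z.re ∧ z.re < b} →
      Measurable fun y : ℝ => ‖K ((x : ℂ) + y * Complex.I)‖ₑ ^ 2 := by
    intro K hK
    have : Continuous fun y : ℝ => K ((x : ℂ) + y * Complex.I) :=
      hK.continuousOn.comp_continuous (by fun_prop) (fun y => by simpa using hx)
    exact (this.measurable.enorm).pow_const 2
  calc ∫⁻ y : ℝ, ‖(F + G) ((x : ℂ) + y * Complex.I)‖ₑ ^ 2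
      ≤ ∫⁻ y : ℝ, 2 * (‖F ((x : ℂ) + y * Complex.I)‖ₑ ^ 2 +
          ‖G ((x : ℂ) + y * Complex.I)‖ₑ ^ 2) := by
        refine lintegral_mono fun y => ?_
        refine (pow_le_pow_left' (enorm_add_le _ _) 2).trans ?_
        have := ENNReal.rpow_add_le_mul_rpow_add_rpow
          ‖F ((x : ℂ) + y * Complex.I)‖ₑ ‖G ((x : ℂ) + y * Complex.I)‖ₑ
          (p := 2) (by norm_num)
        norm_num at this
        exact this
    _ = 2 * ((∫⁻ y : ℝ, ‖F ((x : ℂ) + y * Complex.I)‖ₑ ^ 2) +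
          ∫⁻ y : ℝ, ‖G ((x : ℂ) + y * Complex.I)‖ₑ ^ 2) := by
        rw [lintegral_const_mul' _ _ (by finiteness), lintegral_add_left (hline hF)]
    _ ≤ 2 * (C + D) := by gcongr; exacts [hC x hx, hD x hx]
    _ = _ := by push_cast; rfl

theorem IsHardyStrip.const_smul {b : ℝ} {F : ℂ → ℂ} (hF : IsHardyStrip b F) (c : ℂ) :
    IsHardyStrip b (c • F) := by
  obtain ⟨hF, C, hC⟩ := hF
  refine ⟨hF.const_smul c, ‖c‖₊ ^ 2 * C, fun x hx => ?_⟩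
  have : ∀ y : ℝ, ‖(c • F) ((x : ℂ) + y * Complex.I)‖ₑ ^ 2 =
      ‖c‖ₑ ^ 2 * ‖F ((x : ℂ) + y * Complex.I)‖ₑ ^ 2 := by
    intro y
    rw [Pi.smul_apply, enorm_smul, mul_pow]
  simp_rw [this]
  rw [lintegral_const_mul' _ _ (by finiteness)]
  push_cast
  exact mul_le_mul_right (hC x hx) _

theorem IsHardyStrip.zero {b : ℝ} : IsHardyStrip b 0 :=
  ⟨differentiableOn_const 0, 0, fun x _ => by simp⟩

/-- The space `M²_ω` of holomorphic functions `f` on the right half-plane such that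
`f ∈ H²(S_b)` for every `0 < b < ∞`, and `f`, extended to the closed half-plane by its boundary
values, is in `L²(ω)`. -/
def m2Space : Submodule ℂ (rightHalfPlane → ℂ) where
  carrier := {f | DifferentiableOn ℂ (zeroExt f) rightHalfPlane ∧
    (∀ b : ℝ, 0 < b → IsHardyStrip b (zeroExt f)) ∧
    MemLp (closedExt (zeroExt f)) 2 omega}
  add_mem' := by
    rintro f g ⟨hf, hf', hf''⟩ ⟨hg, hg', hg''⟩
    rw [memLp_closedExt_iff] at hf'' hg''
    rw [mem_ofPred_eq, zeroExt_add, memLp_closedExt_iff, indicator_add']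
    exact ⟨hf.add hg, fun b hb => (hf' b hb).add (hg' b hb), hf''.add hg''⟩
  zero_mem' := by
    rw [mem_ofPred_eq, zeroExt_zero, memLp_closedExt_iff]
    refine ⟨differentiableOn_const 0, fun b _ => IsHardyStrip.zero, ?_⟩
    have : rightHalfPlane.indicator (0 : ℂ → ℂ) = 0 := indicator_zero' _
    rw [this]
    exact MemLp.zero
  smul_mem' := by
    rintro c f ⟨hf, hf', hf''⟩
    rw [memLp_closedExt_iff] at hf''
    rw [mem_ofPred_eq, zeroExt_smul, memLp_closedExt_iff]
    refine ⟨hf.const_smul c, fun b hb => (hf' b hb).const_smul c, ?_⟩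
    have : rightHalfPlane.indicator (c • zeroExt f) = c • rightHalfPlane.indicator (zeroExt f) :=
      indicator_const_smul _ c _
    rw [this]
    exact hf''.const_smul c

/-- The `L²(ω)` inner product of two functions on the right half-plane, extended to the closed
half-plane by their boundary values (conjugate linear in the first variable). -/
def m2Inner (f h : rightHalfPlane → ℂ) : ℂ :=
  ∫ z, conj (closedExt (zeroExt f) z) * closedExt (zeroExt h) z ∂omega

/-! ### The space `ℋ` -/

/-- The function `z ↦ Γ(1 + z) 2^{-z} g(z)` on the right half-plane. -/
def gammaWeight (g : rightHalfPlane → ℂ) (z : rightHalfPlane) : ℂ :=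
  Complex.Gamma (1 + (z : ℂ)) / (2 : ℂ) ^ (z : ℂ) * g z

theorem gammaWeight_add (f g : rightHalfPlane → ℂ) :
    gammaWeight (f + g) = gammaWeight f + gammaWeight g := by
  funext z
  simp [gammaWeight, mul_add]

theorem gammaWeight_zero : gammaWeight 0 = 0 := by
  funext z
  simp [gammaWeight]

theorem gammaWeight_smul (c : ℂ) (f : rightHalfPlane → ℂ) :
    gammaWeight (c • f) = c • gammaWeight f := by
  funext z
  simp [gammaWeight, mul_left_comm]

/-- The set `ℋ` of holomorphic functions `g` on the right half-plane with
`Γ(1 + z) 2^{-z} g ∈ M²_ω`, as a space of functions. -/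
def hSubmodule : Submodule ℂ (rightHalfPlane → ℂ) where
  carrier := {g | DifferentiableOn ℂ (zeroExt g) rightHalfPlane ∧ gammaWeight g ∈ m2Space}
  add_mem' := by
    rintro f g ⟨hf, hf'⟩ ⟨hg, hg'⟩
    rw [mem_ofPred_eq, zeroExt_add, gammaWeight_add]
    exact ⟨hf.add hg, m2Space.add_mem hf' hg'⟩
  zero_mem' := by
    rw [mem_ofPred_eq, zeroExt_zero, gammaWeight_zero]
    exact ⟨differentiableOn_const 0, m2Space.zero_mem⟩
  smul_mem' := by
    rintro c f ⟨hf, hf'⟩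
    rw [mem_ofPred_eq, zeroExt_smul, gammaWeight_smul]
    exact ⟨hf.const_smul c, m2Space.smul_mem c hf'⟩

/-- The space `ℋ` as a type of its own, so that it does not carry the topology of pointwise
convergence. -/
def MBSpace : Type := hSubmodule

instance : AddCommGroup MBSpace := inferInstanceAs (AddCommGroup hSubmodule)

instance : Module ℂ MBSpace := inferInstanceAs (Module ℂ hSubmodule)

/-- The value of `g ∈ ℋ` at a point `z` of the right half-plane. -/
def MBSpace.val (g : MBSpace) (z : rightHalfPlane) : ℂ := Subtype.val g z

/-- The inner product of `ℋ`:
`⟨g, h⟩ = ⟨Γ(1+z) 2^{-z} g, Γ(1+z) 2^{-z} h⟩` in `L²(ω)`. -/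
def hInner (g h : MBSpace) : ℂ := m2Inner (gammaWeight g.val) (gammaWeight h.val)

/-- A function on the open right half-plane is of exponential type at most `τ`: on each closed
half-plane `Re z ≥ δ`, `δ > 0`, it is `O(e^{(τ + ε)|z|})` for every `ε > 0`. -/
def ExpTypeAtMost (τ : ℝ) (g : rightHalfPlane → ℂ) : Prop :=
  ∀ δ : ℝ, 0 < δ → ∀ ε : ℝ, 0 < ε → ∃ C : ℝ, ∀ z : rightHalfPlane, δ ≤ (z : ℂ).re →
    ‖g z‖ ≤ C * Real.exp ((τ + ε) * ‖(z : ℂ)‖)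

end

end MellinBergman

open MellinBergman

/-!
The substitution `t = e^{-u}` turns Euler's integral into `Γ(z) = ∫ exp(-zu - e^{-u}) du`. For
`χ ∈ L²(ℝ)` let `gammaTransform χ z = ∫ χ(u) exp(-zu - e^{-u}) du`. On the line `Re z = x` this is
a Fourier transform, so by Plancherel's theorem its squared norm there is `2π` times the integral of
`|χ(u)|² exp(-2xu - 2e^{-u})`. Summed over `x = n/2` with the weights `2ⁿ/n!`, the factors
`exp(-nu - 2e^{-u})` add up to `1`. Hence `χ ↦ gammaTransform χ` multiplies inner products by `2π`
as a map from `L²(ℝ)` to `M²_ω` (`integral_omega_conj_closedExt`). It is onto by Mellin inversion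
(`exists_gammaTransform_eqOn`): the inverse Fourier transforms of `F ∈ M²_ω` on different vertical
lines differ by the factor expected from Cauchy's theorem, which is applied after damping `F` by a
Gaussian. Dividing by the weight `Γ(1+z) 2^{-z}` gives an isomorphism `synthesisEquiv` of `L²(ℝ)`
with `ℋ`. It carries over the Hilbert space structure, and it gives the reproducing kernel, because
evaluation at `z` is already an inner product on `L²(ℝ)`.

To compare `ℋ` with the Bergman space it is enough to look at the powers `ζ^k`. Expanding
`ζ^(z-1)` in powers of `ζ - 1` and using the orthogonality of these powers on the disc gives
`M_Δ ζ^k = (z+1)(z+2)⋯(z+k) / (k+1)!` (`mellinBergman_bergmanPow`), which is also the image under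
`synthesisEquiv` of a multiple `linePow k` of the kernel `exp(-(k+1)u - e^{-u})`. The value of
`M_Δ f` at the integer `j + 1` is `1/π` times the integral of `f` against `conj ζ^j`, so the Gram
matrices of the two families agree up to the factor `π`. Both families are total: the powers because
of the Taylor expansion about `1`, the kernels because the moment problem for the weight `e^{-t}` is
determinate (`ae_eq_zero_of_integral_mul_expKernel_eq_zero`). So there is a unitary map from the
Bergman space onto `L²(ℝ)` that takes the one family to the other, and its composition with
`synthesisEquiv` is `M_Δ`, since both are continuous at each point of the half-plane and agree on
the powers.

The exponential type comes from a pointwise bound of `(conj ζ)^(z-1)` on the disc, and the density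
of the polynomials from the totality of the kernels.
-/

namespace MellinBergman

/-! ### The Fourier transform on `L¹ ∩ L²` -/

section Fourier

open FourierTransform SchwartzMap
open scoped ContDiff RealInnerProductSpace

theorem continuous_fourier {f : ℝ → ℂ} (hf : Integrable f) : Continuous (𝓕 f) :=
  VectorFourier.fourierIntegral_continuous Real.continuous_fourierChar
    (by fun_prop) hf

theorem continuous_fourierInv {f : ℝ → ℂ} (hf : Integrable f) : Continuous (𝓕⁻ f) := by
  have h : 𝓕⁻ f = fun x => 𝓕 f (-x) := funext fun x => Real.fourierInv_eq_fourier_neg f x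
  rw [h]
  exact (continuous_fourier hf).comp continuous_neg

/-- For integrable functions, the Fourier integral can be moved to the other factor. -/
theorem integral_smul_fourier_eq {f g : ℝ → ℂ} (hf : Integrable f) (hg : Integrable g) :
    ∫ x, g x • 𝓕 f x = ∫ x, 𝓕 g x • f x := by
  have := VectorFourier.integral_fourierIntegral_smul_eq_flip (L := innerₗ ℝ)
    (μ := volume) (ν := volume) Real.continuous_fourierChar (by fun_prop) hg hf
  rw [flip_innerₗ] at this
  exact this.symm

/-- On `L¹ ∩ L²` the `L²` Fourier transform is given by the Fourier integral. -/
theorem fourier_toLp_ae {f : ℝ → ℂ} (h1 : Integrable f) (h2 : MemLp f 2) :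
    ((𝓕 (h2.toLp f) : Lp ℂ 2 (volume : Measure ℝ)) : ℝ → ℂ) =ᵐ[volume] 𝓕 f := by
  refine ae_eq_of_integral_contDiff_smul_eq ((Lp.memLp _).locallyIntegrable (by norm_num))
    (continuous_fourier h1).locallyIntegrable fun g hg hc => ?_
  have hg₁ : HasCompactSupport (Complex.ofRealCLM ∘ g) := hc.comp_left rfl
  have hg₂ : ContDiff ℝ ∞ (Complex.ofRealCLM ∘ g) := by fun_prop
  set G : 𝓢(ℝ, ℂ) := hg₁.toSchwartzMap hg₂
  have e : ∀ x, G x = (g x : ℂ) := fun x => by simp [G]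
  have key := congrArg (fun T => T G)
    (Lp.fourier_toTemperedDistribution_eq (h2.toLp f))
  simp only [TemperedDistribution.fourier_apply, Lp.toTemperedDistribution_apply] at key
  have l : ∫ x, g x • ((𝓕 (h2.toLp f) : Lp ℂ 2 (volume : Measure ℝ)) : ℝ → ℂ) x =
      ∫ x, G x • ((𝓕 (h2.toLp f) : Lp ℂ 2 (volume : Measure ℝ)) : ℝ → ℂ) x := by
    simp [e]
  have r : ∫ x, g x • 𝓕 f x = ∫ x, G x • 𝓕 f x := by simp [e]
  rw [l, r, ← key, integral_smul_fourier_eq h1 G.integrable, SchwartzMap.fourier_coe]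
  refine integral_congr_ae ?_
  filter_upwards [h2.coeFn_toLp] with x hx
  rw [hx]

theorem memLp_fourier {f : ℝ → ℂ} (h1 : Integrable f) (h2 : MemLp f 2) : MemLp (𝓕 f) 2 :=
  (memLp_congr_ae (fourier_toLp_ae h1 h2)).1 (Lp.memLp _)

theorem fourier_toLp_eq {f : ℝ → ℂ} (h1 : Integrable f) (h2 : MemLp f 2) :
    𝓕 (h2.toLp f) = (memLp_fourier h1 h2).toLp (𝓕 f) :=
  Lp.ext ((fourier_toLp_ae h1 h2).trans (MemLp.coeFn_toLp _).symm)

/-- On `L¹ ∩ L²` the inverse of the `L²` Fourier transform is given by the inverse Fourier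
integral. -/
theorem fourierInv_toLp_ae {f : ℝ → ℂ} (h1 : Integrable f) (h2 : MemLp f 2) :
    ((𝓕⁻ (h2.toLp f) : Lp ℂ 2 (volume : Measure ℝ)) : ℝ → ℂ) =ᵐ[volume] 𝓕⁻ f := by
  refine ae_eq_of_integral_contDiff_smul_eq ((Lp.memLp _).locallyIntegrable (by norm_num))
    (continuous_fourierInv h1).locallyIntegrable fun g hg hc => ?_
  have hg₁ : HasCompactSupport (Complex.ofRealCLM ∘ g) := hc.comp_left rfl
  have hg₂ : ContDiff ℝ ∞ (Complex.ofRealCLM ∘ g) := by fun_prop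
  set G : 𝓢(ℝ, ℂ) := hg₁.toSchwartzMap hg₂
  have e : ∀ x, G x = (g x : ℂ) := fun x => by simp [G]
  have key := congrArg (fun T => T G)
    (Lp.fourierInv_toTemperedDistribution_eq (h2.toLp f))
  simp only [TemperedDistribution.fourierInv_apply, Lp.toTemperedDistribution_apply] at key
  have l : ∫ x, g x • ((𝓕⁻ (h2.toLp f) : Lp ℂ 2 (volume : Measure ℝ)) : ℝ → ℂ) x =
      ∫ x, G x • ((𝓕⁻ (h2.toLp f) : Lp ℂ 2 (volume : Measure ℝ)) : ℝ → ℂ) x := by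
    simp [e]
  have r : ∫ x, g x • 𝓕⁻ f x = ∫ x, G (-x) • 𝓕 f x := by
    rw [← integral_neg_eq_self]
    simp [e, Real.fourierInv_eq_fourier_neg]
  have hGn : Integrable (fun x => G (-x)) := G.integrable.comp_neg
  have hFn : 𝓕 (fun x => G (-x)) = 𝓕⁻ (G : ℝ → ℂ) :=
    (Real.fourierInv_eq_fourier_comp_neg (G : ℝ → ℂ)).symm
  rw [l, r, ← key, integral_smul_fourier_eq h1 hGn, SchwartzMap.fourierInv_coe, hFn]
  refine integral_congr_ae ?_
  filter_upwards [h2.coeFn_toLp] with x hx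
  rw [hx]

/-- Plancherel's theorem for the `L²` norm of a Fourier integral. -/
theorem eLpNorm_fourier {f : ℝ → ℂ} (h1 : Integrable f) (h2 : MemLp f 2) :
    eLpNorm (𝓕 f) 2 volume = eLpNorm f 2 volume := by
  have h := Lp.norm_fourier_eq (h2.toLp f)
  rw [fourier_toLp_eq h1 h2, Lp.norm_toLp, Lp.norm_toLp] at h
  exact (ENNReal.toReal_eq_toReal_iff' (memLp_fourier h1 h2).2.ne h2.2.ne).1 h

/-- Parseval's identity for Fourier integrals of functions in `L¹ ∩ L²`. -/
theorem integral_conj_fourier_mul_fourier {f g : ℝ → ℂ} (hf1 : Integrable f) (hf2 : MemLp f 2)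
    (hg1 : Integrable g) (hg2 : MemLp g 2) :
    ∫ y, conj (𝓕 f y) * 𝓕 g y = ∫ u, conj (f u) * g u := by
  have h := Lp.inner_fourier_eq (hf2.toLp f) (hg2.toLp g)
  rw [L2.inner_def, L2.inner_def] at h
  calc ∫ y, conj (𝓕 f y) * 𝓕 g y
      = ∫ y, inner ℂ ((𝓕 (hf2.toLp f) : Lp ℂ 2 (volume : Measure ℝ)) y)
          ((𝓕 (hg2.toLp g) : Lp ℂ 2 (volume : Measure ℝ)) y) := by
        refine integral_congr_ae ?_
        filter_upwards [fourier_toLp_ae hf1 hf2, fourier_toLp_ae hg1 hg2] with y h1 h2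
        rw [h1, h2, RCLike.inner_apply, mul_comm]
    _ = _ := h
    _ = _ := by
        refine integral_congr_ae ?_
        filter_upwards [hf2.coeFn_toLp, hg2.coeFn_toLp] with y h1 h2
        rw [h1, h2, RCLike.inner_apply, mul_comm]

end Fourier

/-! ### The kernel of the Mellin transform -/

theorem lintegral_comp_mul_left {a : ℝ} (ha : a ≠ 0) (f : ℝ → ℝ≥0∞) :
    ∫⁻ y, f (a * y) = ENNReal.ofReal |a⁻¹| * ∫⁻ y, f y := by
  have h := (Homeomorph.mulLeft₀ a ha).measurableEmbedding.lintegral_map (μ := volume) f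
  have e : Measure.map (Homeomorph.mulLeft₀ a ha) (volume : Measure ℝ) =
      ENNReal.ofReal |a⁻¹| • volume := Real.map_volume_mul_left ha
  rw [e, lintegral_smul_measure] at h
  exact h.symm

theorem memLp_comp_mul_left {a : ℝ} (ha : a ≠ 0) {f : ℝ → ℂ} (hf : MemLp f 2) :
    MemLp (fun y => f (a * y)) 2 := by
  have e : Measure.map (a * ·) (volume : Measure ℝ) = ENNReal.ofReal |a⁻¹| • volume :=
    Real.map_volume_mul_left ha
  have h : MemLp f 2 (Measure.map (a * ·) (volume : Measure ℝ)) := by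
    rw [e]
    exact hf.smul_measure ENNReal.ofReal_ne_top
  exact h.comp_of_map (measurable_const_mul a).aemeasurable

theorem eLpNorm_two_sq {α : Type*} [MeasurableSpace α] (μ : Measure α) (f : α → ℂ) :
    eLpNorm f 2 μ ^ 2 = ∫⁻ y, ‖f y‖ₑ ^ 2 ∂μ := by
  rw [eLpNorm_eq_lintegral_rpow_enorm_toReal (by norm_num) (by norm_num)]
  rw [← ENNReal.rpow_natCast, ← ENNReal.rpow_mul]
  norm_num

theorem memLp_two_of_lintegral_lt_top {α : Type*} [MeasurableSpace α] {μ : Measure α} {f : α → ℂ}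
    (hf : AEStronglyMeasurable f μ) (h : ∫⁻ y, ‖f y‖ₑ ^ 2 ∂μ < ∞) : MemLp f 2 μ := by
  refine ⟨hf, ?_⟩
  rw [← eLpNorm_two_sq] at h
  by_contra hc
  rw [not_lt, top_le_iff] at hc
  simp [hc] at h

theorem lintegral_sq_lt_top {α : Type*} [MeasurableSpace α] {μ : Measure α} {f : α → ℂ}
    (hf : MemLp f 2 μ) : ∫⁻ y, ‖f y‖ₑ ^ 2 ∂μ < ∞ := by
  rw [← eLpNorm_two_sq]
  exact ENNReal.pow_lt_top hf.2

theorem integrable_conj_mul {α : Type*} [MeasurableSpace α] {μ : Measure α} {f g : α → ℂ}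
    (hf : MemLp f 2 μ) (hg : MemLp g 2 μ) : Integrable (fun y => conj (f y) * g y) μ :=
  (hf.star).integrable_mul hg

/-- The kernel `exp(-zu - e^{-u})` of the Mellin transform, in the variable `u = -log t`: it is
`t^z e^{-t}`. -/
noncomputable def expKernel (z : ℂ) (u : ℝ) : ℂ :=
  Complex.exp (-z * u - (Real.exp (-u) : ℝ))

theorem continuous_expKernel (z : ℂ) : Continuous (expKernel z) := by
  unfold expKernel
  fun_prop

theorem norm_expKernel (z : ℂ) (u : ℝ) :
    ‖expKernel z u‖ = Real.exp (-z.re * u - Real.exp (-u)) := by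
  rw [expKernel, Complex.norm_exp, Complex.sub_re, Complex.ofReal_re, Complex.mul_re]
  simp

theorem conj_expKernel (z : ℂ) (u : ℝ) : conj (expKernel z u) = expKernel (conj z) u := by
  rw [expKernel, expKernel, ← Complex.exp_conj]
  simp only [map_sub, map_mul, map_neg, Complex.conj_ofReal]

/-- The kernel is bounded, uniformly for `0 ≤ Re z ≤ b`. -/
theorem exists_norm_expKernel_le (b : ℝ) :
    ∃ C : ℝ, 0 ≤ C ∧ ∀ z : ℂ, 0 ≤ z.re → z.re ≤ b → ∀ u, ‖expKernel z u‖ ≤ C := by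
  rcases lt_or_ge b 0 with hb | hb
  · exact ⟨0, le_rfl, fun z h1 h2 => absurd (h1.trans h2) (not_le.2 hb)⟩
  set a := Real.log (2 * b + 3) with ha
  have hpos : 0 < 2 * b + 3 := by linarith
  have ha1 : 1 ≤ a := by
    rw [ha, Real.le_log_iff_exp_le hpos]
    linarith [Real.exp_one_lt_d9]
  refine ⟨Real.exp (b * (a - 1)), (Real.exp_pos _).le, fun z h1 h2 u => ?_⟩
  rw [norm_expKernel, Real.exp_le_exp]
  -- the tangent line inequality at `-u = a`, scaled so that `b e^{-a} ≤ 1`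
  have h3 : -u ≤ Real.exp (-u) * (2 * b + 3)⁻¹ + a - 1 := by
    have := Real.add_one_le_exp (-u - a)
    rw [Real.exp_sub, Real.exp_log hpos, div_eq_mul_inv] at this
    linarith
  have h4 : z.re * (Real.exp (-u) * (2 * b + 3)⁻¹) ≤ Real.exp (-u) := by
    rw [mul_left_comm]
    refine mul_le_of_le_one_right (Real.exp_pos _).le ?_
    rw [← div_eq_mul_inv, div_le_one hpos]
    linarith
  have h5 := mul_le_mul_of_nonneg_left h3 h1
  have h6 := mul_le_mul_of_nonneg_right h2 (sub_nonneg.2 ha1)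
  nlinarith

/-- The substitution `t = e^{-u}` in Euler's integral. -/
theorem integral_exp_neg_mul_sub_exp {s : ℂ} (hs : 0 < s.re) {c : ℝ} (hc : 0 < c) :
    ∫ u : ℝ, Complex.exp (-s * u - c * (Real.exp (-u) : ℝ)) =
      (1 / c : ℂ) ^ s * Complex.Gamma s := by
  have h := mellin_eq_fourier (fun t : ℝ => Complex.exp (-(c * t))) (s := s)
  rw [Real.fourier_eq'] at h
  have e : mellin (fun t : ℝ => Complex.exp (-(c * t))) s = (1 / c : ℂ) ^ s * Complex.Gamma s := by
    rw [← Complex.integral_cpow_mul_exp_neg_mul_Ioi hs hc]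
    simp [mellin]
  rw [← e, h]
  refine integral_congr_ae (Eventually.of_forall fun u => ?_)
  simp only [smul_eq_mul, Complex.real_smul]
  rw [Complex.ofReal_exp (-s.re * u), ← Complex.exp_add, ← Complex.exp_add]
  congr 1
  have hpi : (Real.pi : ℂ) ≠ 0 := by exact_mod_cast Real.pi_ne_zero
  simp
  field_simp
  linear_combination (u : ℂ) * Complex.re_add_im s

theorem integrable_exp_neg_mul_sub_exp {s : ℝ} (hs : 0 < s) {c : ℝ} (hc : 0 < c) :
    Integrable fun u : ℝ => Real.exp (-s * u - c * Real.exp (-u)) := by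
  -- a non-integrable function would have integral zero
  by_contra hcon
  have h := integral_exp_neg_mul_sub_exp (s := (s : ℂ)) (by simpa using hs) hc
  have e : ∀ u : ℝ, Complex.exp (-(s : ℂ) * u - c * (Real.exp (-u) : ℝ)) =
      ((Real.exp (-s * u - c * Real.exp (-u)) : ℝ) : ℂ) := fun u => by push_cast; rfl
  simp_rw [e] at h
  rw [integral_complex_ofReal, integral_undef hcon] at h
  have h1 : (1 / c : ℂ) ^ (s : ℂ) ≠ 0 := by
    rw [Ne, Complex.cpow_eq_zero_iff]
    simp [hc.ne']
  exact mul_ne_zero h1 (Complex.Gamma_ne_zero_of_re_pos (s := (s : ℂ)) (by simpa using hs))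
    (by simpa using h.symm)

theorem memLp_expKernel {z : ℂ} (hz : 0 < z.re) : MemLp (expKernel z) 2 := by
  rw [memLp_two_iff_integrable_sq_norm (continuous_expKernel z).aestronglyMeasurable]
  refine (integrable_exp_neg_mul_sub_exp (s := 2 * z.re) (by linarith) two_pos).congr
    (Eventually.of_forall fun u => ?_)
  simp only [norm_expKernel]
  rw [← Real.exp_nat_mul]
  congr 1
  push_cast
  ring

theorem integral_expKernel_mul {z w : ℂ} (h : 0 < (z + w).re) :
    ∫ u, expKernel z u * expKernel w u = (1 / 2 : ℂ) ^ (z + w) * Complex.Gamma (z + w) := by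
  have := integral_exp_neg_mul_sub_exp h two_pos
  rw [Complex.ofReal_ofNat] at this
  rw [← this]
  refine integral_congr_ae (Eventually.of_forall fun u => ?_)
  simp only [expKernel]
  rw [← Complex.exp_add]
  congr 1
  ring

/-! ### The Mellin transform of a square integrable function -/

/-- The Mellin transform `∫ χ(u) exp(-zu - e^{-u}) du` of `χ ∈ L²(ℝ)` against the weight
`e^{-t}`, `t = e^{-u}`. -/
noncomputable def gammaTransform (χ : ℝ → ℂ) (z : ℂ) : ℂ := ∫ u, χ u * expKernel z u

variable {χ ψ : ℝ → ℂ}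

theorem integrable_mul_expKernel (hχ : MemLp χ 2) {z : ℂ} (hz : 0 < z.re) :
    Integrable fun u => χ u * expKernel z u :=
  hχ.integrable_mul (memLp_expKernel hz)

theorem memLp_mul_expKernel (hχ : MemLp χ 2) {z : ℂ} (hz : 0 ≤ z.re) :
    MemLp (fun u => χ u * expKernel z u) 2 := by
  obtain ⟨C, -, hC⟩ := exists_norm_expKernel_le z.re
  have h : MemLp (expKernel z) ∞ :=
    memLp_top_of_bound (continuous_expKernel z).aestronglyMeasurable C
      (Eventually.of_forall fun u => hC z hz le_rfl u)
  exact h.mul' (r := 2) hχ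

/-- On a vertical line the transform is a Fourier transform. -/
theorem gammaTransform_line (χ : ℝ → ℂ) (x y : ℝ) :
    gammaTransform χ (x + y * Complex.I) =
      FourierTransform.fourier (fun u => χ u * expKernel x u) ((2 * Real.pi)⁻¹ * y) := by
  rw [gammaTransform, Real.fourier_eq']
  refine integral_congr_ae (Eventually.of_forall fun u => ?_)
  simp only [smul_eq_mul, expKernel]
  rw [mul_left_comm, ← Complex.exp_add]
  congr 2
  have hpi : (Real.pi : ℂ) ≠ 0 := by exact_mod_cast Real.pi_ne_zero
  simp
  field_simp
  ring

theorem abs_inv_inv_two_pi : |((2 * Real.pi)⁻¹)⁻¹| = 2 * Real.pi := by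
  rw [inv_inv, abs_of_pos Real.two_pi_pos]

/-- Plancherel's theorem on a vertical line. -/
theorem lintegral_gammaTransform_line (hχ : MemLp χ 2) {x : ℝ} (hx : 0 < x) :
    ∫⁻ y : ℝ, ‖gammaTransform χ (x + y * Complex.I)‖ₑ ^ 2 =
      ENNReal.ofReal (2 * Real.pi) * ∫⁻ u, ‖χ u * expKernel x u‖ₑ ^ 2 := by
  simp_rw [gammaTransform_line]
  rw [lintegral_comp_mul_left (inv_ne_zero Real.two_pi_pos.ne')
    (fun y => ‖FourierTransform.fourier (fun u => χ u * expKernel x u) y‖ₑ ^ 2),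
    abs_inv_inv_two_pi, ← eLpNorm_two_sq,
    eLpNorm_fourier (integrable_mul_expKernel hχ (by simpa using hx))
    (memLp_mul_expKernel hχ (by simpa using hx.le)), eLpNorm_two_sq]

theorem integral_comp_inv_two_pi_mul (f : ℝ → ℂ) :
    ∫ y, f ((2 * Real.pi)⁻¹ * y) = 2 * Real.pi * ∫ y, f y := by
  rw [Measure.integral_comp_mul_left, abs_inv_inv_two_pi, Complex.real_smul]
  push_cast
  rfl

/-- Parseval's identity on a vertical line. -/
theorem integral_conj_gammaTransform_line (hχ : MemLp χ 2) (hψ : MemLp ψ 2) {x : ℝ} (hx : 0 < x) :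
    ∫ y : ℝ, conj (gammaTransform χ (x + y * Complex.I)) *
        gammaTransform ψ (x + y * Complex.I) =
      2 * Real.pi * ∫ u, conj (χ u * expKernel x u) * (ψ u * expKernel x u) := by
  simp_rw [gammaTransform_line]
  rw [integral_comp_inv_two_pi_mul (fun y =>
    conj (FourierTransform.fourier (fun u => χ u * expKernel x u) y) *
      FourierTransform.fourier (fun u => ψ u * expKernel x u) y),
    integral_conj_fourier_mul_fourier]
  · exact integrable_mul_expKernel hχ (by simpa using hx)
  · exact memLp_mul_expKernel hχ (by simpa using hx.le)
  · exact integrable_mul_expKernel hψ (by simpa using hx)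
  · exact memLp_mul_expKernel hψ (by simpa using hx.le)

/-- The weights of `ω`, transported to the `u`-line, add up to `e^{2 exp(-u)}`. -/
theorem tsum_weight (u : ℝ) :
    ∑' n : ℕ, ENNReal.ofReal (2 ^ n / (n ! : ℝ)) * ENNReal.ofReal (Real.exp (-n * u)) =
      ENNReal.ofReal (Real.exp (2 * Real.exp (-u))) := by
  have e : ∀ n : ℕ, 2 ^ n / (n ! : ℝ) * Real.exp (-n * u) = (2 * Real.exp (-u)) ^ n / n ! := by
    intro n
    rw [mul_pow, ← Real.exp_nat_mul, show -(n : ℝ) * u = n * -u by ring]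
    ring
  have hs : HasSum (fun n : ℕ => (2 * Real.exp (-u)) ^ n / (n ! : ℝ))
      (Real.exp (2 * Real.exp (-u))) := by
    rw [Real.exp_eq_exp_ℝ]
    exact NormedSpace.expSeries_div_hasSum_exp _
  rw [← hs.tsum_eq, ENNReal.ofReal_tsum_of_nonneg (fun n => by positivity) hs.summable]
  refine tsum_congr fun n => ?_
  rw [← ENNReal.ofReal_mul (by positivity), e]

theorem differentiableOn_gammaTransform (hχ : MemLp χ 2) :
    DifferentiableOn ℂ (gammaTransform χ) rightHalfPlane := by
  intro z hz
  have hz : 0 < z.re := hz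
  set c : ℝ := z.re / 4 with hc
  have hc0 : 0 < c := by positivity
  -- on the ball of radius `2c` about `z`, the derivative of the kernel is dominated using
  -- `c |u| ≤ e^{cu} + e^{-cu}`, which shifts `Re w ∈ [2c, 6c]` into `[c, 7c]`
  let bound : ℝ → ℝ := fun u =>
    c⁻¹ * (‖χ u * expKernel (c : ℂ) u‖ + ‖χ u * expKernel (7 * c : ℂ) u‖)
  have hb : Integrable bound := by
    refine Integrable.const_mul (Integrable.add ?_ ?_) _
    · exact (integrable_mul_expKernel hχ (by simpa using hc0)).norm
    · exact (integrable_mul_expKernel hχ (by simpa using hc0)).norm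
  have key := hasDerivAt_integral_of_dominated_loc_of_deriv_le (μ := volume) (𝕜 := ℂ)
    (F := fun z u => χ u * expKernel z u) (F' := fun z u => χ u * (expKernel z u * (-u)))
    (bound := bound) (x₀ := z) (s := Metric.ball z (2 * c)) (Metric.ball_mem_nhds _ (by positivity))
    (Eventually.of_forall fun w => hχ.1.mul (continuous_expKernel w).aestronglyMeasurable)
    (integrable_mul_expKernel hχ hz)
    (hχ.1.mul ((continuous_expKernel z).mul (by fun_prop)).aestronglyMeasurable) ?_ hb ?_
  · exact key.2.differentiableAt.differentiableWithinAt
  · refine Eventually.of_forall fun u w hw => ?_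
    have hw1 : |w.re - z.re| < 2 * c := by
      have := (Complex.abs_re_le_norm (w - z)).trans_lt (mem_ball_iff_norm.1 hw)
      rwa [Complex.sub_re] at this
    rw [abs_lt] at hw1
    have hw2 : 2 * c ≤ w.re := by rw [hc] at hw1 ⊢; linarith [hw1.1]
    have hw3 : w.re ≤ 6 * c := by rw [hc] at hw1 ⊢; linarith [hw1.2]
    simp only [bound, norm_mul, norm_neg, Complex.norm_real, Real.norm_eq_abs, norm_expKernel]
    rw [← mul_add, mul_left_comm c⁻¹]
    refine mul_le_mul_of_nonneg_left ?_ (norm_nonneg (χ u))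
    rw [← div_eq_inv_mul, le_div_iff₀ hc0]
    have e1 : Real.exp (-w.re * u - Real.exp (-u)) * |u| * c =
        (c * |u|) * Real.exp (-w.re * u - Real.exp (-u)) := by ring
    rw [e1]
    have hcu : c * |u| ≤ Real.exp (c * |u|) := by linarith [Real.add_one_le_exp (c * |u|)]
    refine (mul_le_mul_of_nonneg_right hcu (Real.exp_pos _).le).trans ?_
    rw [← Real.exp_add]
    rcases le_total 0 u with hu | hu
    · rw [abs_of_nonneg hu]
      refine (Real.exp_le_exp.2 ?_).trans (le_add_of_nonneg_right (Real.exp_pos _).le)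
      simp
      nlinarith
    · rw [abs_of_nonpos hu]
      refine (Real.exp_le_exp.2 ?_).trans (le_add_of_nonneg_left (Real.exp_pos _).le)
      simp
      nlinarith
  · refine Eventually.of_forall fun u w _ => ?_
    have h1 : HasDerivAt (fun w : ℂ => -w * u - (Real.exp (-u) : ℝ)) (-u) w := by
      simpa using ((hasDerivAt_id w).neg.mul_const (u : ℂ)).sub_const ((Real.exp (-u) : ℝ) : ℂ)
    exact (h1.cexp).const_mul _

/-! ### Boundary values of the transform -/

/-- Boundary values are unique up to null sets. -/
theorem IsBoundaryValue.ae_eq {F : ℂ → ℂ} {u v : ℝ → ℂ}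
    (hF : ∀ x : ℝ, 0 < x → AEStronglyMeasurable (fun y : ℝ => F (x + y * Complex.I)) volume)
    (hu : IsBoundaryValue F u) (hv : IsBoundaryValue F v) : u =ᵐ[volume] v := by
  have h0 : eLpNorm (u - v) 2 volume = 0 := by
    have h := hu.2.add hv.2
    rw [add_zero] at h
    refine le_antisymm (ge_of_tendsto h ?_) zero_le
    filter_upwards [self_mem_nhdsWithin] with x hx
    have e : u - v = (fun y : ℝ => F (x + y * Complex.I) - v y) -
        fun y : ℝ => F (x + y * Complex.I) - u y := by
      funext y
      simp
    rw [e, add_comm]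
    exact eLpNorm_sub_le ((hF x hx).sub hv.1.1) ((hF x hx).sub hu.1.1) (by norm_num)
  rw [eLpNorm_eq_zero_iff (hu.1.1.sub hv.1.1) (by norm_num)] at h0
  exact (sub_ae_eq_zero _ _).1 h0

/-- The boundary value of the transform of `χ`: the `L²` Fourier transform of
`χ(u) exp(-e^{-u})`, at the frequency `y / 2π`. -/
noncomputable def gammaBoundary (hχ : MemLp χ 2) (y : ℝ) : ℂ :=
  (FourierTransform.fourier
    ((memLp_mul_expKernel hχ (z := ((0 : ℝ) : ℂ)) (by simp)).toLp) : Lp ℂ 2 (volume : Measure ℝ))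
    ((2 * Real.pi)⁻¹ * y)

theorem memLp_gammaBoundary (hχ : MemLp χ 2) : MemLp (gammaBoundary hχ) 2 :=
  memLp_comp_mul_left (inv_ne_zero Real.two_pi_pos.ne') (Lp.memLp _)

theorem integral_conj_gammaBoundary (hχ : MemLp χ 2) (hψ : MemLp ψ 2) :
    ∫ y : ℝ, conj (gammaBoundary hχ y) * gammaBoundary hψ y =
      2 * Real.pi * ∫ u, conj (χ u * expKernel (0 : ℝ) u) * (ψ u * expKernel (0 : ℝ) u) := by
  set f := (memLp_mul_expKernel hχ (z := ((0 : ℝ) : ℂ)) (by simp)).toLp with hf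
  set g := (memLp_mul_expKernel hψ (z := ((0 : ℝ) : ℂ)) (by simp)).toLp with hg
  have h := Lp.inner_fourier_eq f g
  rw [L2.inner_def, L2.inner_def] at h
  have e := integral_comp_inv_two_pi_mul (fun y =>
    inner ℂ ((FourierTransform.fourier f : Lp ℂ 2 (volume : Measure ℝ)) y)
      ((FourierTransform.fourier g : Lp ℂ 2 (volume : Measure ℝ)) y))
  rw [h] at e
  convert e using 2
  · funext y
    simp only [gammaBoundary, RCLike.inner_apply, ← hf, ← hg]
    exact mul_comm _ _
  · refine integral_congr_ae ?_
    filter_upwards [(memLp_mul_expKernel hχ (z := ((0 : ℝ) : ℂ)) (by simp)).coeFn_toLp,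
      (memLp_mul_expKernel hψ (z := ((0 : ℝ) : ℂ)) (by simp)).coeFn_toLp] with u h1 h2
    rw [hf, hg, h1, h2, RCLike.inner_apply, mul_comm]

/-- The distance between the transform on a line and its boundary value, by Plancherel's theorem. -/
theorem eLpNorm_gammaTransform_sub_gammaBoundary (hχ : MemLp χ 2) {x : ℝ} (hx : 0 < x) :
    eLpNorm (fun y : ℝ => gammaTransform χ (x + y * Complex.I) - gammaBoundary hχ y) 2 volume ^ 2 =
      ENNReal.ofReal (2 * Real.pi) *
        ∫⁻ u, ‖χ u * expKernel x u - χ u * expKernel (0 : ℝ) u‖ₑ ^ 2 := by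
  have h1 := integrable_mul_expKernel hχ (z := (x : ℂ)) (by simpa using hx)
  have h2 := memLp_mul_expKernel hχ (z := (x : ℂ)) (by simpa using hx.le)
  have h3 := memLp_mul_expKernel hχ (z := ((0 : ℝ) : ℂ)) (by simp)
  let D : ℝ → ℂ := fun y => FourierTransform.fourier (fun u => χ u * expKernel x u) y -
    (FourierTransform.fourier h3.toLp : Lp ℂ 2 (volume : Measure ℝ)) y
  have e : (fun y : ℝ => gammaTransform χ (x + y * Complex.I) - gammaBoundary hχ y) =
      fun y => D ((2 * Real.pi)⁻¹ * y) := by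
    funext y
    rw [gammaTransform_line, gammaBoundary]
  have hD : D =ᵐ[volume]
      (FourierTransform.fourier (h2.toLp - h3.toLp) : Lp ℂ 2 (volume : Measure ℝ)) := by
    have hs : FourierTransform.fourier (h2.toLp - h3.toLp) =
        FourierTransform.fourier h2.toLp - FourierTransform.fourier h3.toLp :=
      map_sub (Lp.fourierTransformₗᵢ ℝ ℂ) _ _
    rw [hs]
    filter_upwards [fourier_toLp_ae h1 h2, Lp.coeFn_sub (FourierTransform.fourier h2.toLp)
      (FourierTransform.fourier h3.toLp)] with y e1 e2
    rw [e2, Pi.sub_apply, e1]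
  have hn : eLpNorm D 2 volume =
      eLpNorm (fun u => χ u * expKernel x u - χ u * expKernel (0 : ℝ) u) 2 volume := by
    rw [eLpNorm_congr_ae hD]
    have := Lp.norm_fourier_eq (h2.toLp - h3.toLp)
    rw [← MemLp.toLp_sub] at this ⊢
    rw [Lp.norm_toLp, Lp.norm_def] at this
    exact (ENNReal.toReal_eq_toReal_iff' (Lp.memLp _).2.ne (h2.sub h3).2.ne).1 this
  rw [e, eLpNorm_two_sq, lintegral_comp_mul_left (inv_ne_zero Real.two_pi_pos.ne')
    (fun y => ‖D y‖ₑ ^ 2), abs_inv_inv_two_pi, ← eLpNorm_two_sq, hn, eLpNorm_two_sq]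

theorem tendsto_lintegral_mul_expKernel_sub (hχ : MemLp χ 2) :
    Tendsto (fun x : ℝ => ∫⁻ u, ‖χ u * expKernel x u - χ u * expKernel (0 : ℝ) u‖ₑ ^ 2)
      (𝓝[>] 0) (𝓝 0) := by
  obtain ⟨C, hC0, hC⟩ := exists_norm_expKernel_le 1
  have h := tendsto_lintegral_filter_of_dominated_convergence' (μ := volume) (l := 𝓝[>] (0 : ℝ))
    (F := fun x u => ‖χ u * expKernel (x : ℝ) u - χ u * expKernel (0 : ℝ) u‖ₑ ^ 2) (f := fun _ => 0)
    (fun u => ‖χ u‖ₑ ^ 2 * ENNReal.ofReal (2 * C) ^ 2) ?_ ?_ ?_ ?_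
  · simpa using h
  · refine Eventually.of_forall fun x => ?_
    exact ((hχ.1.mul (continuous_expKernel _).aestronglyMeasurable).sub
      (hχ.1.mul (continuous_expKernel _).aestronglyMeasurable)).enorm.pow_const 2
  · filter_upwards [Ioo_mem_nhdsGT (zero_lt_one' ℝ)] with x hx
    refine Eventually.of_forall fun u => ?_
    rw [← mul_sub, enorm_mul, mul_pow]
    gcongr
    rw [← ofReal_norm]
    refine ENNReal.ofReal_le_ofReal ((norm_sub_le _ _).trans ?_)
    have h1 := hC (x : ℂ) (by simpa using hx.1.le) (by simpa using hx.2.le) u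
    have h2 := hC ((0 : ℝ) : ℂ) (by simp) (by simp) u
    linarith
  · rw [lintegral_mul_const' _ _ (by finiteness)]
    exact ENNReal.mul_ne_top (lintegral_sq_lt_top hχ).ne (by finiteness)
  · refine Eventually.of_forall fun u => ?_
    have hc : Continuous fun x : ℝ => ‖χ u * expKernel x u - χ u * expKernel (0 : ℝ) u‖ₑ ^ 2 := by
      refine (ENNReal.continuous_pow 2).comp (continuous_enorm.comp ?_)
      unfold expKernel
      fun_prop
    have := hc.tendsto 0
    simp only [sub_self, enorm_zero] at this
    refine (this.mono_left nhdsWithin_le_nhds).trans_eq ?_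
    simp

variable {F G : ℂ → ℂ}

theorem line_mem {x : ℝ} (hx : 0 < x) (y : ℝ) : (x : ℂ) + y * Complex.I ∈ rightHalfPlane := by
  simpa [rightHalfPlane] using hx

theorem continuous_line (hF : ContinuousOn F rightHalfPlane) {x : ℝ} (hx : 0 < x) :
    Continuous fun y : ℝ => F (x + y * Complex.I) :=
  hF.comp_continuous (by fun_prop) fun y => line_mem hx y

theorem isBoundaryValue_gammaBoundary (hχ : MemLp χ 2)
    (hF : EqOn F (gammaTransform χ) rightHalfPlane) : IsBoundaryValue F (gammaBoundary hχ) := by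
  refine ⟨memLp_gammaBoundary hχ, ?_⟩
  have h : Tendsto (fun x : ℝ =>
      eLpNorm (fun y : ℝ => gammaTransform χ (x + y * Complex.I) - gammaBoundary hχ y) 2 volume ^ 2)
      (𝓝[>] 0) (𝓝 0) := by
    have := ENNReal.Tendsto.const_mul (a := ENNReal.ofReal (2 * Real.pi))
      (tendsto_lintegral_mul_expKernel_sub hχ) (Or.inr (by finiteness))
    rw [mul_zero] at this
    refine this.congr' ?_
    filter_upwards [self_mem_nhdsWithin] with x hx
    rw [eLpNorm_gammaTransform_sub_gammaBoundary hχ hx]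
  have h' := (ENNReal.continuous_rpow_const (y := (1 / 2 : ℝ))).tendsto 0 |>.comp h
  rw [ENNReal.zero_rpow_of_pos (by norm_num)] at h'
  refine h'.congr' ?_
  filter_upwards [self_mem_nhdsWithin] with x hx
  simp only [Function.comp]
  rw [← ENNReal.rpow_natCast, ← ENNReal.rpow_mul]
  norm_num
  congr 1
  funext y
  rw [hF (line_mem hx y)]

theorem boundaryValue_ae_eq (hχ : MemLp χ 2) (hF : EqOn F (gammaTransform χ) rightHalfPlane) :
    boundaryValue F =ᵐ[volume] gammaBoundary hχ := by
  have h := isBoundaryValue_gammaBoundary hχ hF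
  have hex : ∃ u, IsBoundaryValue F u := ⟨_, h⟩
  rw [boundaryValue, dif_pos hex]
  refine IsBoundaryValue.ae_eq (fun x hx => ?_) hex.choose_spec h
  exact (continuous_line ((differentiableOn_gammaTransform hχ).continuousOn.congr hF)
    hx).aestronglyMeasurable

/-! ### The transform belongs to `M²_ω` -/

theorem isHardyStrip_of_eqOn (hχ : MemLp χ 2) (hF : EqOn F (gammaTransform χ) rightHalfPlane)
    (b : ℝ) : IsHardyStrip b F := by
  refine ⟨((differentiableOn_gammaTransform hχ).congr hF).mono fun z hz => hz.1, ?_⟩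
  obtain ⟨C, hC0, hC⟩ := exists_norm_expKernel_le b
  have hfin : ENNReal.ofReal (2 * Real.pi) * ((∫⁻ u, ‖χ u‖ₑ ^ 2) * ENNReal.ofReal C ^ 2) ≠ ∞ :=
    ENNReal.mul_ne_top (by finiteness)
      (ENNReal.mul_ne_top (lintegral_sq_lt_top hχ).ne (by finiteness))
  refine ⟨(ENNReal.ofReal (2 * Real.pi) * ((∫⁻ u, ‖χ u‖ₑ ^ 2) * ENNReal.ofReal C ^ 2)).toNNReal,
    fun x hx => ?_⟩
  rw [ENNReal.coe_toNNReal hfin]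
  calc ∫⁻ y : ℝ, ‖F (x + y * Complex.I)‖ₑ ^ 2
      = ∫⁻ y : ℝ, ‖gammaTransform χ (x + y * Complex.I)‖ₑ ^ 2 := by
        simp_rw [hF (line_mem hx.1 _)]
    _ = _ := lintegral_gammaTransform_line hχ hx.1
    _ ≤ _ := by
        rw [← lintegral_mul_const' _ _ (by finiteness)]
        gcongr with u
        rw [enorm_mul, mul_pow, ← ofReal_norm (expKernel _ _)]
        gcongr
        exact hC (x : ℂ) (by simpa using hx.1.le) (by simpa using hx.2.le) u

theorem measurableEmbedding_line (n : ℕ) :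
    MeasurableEmbedding fun y : ℝ => (n : ℂ) / 2 + y * Complex.I := by
  refine (Continuous.measurableEmbedding (by fun_prop) fun y y' h => ?_)
  simpa using h

theorem lintegral_omega (f : ℂ → ℝ≥0∞) :
    ∫⁻ z, f z ∂omega = ∑' n : ℕ, ENNReal.ofReal (2 ^ n / (n ! : ℝ)) *
      ∫⁻ y : ℝ, f ((n : ℂ) / 2 + y * Complex.I) := by
  rw [omega, lintegral_sum_measure]
  refine tsum_congr fun n => ?_
  rw [lintegral_smul_measure, (measurableEmbedding_line n).lintegral_map, smul_eq_mul]

theorem enorm_expKernel_sq (x u : ℝ) : ‖expKernel x u‖ₑ ^ 2 =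
    ENNReal.ofReal (Real.exp (-(2 * x) * u)) * ENNReal.ofReal (Real.exp (-2 * Real.exp (-u))) := by
  rw [← ofReal_norm, norm_expKernel, ← ENNReal.ofReal_pow (Real.exp_pos _).le,
    ← ENNReal.ofReal_mul (Real.exp_pos _).le, ← Real.exp_nat_mul, ← Real.exp_add]
  congr 2
  simp
  ring

/-- The weights of `ω` against the squared kernels on its lines add up to `1`: this is what makes
the transform an isometry, up to a factor. -/
theorem tsum_weight_mul_enorm_expKernel_sq (u : ℝ) :
    ∑' n : ℕ, ENNReal.ofReal (2 ^ n / (n ! : ℝ)) * ‖expKernel ((n / 2 : ℝ) : ℝ) u‖ₑ ^ 2 = 1 := by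
  simp_rw [enorm_expKernel_sq, ← mul_assoc]
  rw [ENNReal.tsum_mul_right]
  have e : ∀ n : ℕ, -(2 * ((n : ℝ) / 2)) * u = -n * u := fun n => by ring
  simp_rw [e]
  rw [tsum_weight, ← ENNReal.ofReal_mul (Real.exp_pos _).le, ← Real.exp_add]
  simp

theorem tsum_weight_mul_lintegral {h : ℝ → ℝ≥0∞} (hh : AEMeasurable h) :
    ∑' n : ℕ, ENNReal.ofReal (2 ^ n / (n ! : ℝ)) *
      ∫⁻ u, h u * ‖expKernel ((n / 2 : ℝ) : ℝ) u‖ₑ ^ 2 = ∫⁻ u, h u := by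
  have hm : ∀ n : ℕ, AEMeasurable
      (fun u => h u * ‖expKernel ((n / 2 : ℝ) : ℝ) u‖ₑ ^ 2) volume := fun n =>
    hh.mul ((continuous_expKernel _).enorm.measurable.pow_const 2).aemeasurable
  simp_rw [← fun n : ℕ => lintegral_const_mul'' (ENNReal.ofReal (2 ^ n / (n ! : ℝ))) (hm n)]
  rw [← lintegral_tsum fun n => (hm n).const_mul _]
  refine lintegral_congr fun u => ?_
  simp_rw [mul_left_comm _ (h u)]
  rw [ENNReal.tsum_mul_left, tsum_weight_mul_enorm_expKernel_sq, mul_one]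

theorem line_cast (n : ℕ) (y : ℝ) :
    (n : ℂ) / 2 + y * Complex.I = ((n / 2 : ℝ) : ℂ) + y * Complex.I := by
  push_cast
  rfl

theorem memLp_closedExt (hχ : MemLp χ 2) (hF : EqOn F (gammaTransform χ) rightHalfPlane) :
    MemLp (closedExt F) 2 omega := by
  rw [memLp_closedExt_iff]
  refine memLp_two_of_lintegral_lt_top ?_ ?_
  · rw [aestronglyMeasurable_indicator_iff measurableSet_rightHalfPlane]
    exact ((differentiableOn_gammaTransform hχ).continuousOn.congr hF).aestronglyMeasurable
      measurableSet_rightHalfPlane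
  · rw [lintegral_omega]
    have hle : ∀ n : ℕ, ∫⁻ y : ℝ, ‖rightHalfPlane.indicator F ((n : ℂ) / 2 + y * Complex.I)‖ₑ ^ 2 ≤
        ENNReal.ofReal (2 * Real.pi) *
          ∫⁻ u, ‖χ u‖ₑ ^ 2 * ‖expKernel ((n / 2 : ℝ) : ℝ) u‖ₑ ^ 2 := by
      intro n
      rcases Nat.eq_zero_or_pos n with rfl | hn
      · simp [rightHalfPlane, indicator]
      · have hx : (0 : ℝ) < n / 2 := by positivity
        simp_rw [← mul_pow, ← enorm_mul]
        rw [← lintegral_gammaTransform_line hχ hx]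
        refine (lintegral_congr fun y => ?_).le
        rw [line_cast, indicator_of_mem (line_mem hx y), hF (line_mem hx y)]
    refine (ENNReal.tsum_le_tsum fun n => mul_le_mul_right (hle n) _).trans_lt ?_
    simp_rw [mul_left_comm _ (ENNReal.ofReal (2 * Real.pi))]
    rw [ENNReal.tsum_mul_left, tsum_weight_mul_lintegral (hχ.1.enorm.pow_const 2)]
    exact ENNReal.mul_lt_top (by finiteness) (lintegral_sq_lt_top hχ)

theorem hasSum_of_eq {f g : ℕ → ℂ} {a : ℂ} (h : HasSum f a) (e : ∀ n, g n = f n) : HasSum g a := by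
  rwa [funext e]

theorem hasSum_integral_omega {f : ℂ → ℂ} (hf : Integrable f omega) :
    HasSum (fun n : ℕ => ((2 ^ n / (n ! : ℝ) : ℝ) : ℂ) *
      ∫ y : ℝ, f ((n : ℂ) / 2 + y * Complex.I)) (∫ z, f z ∂omega) := by
  have h := hasSum_integral_measure (show Integrable f (Measure.sum _) from hf)
  refine hasSum_of_eq h fun n => ?_
  rw [integral_smul_measure, (measurableEmbedding_line n).integral_map,
    ENNReal.toReal_ofReal (by positivity), Complex.real_smul]

theorem conj_mul_expKernel (x u : ℝ) (a b : ℂ) :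
    conj (a * expKernel x u) * (b * expKernel x u) =
      ((‖expKernel x u‖ ^ 2 : ℝ) : ℂ) * (conj a * b) := by
  rw [map_mul, Complex.ofReal_pow, ← Complex.conj_mul']
  ring

/-- An integral over the `u`-line is distributed over the lines of `ω` by the partition of unity
`tsum_weight_mul_enorm_expKernel_sq`. -/
theorem hasSum_weight_mul_integral {f : ℝ → ℂ} (hf : Integrable f) :
    HasSum (fun n : ℕ => ((2 ^ n / (n ! : ℝ) : ℝ) : ℂ) *
      ∫ u, ((‖expKernel ((n / 2 : ℝ) : ℝ) u‖ ^ 2 : ℝ) : ℂ) * f u) (∫ u, f u) := by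
  let w : ℕ → ℝ → ℝ≥0 := fun n u =>
    Real.toNNReal (2 ^ n / (n ! : ℝ)) * ‖expKernel ((n / 2 : ℝ) : ℝ) u‖₊ ^ 2
  have hwm : ∀ n, Measurable (w n) := fun n =>
    ((continuous_expKernel _).nnnorm.measurable.pow_const 2).const_mul _
  have hw : ∀ u, ∑' n, (w n u : ℝ≥0∞) = 1 := fun u => by
    rw [← tsum_weight_mul_enorm_expKernel_sq u]
    refine tsum_congr fun n => ?_
    simp [w, ENNReal.ofReal, enorm_eq_nnnorm]
  have hsum : Measure.sum (fun n => (volume : Measure ℝ).withDensity fun u => (w n u : ℝ≥0∞)) =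
      volume := by
    rw [← withDensity_tsum fun n => (hwm n).coe_nnreal_ennreal]
    have : (∑' n, fun u => (w n u : ℝ≥0∞)) = 1 := by
      funext u
      rw [ENNReal.tsum_apply, hw, Pi.one_apply]
    rw [this, withDensity_one]
  have h := hasSum_integral_measure (f := f)
    (μ := fun n => (volume : Measure ℝ).withDensity fun u => (w n u : ℝ≥0∞)) (by rwa [hsum])
  rw [hsum] at h
  refine hasSum_of_eq h fun n => ?_
  rw [integral_withDensity_eq_integral_smul (hwm n), ← integral_const_mul]
  refine integral_congr_ae (Eventually.of_forall fun u => ?_)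
  simp only [NNReal.smul_def, Complex.real_smul, w]
  rw [NNReal.coe_mul, Real.coe_toNNReal _ (by positivity)]
  push_cast
  ring

theorem closedExt_line_pos (F : ℂ → ℂ) {n : ℕ} (hn : 0 < n) (y : ℝ) :
    closedExt F ((n : ℂ) / 2 + y * Complex.I) = F (((n / 2 : ℝ) : ℂ) + y * Complex.I) := by
  have : 0 < ((n : ℂ) / 2 + y * Complex.I).re := by
    rw [re_line]
    positivity
  rw [closedExt, if_pos this, line_cast]

theorem closedExt_line_zero (F : ℂ → ℂ) (y : ℝ) :
    closedExt F (((0 : ℕ) : ℂ) / 2 + y * Complex.I) = boundaryValue F y := by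
  simp [closedExt]

/-- The transform is, up to the factor `√(2π)`, an isometry from `L²(ℝ)` into `L²(ω)`. -/
theorem integral_omega_conj_closedExt (hχ : MemLp χ 2) (hψ : MemLp ψ 2)
    (hF : EqOn F (gammaTransform χ) rightHalfPlane)
    (hG : EqOn G (gammaTransform ψ) rightHalfPlane) :
    ∫ z, conj (closedExt F z) * closedExt G z ∂omega =
      2 * Real.pi * ∫ u, conj (χ u) * ψ u := by
  have h1 := hasSum_integral_omega
    (integrable_conj_mul (memLp_closedExt hχ hF) (memLp_closedExt hψ hG))
  have h2 := (hasSum_weight_mul_integral (integrable_conj_mul hχ hψ)).mul_left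
    (2 * Real.pi : ℂ)
  refine h1.unique ?_
  refine hasSum_of_eq h2 fun n => ?_
  rw [mul_left_comm]
  congr 1
  simp_rw [← conj_mul_expKernel]
  rcases Nat.eq_zero_or_pos n with rfl | hn
  · simp_rw [closedExt_line_zero]
    have e : (((0 : ℕ) / 2 : ℝ) : ℂ) = ((0 : ℝ) : ℂ) := by simp
    simp_rw [e]
    rw [← integral_conj_gammaBoundary hχ hψ]
    refine integral_congr_ae ?_
    filter_upwards [boundaryValue_ae_eq hχ hF, boundaryValue_ae_eq hψ hG] with y e1 e2
    rw [e1, e2]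
  · have hx : (0 : ℝ) < n / 2 := by positivity
    rw [← integral_conj_gammaTransform_line hχ hψ hx]
    simp_rw [closedExt_line_pos _ hn, hF (line_mem hx _), hG (line_mem hx _)]

/-! ### Taylor coefficients as area integrals -/

/-- Cauchy's formula for a Taylor coefficient, with `conj (ζ - c) = r² / (ζ - c)` on the circle. -/
theorem integral_circle_conj_pow_mul {f : ℂ → ℂ} {p : FormalMultilinearSeries ℂ ℂ ℂ} {c : ℂ}
    {R r : ℝ} (hp : HasFPowerSeriesOnBall f p c (ENNReal.ofReal R)) (hr : 0 < r) (hrR : r < R)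
    (m : ℕ) :
    ∫ θ in (0 : ℝ)..2 * Real.pi, conj (circleMap 0 r θ) ^ m * f (c + circleMap 0 r θ) =
      2 * Real.pi * r ^ (2 * m) * p.coeff m := by
  have hd : DifferentiableOn ℂ f (Metric.closedBall c (⟨r, hr.le⟩ : ℝ≥0)) := by
    refine hp.differentiableOn.mono fun z hz => ?_
    rw [Metric.eball_ofReal]
    exact lt_of_le_of_lt hz hrR
  have hq := hd.hasFPowerSeriesOnBall (show (0 : ℝ≥0) < ⟨r, hr.le⟩ from hr)
  rw [hp.hasFPowerSeriesAt.eq_formalMultilinearSeries hq.hasFPowerSeriesAt]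
  have e : (cauchyPowerSeries f c r).coeff m = (2 * Real.pi * Complex.I : ℂ)⁻¹ •
      ∮ z in C(c, r), (1 / (z - c)) ^ m • (z - c)⁻¹ • f z :=
    cauchyPowerSeries_apply f c r m 1
  change _ = 2 * Real.pi * r ^ (2 * m) * (cauchyPowerSeries f c r).coeff m
  rw [e, circleIntegral, smul_eq_mul]
  have hpi : (Real.pi : ℂ) ≠ 0 := by exact_mod_cast Real.pi_ne_zero
  have hint : (∫ θ in (0 : ℝ)..2 * Real.pi, deriv (circleMap c r) θ •
      (1 / (circleMap c r θ - c)) ^ m • (circleMap c r θ - c)⁻¹ • f (circleMap c r θ)) =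
      ∫ θ in (0 : ℝ)..2 * Real.pi, (Complex.I / r ^ (2 * m)) *
        (conj (circleMap 0 r θ) ^ m * f (c + circleMap 0 r θ)) := by
    refine intervalIntegral.integral_congr fun θ _ => ?_
    have h0 : circleMap 0 r θ ≠ 0 := by
      rw [← norm_ne_zero_iff, norm_circleMap_zero, abs_of_pos hr]
      exact hr.ne'
    have h1 : circleMap c r θ - c = circleMap 0 r θ := circleMap_sub_center c r θ
    have h2 : circleMap c r θ = c + circleMap 0 r θ := by rw [← h1]; ring
    have h3 : conj (circleMap 0 r θ) * circleMap 0 r θ = r ^ 2 := by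
      rw [Complex.conj_mul', norm_circleMap_zero, abs_of_pos hr]
    have hr0 : (r : ℂ) ≠ 0 := by exact_mod_cast hr.ne'
    simp only [smul_eq_mul]
    rw [h1, deriv_circleMap, h2, pow_mul, ← h3]
    have h4 : conj (circleMap 0 r θ) ≠ 0 := by simpa using h0
    rw [mul_pow, one_div, inv_pow]
    field_simp
  rw [hint, intervalIntegral.integral_const_mul]
  have hr0 : (r : ℂ) ≠ 0 := by exact_mod_cast hr.ne'
  field_simp

theorem integral_ball_eq_polar {h : ℂ → ℂ} {R : ℝ} (hc : ContinuousOn h (Metric.ball 0 R))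
    (hi : IntegrableOn h (Metric.ball 0 R)) :
    ∫ ζ in Metric.ball 0 R, h ζ =
      ∫ r in Ioo 0 R, (r : ℂ) * ∫ θ in (0 : ℝ)..2 * Real.pi, h (circleMap 0 r θ) := by
  set S : Set (ℝ × ℝ) := Ioo 0 R ×ˢ Ioo (-Real.pi) Real.pi with hS
  have hSm : MeasurableSet S := measurableSet_Ioo.prod measurableSet_Ioo
  have hnorm : ∀ p : ℝ × ℝ, ‖Complex.polarCoord.symm p‖ = |p.1| := Complex.norm_polarCoord_symm
  have hcm : ∀ p : ℝ × ℝ, Complex.polarCoord.symm p = circleMap 0 p.1 p.2 := fun p => by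
    rw [Complex.polarCoord_symm_apply, circleMap, zero_add, Complex.exp_mul_I]
    push_cast
    rfl
  have hmem : ∀ p ∈ polarCoord.target,
      Complex.polarCoord.symm p ∈ Metric.ball (0 : ℂ) R ↔ p.1 < R := by
    intro p hp
    rw [mem_ball_zero_iff, hnorm, abs_of_pos (show 0 < p.1 from hp.1)]
  have hsub : S ⊆ polarCoord.target := fun p hp => ⟨hp.1.1, hp.2⟩
  have hinter : polarCoord.target ∩ {p : ℝ × ℝ | p.1 < R} = S := by
    ext p
    constructor
    · exact fun ⟨h1, h2⟩ => ⟨⟨h1.1, h2⟩, h1.2⟩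
    · exact fun h => ⟨hsub h, h.1.2⟩
  have hRm : MeasurableSet {p : ℝ × ℝ | p.1 < R} := measurableSet_lt measurable_fst measurable_const
  have key : ∫ ζ in Metric.ball 0 R, h ζ = ∫ p in S, (p.1 : ℂ) * h (circleMap 0 p.1 p.2) := by
    rw [← integral_indicator Metric.isOpen_ball.measurableSet,
      ← Complex.integral_comp_polarCoord_symm, ← hinter, ← setIntegral_indicator hRm]
    refine setIntegral_congr_fun polarCoord.open_target.measurableSet fun p hp => ?_
    simp only [Complex.real_smul]
    by_cases hpR : p.1 < R
    · rw [indicator_of_mem ((hmem p hp).2 hpR),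
        indicator_of_mem (show p ∈ {p : ℝ × ℝ | p.1 < R} from hpR), hcm]
    · rw [indicator_of_notMem fun h' => hpR ((hmem p hp).1 h'),
        indicator_of_notMem (show p ∉ {p : ℝ × ℝ | p.1 < R} from hpR), mul_zero]
  have hint : IntegrableOn (fun p : ℝ × ℝ => (p.1 : ℂ) * h (circleMap 0 p.1 p.2)) S := by
    refine ⟨ContinuousOn.aestronglyMeasurable ?_ hSm, ?_⟩
    · refine ContinuousOn.mul (by fun_prop) (hc.comp (by unfold circleMap; fun_prop) fun p hp => ?_)
      rw [← hcm]
      exact (hmem p (hsub hp)).2 hp.1.2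
    · have hfin := hi.2
      rw [HasFiniteIntegral, ← lintegral_indicator Metric.isOpen_ball.measurableSet,
        ← Complex.lintegral_comp_polarCoord_symm] at hfin
      refine lt_of_le_of_lt ?_ hfin
      refine le_trans (le_of_eq ?_) (lintegral_mono_set hsub)
      refine setLIntegral_congr_fun hSm fun p hp => ?_
      simp only
      rw [indicator_of_mem ((hmem p (hsub hp)).2 hp.1.2), enorm_mul, hcm, smul_eq_mul,
        ← ofReal_norm (p.1 : ℂ), Complex.norm_real, Real.norm_of_nonneg hp.1.1.le]
  rw [key]
  rw [Measure.volume_eq_prod, setIntegral_prod _ (by rwa [← Measure.volume_eq_prod])]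
  refine setIntegral_congr_fun measurableSet_Ioo fun r _ => ?_
  simp only
  rw [integral_const_mul, ← integral_Ioc_eq_integral_Ioo,
    ← intervalIntegral.integral_of_le (by linarith [Real.pi_pos])]
  congr 1
  have hper : Function.Periodic (fun θ : ℝ => h (circleMap 0 r θ)) (2 * Real.pi) := fun θ => by
    simp only [periodic_circleMap 0 r θ]
  have := hper.intervalIntegral_add_eq (-Real.pi) 0
  rw [zero_add, show -Real.pi + 2 * Real.pi = Real.pi by ring] at this
  exact this

/-- The powers of `ζ - c` are orthogonal on a disc about `c`, so that integrating against them
extracts the Taylor coefficients. -/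
theorem integral_ball_conj_pow_mul {f : ℂ → ℂ} {p : FormalMultilinearSeries ℂ ℂ ℂ} {c : ℂ}
    {R : ℝ} (hR : 0 < R) (hp : HasFPowerSeriesOnBall f p c (ENNReal.ofReal R))
    (hf : IntegrableOn f (Metric.ball c R)) (m : ℕ) :
    ∫ ζ in Metric.ball c R, conj (ζ - c) ^ m * f ζ =
      Real.pi * R ^ (2 * m + 2) / (m + 1) * p.coeff m := by
  have hball : (fun η : ℂ => c + η) ⁻¹' Metric.ball c R = Metric.ball 0 R := by
    ext η
    simp
  have hmp := measurePreserving_add_left (volume : Measure ℂ) c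
  have hme : MeasurableEmbedding (fun η : ℂ => c + η) := (Homeomorph.addLeft c).measurableEmbedding
  have htrans := hmp.setIntegral_preimage_emb hme (fun ζ => conj (ζ - c) ^ m * f ζ)
    (Metric.ball c R)
  rw [hball] at htrans
  simp only [add_sub_cancel_left] at htrans
  have hfc : ContinuousOn (fun η => f (c + η)) (Metric.ball 0 R) := by
    have := hp.continuousOn
    rw [Metric.eball_ofReal] at this
    exact this.comp (by fun_prop) fun η hη => by simpa using hη
  have hfi : IntegrableOn (fun η => f (c + η)) (Metric.ball 0 R) := by
    have := (hmp.integrableOn_comp_preimage hme (f := f) (s := Metric.ball c R)).2 hf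
    rwa [hball] at this
  rw [← htrans, integral_ball_eq_polar]
  · have hcong : ∫ r in Ioo 0 R, (r : ℂ) * ∫ θ in (0 : ℝ)..2 * Real.pi,
        conj (circleMap 0 r θ) ^ m * f (c + circleMap 0 r θ) =
        ∫ r in Ioo 0 R, ((r ^ (2 * m + 1) : ℝ) : ℂ) * (2 * Real.pi * p.coeff m) := by
      refine setIntegral_congr_fun measurableSet_Ioo fun r hr => ?_
      rw [integral_circle_conj_pow_mul hp hr.1 hr.2]
      push_cast
      ring
    rw [hcong, integral_mul_const, integral_complex_ofReal, ← integral_Ioc_eq_integral_Ioo,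
      ← intervalIntegral.integral_of_le hR.le, integral_pow]
    have hm : (m : ℂ) + 1 ≠ 0 := by exact_mod_cast Nat.succ_ne_zero m
    have hm2 : (2 * m + 1 + 1 : ℂ) = 2 * (m + 1) := by ring
    push_cast
    rw [hm2]
    field_simp
    simp
  · exact ContinuousOn.mul (by fun_prop) hfc
  · have hbdd : ∀ η ∈ Metric.ball (0 : ℂ) R, ‖conj η ^ m‖ ≤ R ^ m := by
      intro η hη
      rw [norm_pow, RCLike.norm_conj]
      exact pow_le_pow_left₀ (norm_nonneg _) (by simpa using (mem_ball_zero_iff.1 hη).le) m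
    refine Integrable.bdd_mul (c := R ^ m) hfi (by fun_prop) ?_
    exact ae_restrict_of_forall_mem Metric.isOpen_ball.measurableSet hbdd

theorem exists_hasFPowerSeriesOnBall {f : ℂ → ℂ} {c : ℂ} {R : ℝ} (hR : 0 < R)
    (hd : DifferentiableOn ℂ f (Metric.ball c R)) :
    ∃ p : FormalMultilinearSeries ℂ ℂ ℂ, HasFPowerSeriesOnBall f p c (ENNReal.ofReal R) := by
  have hq : ∀ r : ℝ≥0, 0 < r → (r : ℝ) < R →
      HasFPowerSeriesOnBall f (cauchyPowerSeries f c r) c r := fun r hr hrR =>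
    (hd.mono (Metric.closedBall_subset_ball hrR)).hasFPowerSeriesOnBall hr
  set r₀ : ℝ≥0 := ⟨R / 2, by positivity⟩ with hr₀
  have h₀ := hq r₀ (show (0 : ℝ) < R / 2 by positivity) (show R / 2 < R by linarith)
  have hp : ∀ r : ℝ≥0, 0 < r → (r : ℝ) < R →
      HasFPowerSeriesOnBall f (cauchyPowerSeries f c r₀) c r := fun r hr hrR => by
    rw [h₀.hasFPowerSeriesAt.eq_formalMultilinearSeries (hq r hr hrR).hasFPowerSeriesAt]
    exact hq r hr hrR
  refine ⟨cauchyPowerSeries f c r₀, ENNReal.le_of_forall_nnreal_lt fun r hr => ?_,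
    ENNReal.ofReal_pos.2 hR, fun {y} hy => ?_⟩
  · rcases eq_or_ne r 0 with rfl | h0
    · exact zero_le
    · have hr' : (r : ℝ) < R := (ENNReal.lt_ofReal_iff_toReal_lt ENNReal.coe_ne_top).1 hr
      exact (hp r (pos_iff_ne_zero.2 h0) hr').r_le
  · rw [Metric.eball_ofReal, mem_ball_zero_iff] at hy
    obtain ⟨r, hr1, hr2⟩ := exists_between hy
    have hr0 : 0 < r := (norm_nonneg y).trans_lt hr1
    lift r to ℝ≥0 using hr0.le
    refine (hp r hr0 hr2).hasSum ?_
    rw [mem_eball_zero_iff, enorm_eq_nnnorm, ENNReal.coe_lt_coe]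
    exact hr1

/-- The area mean value property of holomorphic functions. -/
theorem integral_ball_eq_mul_center {f : ℂ → ℂ} {c : ℂ} {R : ℝ} (hR : 0 < R)
    (hd : DifferentiableOn ℂ f (Metric.ball c R)) (hf : IntegrableOn f (Metric.ball c R)) :
    ∫ ζ in Metric.ball c R, f ζ = Real.pi * R ^ 2 * f c := by
  obtain ⟨p, hp⟩ := exists_hasFPowerSeriesOnBall hR hd
  have h := integral_ball_conj_pow_mul hR hp hf 0
  have h0 : p.coeff 0 = f c := hp.coeff_zero _
  rw [h0] at h
  simpa using h

/-! ### Bounds in strips and shifts of the line of integration -/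

/-- Square integrability on vertical lines, uniformly in a strip, implies boundedness in smaller
closed strips, by the area mean value property. -/
theorem exists_norm_le_of_isHardyStrip {b δ : ℝ} (hδ : 0 < δ) (hF : IsHardyStrip b F) :
    ∃ C : ℝ, ∀ z : ℂ, δ ≤ z.re → z.re + δ ≤ b → ‖F z‖ ≤ C := by
  obtain ⟨hd, C, hC⟩ := hF
  set D : Set ℂ := {z | 0 < z.re ∧ z.re < b} with hD
  have hDo : IsOpen D := (isOpen_lt continuous_const Complex.continuous_re).inter
    (isOpen_lt Complex.continuous_re continuous_const)
  have hball : ∀ z : ℂ, ∀ ζ ∈ Metric.ball z δ, |ζ.re - z.re| < δ := fun z ζ hζ => by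
    rw [← Complex.sub_re]
    exact (Complex.abs_re_le_norm _).trans_lt (mem_ball_iff_norm.1 hζ)
  have hsub : ∀ z : ℂ, δ ≤ z.re → z.re + δ ≤ b → Metric.ball z δ ⊆ D := fun z h1 h2 ζ hζ => by
    have := abs_lt.1 (hball z ζ hζ)
    exact ⟨by linarith [this.1], by linarith [this.2]⟩
  set h : ℂ → ℝ≥0∞ := D.indicator fun ζ => ‖F ζ‖ₑ ^ 2 with hh
  have hm : Measurable h := by
    have h1 : Measurable (D.indicator F) := by
      have := hd.continuousOn.measurable_piecewise
        (continuousOn_const (c := (0 : ℂ)) (s := Dᶜ)) hDo.measurableSet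
      rwa [show (fun _ : ℂ => (0 : ℂ)) = 0 from rfl, piecewise_eq_indicator] at this
    have h2 : h = fun ζ => ‖D.indicator F ζ‖ₑ ^ 2 := by
      funext ζ
      by_cases hζ : ζ ∈ D <;> simp [hh, hζ]
    rw [h2]
    exact h1.enorm.pow_const 2
  have hsq : ∀ z : ℂ, δ ≤ z.re → z.re + δ ≤ b →
      ∫⁻ ζ in Metric.ball z δ, ‖F ζ‖ₑ ^ 2 ≤ ENNReal.ofReal (2 * δ) * C := by
    intro z h1 h2
    calc ∫⁻ ζ in Metric.ball z δ, ‖F ζ‖ₑ ^ 2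
        = ∫⁻ ζ in Metric.ball z δ, h ζ := by
          refine setLIntegral_congr_fun Metric.isOpen_ball.measurableSet fun ζ hζ => ?_
          simp only [hh]
          rw [indicator_of_mem (hsub z h1 h2 hζ)]
      _ ≤ ∫⁻ ζ in Complex.re ⁻¹' Ioo (z.re - δ) (z.re + δ), h ζ := by
          refine lintegral_mono_set fun ζ hζ => ?_
          have := abs_lt.1 (hball z ζ hζ)
          exact ⟨by linarith [this.1], by linarith [this.2]⟩
      _ = ∫⁻ x in Ioo (z.re - δ) (z.re + δ), ∫⁻ y : ℝ, h (x + y * Complex.I) := by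
          rw [← lintegral_indicator (Complex.measurable_re measurableSet_Ioo),
            ← lintegral_indicator measurableSet_Ioo,
            ← (Complex.volume_preserving_equiv_real_prod.symm).lintegral_comp_emb
              Complex.measurableEquivRealProd.symm.measurableEmbedding, Measure.volume_eq_prod,
            lintegral_prod]
          · refine lintegral_congr fun x => ?_
            by_cases hx : x ∈ Ioo (z.re - δ) (z.re + δ)
            · rw [indicator_of_mem hx]
              refine lintegral_congr fun y => ?_
              rw [indicator_of_mem (by simpa [Complex.measurableEquivRealProd] using hx)]
              congr 1
              exact Complex.mk_eq_add_mul_I x y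
            · rw [indicator_of_notMem hx]
              refine (lintegral_congr fun y => ?_).trans lintegral_zero
              rw [indicator_of_notMem (by simpa [Complex.measurableEquivRealProd] using hx)]
          · exact ((hm.indicator (Complex.measurable_re measurableSet_Ioo)).comp
              Complex.measurableEquivRealProd.symm.measurable).aemeasurable
      _ ≤ ∫⁻ x in Ioo (z.re - δ) (z.re + δ), (C : ℝ≥0∞) := by
          refine setLIntegral_mono measurable_const fun x hx => ?_
          refine le_trans (lintegral_mono fun y => ?_)
            (hC x ⟨by linarith [hx.1], by linarith [hx.2]⟩)
          exact indicator_le_self _ _ _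
      _ = ENNReal.ofReal (2 * δ) * C := by
          rw [setLIntegral_const, Real.volume_Ioo, mul_comm]
          congr 2
          ring
  have hvol : ∀ z : ℂ, volume (Metric.ball z δ) ≠ ∞ := fun z => measure_ball_lt_top.ne
  set K : ℝ≥0∞ := volume (Metric.ball (0 : ℂ) δ) + ENNReal.ofReal (2 * δ) * C with hK
  have hKtop : K ≠ ∞ := by
    rw [hK]
    exact ENNReal.add_ne_top.2 ⟨hvol 0, by finiteness⟩
  have hint : ∀ z : ℂ, δ ≤ z.re → z.re + δ ≤ b → ∫⁻ ζ in Metric.ball z δ, ‖F ζ‖ₑ ≤ K := by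
    intro z h1 h2
    calc ∫⁻ ζ in Metric.ball z δ, ‖F ζ‖ₑ
        ≤ ∫⁻ ζ in Metric.ball z δ, (1 + ‖F ζ‖ₑ ^ 2) := by
          refine lintegral_mono fun ζ => ?_
          rcases le_total ‖F ζ‖ₑ 1 with h | h
          · exact h.trans le_self_add
          · exact (le_self_pow₀ h two_ne_zero).trans le_add_self
      _ = volume (Metric.ball z δ) + ∫⁻ ζ in Metric.ball z δ, ‖F ζ‖ₑ ^ 2 := by
          rw [lintegral_add_left measurable_const, setLIntegral_const, one_mul]
      _ ≤ K := by
          rw [hK, Measure.addHaar_ball_center volume z]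
          gcongr
          exact hsq z h1 h2
  refine ⟨K.toReal / (Real.pi * δ ^ 2), fun z h1 h2 => ?_⟩
  have hdz := hd.mono (hsub z h1 h2)
  have hi : IntegrableOn F (Metric.ball z δ) :=
    ⟨hdz.continuousOn.aestronglyMeasurable Metric.isOpen_ball.measurableSet,
      (hint z h1 h2).trans_lt hKtop.lt_top⟩
  have hmv := congrArg norm (integral_ball_eq_mul_center hδ hdz hi)
  have hpos : 0 < Real.pi * δ ^ 2 := by positivity
  rw [norm_mul] at hmv
  have e : ‖(Real.pi * δ ^ 2 : ℂ)‖ = Real.pi * δ ^ 2 := by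
    rw [← Complex.ofReal_pow, ← Complex.ofReal_mul, Complex.norm_real, Real.norm_of_nonneg hpos.le]
  rw [e] at hmv
  rw [le_div_iff₀ hpos, mul_comm, ← hmv, ← toReal_enorm]
  exact ENNReal.toReal_mono hKtop ((enorm_integral_le_lintegral_enorm _).trans (hint z h1 h2))

/-- Shifting a vertical line of integration, by Cauchy's theorem for rectangles: the integrals over
the horizontal sides tend to `0`. -/
theorem integral_line_eq_of_gaussian_decay {H : ℂ → ℂ} (hH : DifferentiableOn ℂ H rightHalfPlane)
    {x₁ x₂ : ℝ} (h1 : 0 < x₁) (h12 : x₁ ≤ x₂) {a C : ℝ} (ha : 0 < a)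
    (hb : ∀ x ∈ Icc x₁ x₂, ∀ y : ℝ, ‖H (x + y * Complex.I)‖ ≤ C * Real.exp (-a * y ^ 2)) :
    ∫ y : ℝ, H (x₁ + y * Complex.I) = ∫ y : ℝ, H (x₂ + y * Complex.I) := by
  have hint : ∀ x ∈ Icc x₁ x₂, Integrable fun y : ℝ => H (x + y * Complex.I) := fun x hx =>
    ((integrable_exp_neg_mul_sq ha).const_mul C).mono'
      (continuous_line hH.continuousOn (h1.trans_le hx.1)).aestronglyMeasurable
      (Eventually.of_forall (hb x hx))
  have hlim : ∀ x ∈ Icc x₁ x₂, Tendsto (fun T : ℝ => ∫ y in -T..T, H (x + y * Complex.I)) atTop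
      (𝓝 (∫ y : ℝ, H (x + y * Complex.I))) := fun x hx =>
    intervalIntegral_tendsto_integral (hint x hx) tendsto_neg_atTop_atBot tendsto_id
  have hdecay : Tendsto (fun T : ℝ => C * Real.exp (-a * T ^ 2) * |x₂ - x₁|) atTop (𝓝 0) := by
    have h2 : Tendsto (fun T : ℝ => -a * T ^ 2) atTop atBot :=
      (tendsto_pow_atTop two_ne_zero).const_mul_atTop_of_neg (neg_lt_zero.2 ha)
    have := ((Real.tendsto_exp_atBot.comp h2).const_mul C).mul_const |x₂ - x₁|
    simpa using this
  have hhor : ∀ s : ℝ, s ^ 2 = 1 →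
      Tendsto (fun T : ℝ => ∫ x in x₁..x₂, H (x + (s * T : ℝ) * Complex.I)) atTop (𝓝 0) := by
    intro s hs
    refine squeeze_zero_norm (fun T => ?_) hdecay
    refine intervalIntegral.norm_integral_le_of_norm_le_const fun x hx => ?_
    rw [uIoc_of_le h12] at hx
    refine (hb x ⟨hx.1.le, hx.2⟩ (s * T)).trans (le_of_eq ?_)
    rw [mul_pow, hs, one_mul]
  have hrect : ∀ T : ℝ, (∫ x in x₁..x₂, H (x + (-1 * T : ℝ) * Complex.I)) -
      (∫ x in x₁..x₂, H (x + (1 * T : ℝ) * Complex.I)) +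
      Complex.I • (∫ y in -T..T, H (x₂ + y * Complex.I)) -
      Complex.I • (∫ y in -T..T, H (x₁ + y * Complex.I)) = 0 := by
    intro T
    have := Complex.integral_boundary_rect_eq_zero_of_differentiableOn H
      (⟨x₁, -T⟩ : ℂ) (⟨x₂, T⟩ : ℂ) (hH.mono fun z hz => ?_)
    · simpa using this
    · have hz1 := hz.1
      simp only [mem_preimage, uIcc_of_le h12] at hz1
      exact h1.trans_le hz1.1
  have htot := (((hhor (-1) (by norm_num)).sub (hhor 1 (by norm_num))).add
    ((hlim x₂ ⟨h12, le_rfl⟩).const_smul Complex.I)).sub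
    ((hlim x₁ ⟨le_rfl, h12⟩).const_smul Complex.I)
  simp_rw [hrect] at htot
  have h0 := tendsto_nhds_unique htot tendsto_const_nhds
  rw [sub_zero, zero_add, sub_eq_zero] at h0
  exact (smul_right_injective ℂ Complex.I_ne_zero h0).symm

/-- Relations between two sequences that hold almost everywhere pass to their limits in `L²`, along
a subsequence that converges almost everywhere. -/
theorem ae_mul_eq_of_tendsto_Lp {f g : ℕ → Lp ℂ 2 (volume : Measure ℝ)}
    {f' g' : Lp ℂ 2 (volume : Measure ℝ)} {a b : ℝ → ℂ} (hf : Tendsto f atTop (𝓝 f'))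
    (hg : Tendsto g atTop (𝓝 g')) (h : ∀ n, ∀ᵐ u, f n u * a u = g n u * b u) :
    ∀ᵐ u, f' u * a u = g' u * b u := by
  obtain ⟨ns, hns, h1⟩ := (tendstoInMeasure_of_tendsto_Lp hf).exists_seq_tendsto_ae
  obtain ⟨ms, hms, h2⟩ :=
    (tendstoInMeasure_of_tendsto_Lp (hg.comp hns.tendsto_atTop)).exists_seq_tendsto_ae
  filter_upwards [h1, h2, ae_all_iff.2 h] with u h1 h2 h
  have e1 := (h1.comp hms.tendsto_atTop).mul_const (a u)
  have e2 := h2.mul_const (b u)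
  refine tendsto_nhds_unique e1 (e2.congr fun n => ?_)
  exact (h (ns (ms n))).symm

/-! ### Gaussian damping -/

/-- The function `F` damped by the Gaussian `exp(z² / (N + 1))`, which decays on vertical lines and
tends to `1` as `N → ∞`. -/
noncomputable def gaussianDamp (F : ℂ → ℂ) (N : ℕ) (z : ℂ) : ℂ :=
  F z * Complex.exp (z ^ 2 / (N + 1))

theorem norm_gaussianFactor (N : ℕ) (x y : ℝ) :
    ‖Complex.exp ((x + y * Complex.I) ^ 2 / (N + 1))‖ =
      Real.exp (x ^ 2 / (N + 1)) * Real.exp (-(1 / (N + 1 : ℝ)) * y ^ 2) := by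
  rw [Complex.norm_exp, ← Real.exp_add]
  congr 1
  have e : (x + y * Complex.I) ^ 2 / (N + 1) =
      (((x ^ 2 - y ^ 2) / (N + 1) : ℝ) : ℂ) + ((2 * x * y / (N + 1) : ℝ) : ℂ) * Complex.I := by
    push_cast
    rw [add_sq, mul_pow, Complex.I_sq]
    ring
  rw [e, Complex.add_re, Complex.ofReal_re, Complex.re_ofReal_mul, Complex.I_re]
  ring

theorem norm_gaussianFactor_le (N : ℕ) (x y : ℝ) :
    ‖Complex.exp ((x + y * Complex.I) ^ 2 / (N + 1))‖ ≤ Real.exp (x ^ 2) := by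
  rw [norm_gaussianFactor]
  have hN : (0 : ℝ) < N + 1 := by positivity
  have h1 : x ^ 2 / (N + 1 : ℝ) ≤ x ^ 2 :=
    div_le_self (sq_nonneg x) (by linarith [(Nat.cast_nonneg N : (0 : ℝ) ≤ N)])
  have h2 : -(1 / (N + 1 : ℝ)) * y ^ 2 ≤ 0 := by
    have : 0 ≤ 1 / (N + 1 : ℝ) * y ^ 2 := by positivity
    linarith
  rw [← Real.exp_add]
  exact Real.exp_le_exp.2 (by linarith)

/-- The vertical line of abscissa `x`, parametrized so that the transform restricted to it is a
Fourier transform. -/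
noncomputable def vline (x y : ℝ) : ℂ := x + (2 * Real.pi * y : ℝ) * Complex.I

theorem continuous_vline (x : ℝ) : Continuous (vline x) := by
  unfold vline
  fun_prop

theorem vline_mem {x : ℝ} (hx : 0 < x) (y : ℝ) : vline x y ∈ rightHalfPlane := line_mem hx _

theorem continuous_comp_vline (hF : ContinuousOn F rightHalfPlane) {x : ℝ} (hx : 0 < x) :
    Continuous fun y => F (vline x y) :=
  hF.comp_continuous (continuous_vline x) (vline_mem hx)

theorem lintegral_vline (F : ℂ → ℂ) (x : ℝ) :
    ∫⁻ y, ‖F (vline x y)‖ₑ ^ 2 =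
      ENNReal.ofReal (2 * Real.pi)⁻¹ * ∫⁻ y : ℝ, ‖F (x + y * Complex.I)‖ₑ ^ 2 := by
  have h := lintegral_comp_mul_left Real.two_pi_pos.ne' fun y : ℝ => ‖F (x + y * Complex.I)‖ₑ ^ 2
  rwa [abs_of_pos (inv_pos.2 Real.two_pi_pos)] at h

theorem memLp_vline (hd : DifferentiableOn ℂ F rightHalfPlane)
    (hS : ∀ b : ℝ, 0 < b → IsHardyStrip b F) {x : ℝ} (hx : 0 < x) :
    MemLp (fun y => F (vline x y)) 2 := by
  refine memLp_two_of_lintegral_lt_top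
    (continuous_comp_vline hd.continuousOn hx).aestronglyMeasurable ?_
  obtain ⟨-, C, hC⟩ := hS (x + 1) (by linarith)
  rw [lintegral_vline]
  exact ENNReal.mul_lt_top (by finiteness)
    ((hC x ⟨hx, by linarith⟩).trans_lt ENNReal.coe_lt_top)

theorem exists_norm_gaussianDamp_le (hS : ∀ b : ℝ, 0 < b → IsHardyStrip b F)
    {x₁ : ℝ} (h1 : 0 < x₁) (x₂ : ℝ) (N : ℕ) (u : ℝ) :
    ∃ C : ℝ, ∀ x ∈ Icc x₁ x₂, ∀ y : ℝ,
      ‖gaussianDamp F N (x + y * Complex.I) * Complex.exp (u * (x + y * Complex.I))‖ ≤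
        C * Real.exp (-(1 / (N + 1 : ℝ)) * y ^ 2) := by
  rcases lt_or_ge x₂ x₁ with h | h
  · exact ⟨0, fun x hx => absurd (hx.1.trans hx.2) (not_le.2 h)⟩
  obtain ⟨C, hC⟩ := exists_norm_le_of_isHardyStrip h1 (hS (x₂ + x₁) (by linarith))
  refine ⟨C * Real.exp (x₂ ^ 2) * Real.exp (|u| * x₂), fun x hx y => ?_⟩
  have hF := hC (x + y * Complex.I) (by simpa using hx.1) (by simpa using hx.2)
  have hC0 : 0 ≤ C := (norm_nonneg _).trans hF
  have hx0 : 0 < x := h1.trans_le hx.1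
  have hexp : ‖Complex.exp (u * (x + y * Complex.I))‖ ≤ Real.exp (|u| * x₂) := by
    rw [Complex.norm_exp, Real.exp_le_exp]
    have e : (u * (x + y * Complex.I) : ℂ).re = u * x := by simp
    rw [e]
    exact mul_le_mul (le_abs_self u) hx.2 hx0.le (abs_nonneg u)
  have hsq : Real.exp (x ^ 2 / (N + 1)) ≤ Real.exp (x₂ ^ 2) := by
    refine Real.exp_le_exp.2 ((div_le_self (sq_nonneg x)
      (by linarith [(Nat.cast_nonneg N : (0 : ℝ) ≤ N)])).trans ?_)
    exact pow_le_pow_left₀ hx0.le hx.2 2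
  rw [gaussianDamp, norm_mul, norm_mul, norm_gaussianFactor]
  calc ‖F (x + y * Complex.I)‖ *
        (Real.exp (x ^ 2 / (N + 1)) * Real.exp (-(1 / (N + 1 : ℝ)) * y ^ 2)) *
        ‖Complex.exp (u * (x + y * Complex.I))‖
      ≤ C * (Real.exp (x₂ ^ 2) * Real.exp (-(1 / (N + 1 : ℝ)) * y ^ 2)) *
          Real.exp (|u| * x₂) := by gcongr
    _ = _ := by ring

theorem differentiableOn_gaussianDamp (hd : DifferentiableOn ℂ F rightHalfPlane) (N : ℕ) :
    DifferentiableOn ℂ (gaussianDamp F N) rightHalfPlane :=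
  hd.mul (by fun_prop)

theorem integrable_gaussianDamp_vline (hd : DifferentiableOn ℂ F rightHalfPlane)
    (hS : ∀ b : ℝ, 0 < b → IsHardyStrip b F) {x : ℝ} (hx : 0 < x) (N : ℕ) :
    Integrable fun y => gaussianDamp F N (vline x y) := by
  obtain ⟨C, hC⟩ := exists_norm_gaussianDamp_le hS hx x N 0
  have hN : (0 : ℝ) < 1 / (N + 1) := by positivity
  have hi := ((integrable_exp_neg_mul_sq hN).const_mul C).comp_mul_left' Real.two_pi_pos.ne'
  refine hi.mono' (continuous_comp_vline
    (differentiableOn_gaussianDamp hd N).continuousOn hx).aestronglyMeasurable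
    (Eventually.of_forall fun y => ?_)
  have := hC x ⟨le_rfl, le_rfl⟩ (2 * Real.pi * y)
  simpa [vline] using this

theorem memLp_gaussianDamp_vline (hd : DifferentiableOn ℂ F rightHalfPlane)
    (hS : ∀ b : ℝ, 0 < b → IsHardyStrip b F) {x : ℝ} (hx : 0 < x) (N : ℕ) :
    MemLp (fun y => gaussianDamp F N (vline x y)) 2 := by
  refine (memLp_vline hd hS hx).of_le_mul (c := Real.exp (x ^ 2)) (continuous_comp_vline
    (differentiableOn_gaussianDamp hd N).continuousOn hx).aestronglyMeasurable
    (Eventually.of_forall fun y => ?_)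
  rw [gaussianDamp, norm_mul, mul_comm]
  exact mul_le_mul_of_nonneg_right (norm_gaussianFactor_le N x _) (norm_nonneg _)

theorem tendsto_gaussianDamp_vline (hd : DifferentiableOn ℂ F rightHalfPlane)
    (hS : ∀ b : ℝ, 0 < b → IsHardyStrip b F) {x : ℝ} (hx : 0 < x) :
    Tendsto (fun N => (memLp_gaussianDamp_vline hd hS hx N).toLp) atTop
      (𝓝 (memLp_vline hd hS hx).toLp) := by
  rw [Lp.tendsto_Lp_iff_tendsto_eLpNorm'']
  have hm : ∀ N, AEStronglyMeasurable
      (fun y => gaussianDamp F N (vline x y) - F (vline x y)) volume := fun N =>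
    (memLp_gaussianDamp_vline hd hS hx N).1.sub (memLp_vline hd hS hx).1
  have h := tendsto_lintegral_of_dominated_convergence' (μ := volume)
    (F := fun N y => ‖gaussianDamp F N (vline x y) - F (vline x y)‖ₑ ^ 2) (f := fun _ => 0)
    (fun y => ‖F (vline x y)‖ₑ ^ 2 * ENNReal.ofReal (Real.exp (x ^ 2) + 1) ^ 2)
    (fun N => (hm N).enorm.pow_const 2) (fun N => Eventually.of_forall fun y => ?_) ?_
    (Eventually.of_forall fun y => ?_)
  · rw [lintegral_zero] at h
    simp_rw [← eLpNorm_two_sq] at h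
    have h' := (ENNReal.continuous_rpow_const (y := (1 / 2 : ℝ))).tendsto 0 |>.comp h
    rw [ENNReal.zero_rpow_of_pos (by norm_num)] at h'
    refine h'.congr fun N => ?_
    simp only [Function.comp]
    rw [← ENNReal.rpow_natCast, ← ENNReal.rpow_mul]
    norm_num
    rfl
  · have e : gaussianDamp F N (vline x y) - F (vline x y) =
        F (vline x y) * (Complex.exp (vline x y ^ 2 / (N + 1)) - 1) := by
      rw [gaussianDamp]
      ring
    beta_reduce
    rw [e, enorm_mul, mul_pow]
    gcongr
    rw [← ofReal_norm]
    refine ENNReal.ofReal_le_ofReal ((norm_sub_le _ _).trans ?_)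
    rw [norm_one]
    exact add_le_add_left (norm_gaussianFactor_le N x _) 1
  · rw [lintegral_mul_const' _ _ (by finiteness)]
    exact ENNReal.mul_ne_top (lintegral_sq_lt_top (memLp_vline hd hS hx)).ne (by finiteness)
  · have h1 : Tendsto (fun N : ℕ => vline x y ^ 2 / ((N : ℂ) + 1)) atTop (𝓝 0) := by
      have := (tendsto_one_div_add_atTop_nhds_zero_nat (𝕜 := ℂ)).const_mul (vline x y ^ 2)
      rw [mul_zero] at this
      refine this.congr fun N => ?_
      ring
    have h2 := (Complex.continuous_exp.tendsto 0).comp h1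
    rw [Complex.exp_zero] at h2
    have h3 := (h2.const_mul (F (vline x y))).sub_const (F (vline x y))
    rw [mul_one, sub_self] at h3
    have h4 := ((ENNReal.continuous_pow 2).comp continuous_enorm).tendsto 0 |>.comp h3
    simpa [Function.comp_def, gaussianDamp] using h4

/-- The inverse Fourier transforms on two vertical lines differ by the expected exponential
factor: for the damped function this is Cauchy's theorem. -/
theorem fourierInv_gaussianDamp_mul_exp (hd : DifferentiableOn ℂ F rightHalfPlane)
    (hS : ∀ b : ℝ, 0 < b → IsHardyStrip b F) {x₁ x₂ : ℝ} (h1 : 0 < x₁) (h12 : x₁ ≤ x₂)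
    (N : ℕ) (u : ℝ) :
    FourierTransform.fourierInv (fun y => gaussianDamp F N (vline x₁ y)) u * Complex.exp (x₁ * u) =
      FourierTransform.fourierInv (fun y => gaussianDamp F N (vline x₂ y)) u *
        Complex.exp (x₂ * u) := by
  have key : ∀ x : ℝ,
      FourierTransform.fourierInv (fun y => gaussianDamp F N (vline x y)) u * Complex.exp (x * u) =
        (2 * Real.pi : ℂ)⁻¹ * ∫ y : ℝ, gaussianDamp F N (x + y * Complex.I) *
          Complex.exp (u * (x + y * Complex.I)) := by
    intro x
    rw [Real.fourierInv_eq', ← integral_mul_const]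
    have hsc := Measure.integral_comp_mul_left (fun y : ℝ => gaussianDamp F N (x + y * Complex.I) *
      Complex.exp (u * (x + y * Complex.I))) (2 * Real.pi)
    rw [abs_of_pos (inv_pos.2 Real.two_pi_pos), Complex.real_smul] at hsc
    push_cast at hsc
    rw [← hsc]
    refine integral_congr_ae (Eventually.of_forall fun y => ?_)
    simp only [smul_eq_mul, vline]
    rw [mul_comm (Complex.exp _) (gaussianDamp _ _ _), mul_assoc, ← Complex.exp_add]
    push_cast
    congr 2
    simp
    ring
  obtain ⟨C, hC⟩ := exists_norm_gaussianDamp_le hS h1 x₂ N u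
  rw [key, key, integral_line_eq_of_gaussian_decay
    (H := fun z => gaussianDamp F N z * Complex.exp (u * z)) ?_ h1 h12
    (a := 1 / (N + 1 : ℝ)) (by positivity) hC]
  exact (differentiableOn_gaussianDamp hd N).mul (by fun_prop)

/-- The relation between the inverse Fourier transforms of `F` on two vertical lines, in `L²(ℝ)`,
as a limit of the relation for the damped functions. -/
theorem fourierInv_vline_mul_exp (hd : DifferentiableOn ℂ F rightHalfPlane)
    (hS : ∀ b : ℝ, 0 < b → IsHardyStrip b F) {x₁ x₂ : ℝ} (h1 : 0 < x₁) (h2 : 0 < x₂) :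
    ∀ᵐ u : ℝ, (FourierTransform.fourierInv (memLp_vline hd hS h1).toLp :
        Lp ℂ 2 (volume : Measure ℝ)) u * Complex.exp (x₁ * u) =
      (FourierTransform.fourierInv (memLp_vline hd hS h2).toLp :
        Lp ℂ 2 (volume : Measure ℝ)) u * Complex.exp (x₂ * u) := by
  have hcont : Continuous fun f : Lp ℂ 2 (volume : Measure ℝ) =>
      (FourierTransform.fourierInv f : Lp ℂ 2 (volume : Measure ℝ)) :=
    (Lp.fourierTransformₗᵢ ℝ ℂ).symm.continuous
  refine ae_mul_eq_of_tendsto_Lp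
    ((hcont.tendsto _).comp (tendsto_gaussianDamp_vline hd hS h1))
    ((hcont.tendsto _).comp (tendsto_gaussianDamp_vline hd hS h2)) fun N => ?_
  filter_upwards [fourierInv_toLp_ae (integrable_gaussianDamp_vline hd hS h1 N)
    (memLp_gaussianDamp_vline hd hS h1 N),
    fourierInv_toLp_ae (integrable_gaussianDamp_vline hd hS h2 N)
    (memLp_gaussianDamp_vline hd hS h2 N)] with u e1 e2
  simp only [Function.comp_apply]
  rw [e1, e2]
  rcases le_total x₁ x₂ with h | h
  · exact fourierInv_gaussianDamp_mul_exp hd hS h1 h N u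
  · exact (fourierInv_gaussianDamp_mul_exp hd hS h2 h N u).symm

/-! ### Mellin inversion in `M²_ω` -/

theorem lintegral_fourierInv_vline (hd : DifferentiableOn ℂ F rightHalfPlane)
    (hS : ∀ b : ℝ, 0 < b → IsHardyStrip b F) {x : ℝ} (hx : 0 < x) :
    ∫⁻ u, ‖(FourierTransform.fourierInv (memLp_vline hd hS hx).toLp :
        Lp ℂ 2 (volume : Measure ℝ)) u‖ₑ ^ 2 =
      ENNReal.ofReal (2 * Real.pi)⁻¹ * ∫⁻ y : ℝ, ‖F (x + y * Complex.I)‖ₑ ^ 2 := by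
  rw [← lintegral_vline, ← eLpNorm_two_sq, ← eLpNorm_two_sq]
  have h : ‖(FourierTransform.fourierInv (memLp_vline hd hS hx).toLp :
      Lp ℂ 2 (volume : Measure ℝ))‖ = ‖(memLp_vline hd hS hx).toLp‖ :=
    (Lp.fourierTransformₗᵢ ℝ ℂ).symm.norm_map _
  rw [Lp.norm_toLp, Lp.norm_def] at h
  rw [(ENNReal.toReal_eq_toReal_iff' (Lp.memLp _).2.ne (memLp_vline hd hS hx).2.ne).1 h]

/-- Fatou's lemma as `x → 0⁺`. -/
theorem lintegral_le_of_forall_pos {h : ℝ → ℝ≥0∞} (hm : AEMeasurable h) {C : ℝ≥0∞}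
    (hC : ∀ x : ℝ, 0 < x → x < 1 → ∫⁻ u, h u * ENNReal.ofReal (Real.exp (-(2 * x) * u)) ≤ C) :
    ∫⁻ u, h u ≤ C := by
  let x : ℕ → ℝ := fun n => 1 / ((n + 1 : ℕ) + 1)
  have hx : Tendsto x atTop (𝓝 0) :=
    (tendsto_add_atTop_iff_nat 1).2 (tendsto_one_div_add_atTop_nhds_zero_nat (𝕜 := ℝ))
  have hlim : ∀ u, Tendsto (fun n => h u * ENNReal.ofReal (Real.exp (-(2 * x n) * u))) atTop
      (𝓝 (h u)) := fun u => by
    have hc : Continuous fun t : ℝ => ENNReal.ofReal (Real.exp (-(2 * t) * u)) :=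
      ENNReal.continuous_ofReal.comp (by fun_prop)
    have := ENNReal.Tendsto.const_mul (a := h u) ((hc.tendsto 0).comp hx) (Or.inl (by simp))
    simpa using this
  calc ∫⁻ u, h u
      = ∫⁻ u, liminf (fun n => h u * ENNReal.ofReal (Real.exp (-(2 * x n) * u))) atTop := by
        simp_rw [(hlim _).liminf_eq]
    _ ≤ liminf (fun n => ∫⁻ u, h u * ENNReal.ofReal (Real.exp (-(2 * x n) * u))) atTop :=
        lintegral_liminf_le' fun n => hm.mul (by fun_prop)
    _ ≤ liminf (fun _ : ℕ => C) atTop := by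
        refine liminf_le_liminf (Eventually.of_forall fun n => hC _ (by positivity) ?_)
        have hn : (0 : ℝ) ≤ n := n.cast_nonneg
        simp only [x]
        rw [div_lt_one (by positivity)]
        push_cast
        linarith
    _ = C := liminf_const C

/-- Every function in `M²_ω` is the transform of a square integrable function. -/
theorem exists_gammaTransform_eqOn (hd : DifferentiableOn ℂ F rightHalfPlane)
    (hS : ∀ b : ℝ, 0 < b → IsHardyStrip b F) (hL : MemLp (closedExt F) 2 omega) :
    ∃ χ : ℝ → ℂ, MemLp χ 2 ∧ EqOn F (gammaTransform χ) rightHalfPlane := by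
  let v : ∀ x : ℝ, 0 < x → Lp ℂ 2 (volume : Measure ℝ) := fun x hx =>
    FourierTransform.fourierInv (memLp_vline hd hS hx).toLp
  let χ : ℝ → ℂ := fun u => v 1 one_pos u * Complex.exp ((1 : ℝ) * u) *
    Complex.exp ((Real.exp (-u) : ℝ))
  have hχm : AEStronglyMeasurable χ volume :=
    ((Lp.aestronglyMeasurable _).mul
      (Continuous.aestronglyMeasurable (by fun_prop))).mul
      (Continuous.aestronglyMeasurable (by fun_prop))
  -- on the line `Re z = x`, `χ` times the kernel is the inverse Fourier transform of `F`
  have hv : ∀ x (hx : 0 < x), (fun u => χ u * expKernel (x : ℝ) u) =ᵐ[volume] v x hx := by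
    intro x hx
    filter_upwards [fourierInv_vline_mul_exp hd hS one_pos hx] with u hu
    change v 1 one_pos u * Complex.exp ((1 : ℝ) * u) = v x hx u * Complex.exp (x * u) at hu
    simp only [χ]
    rw [hu, expKernel, mul_assoc, mul_assoc, ← Complex.exp_add, ← Complex.exp_add]
    convert mul_one _
    rw [← Complex.exp_zero]
    congr 1
    ring
  have hvn : ∀ x : ℝ, 0 < x → ∫⁻ u, ‖χ u‖ₑ ^ 2 * ‖expKernel (x : ℝ) u‖ₑ ^ 2 =
      ENNReal.ofReal (2 * Real.pi)⁻¹ * ∫⁻ y : ℝ, ‖F (x + y * Complex.I)‖ₑ ^ 2 := by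
    intro x hx
    rw [← lintegral_fourierInv_vline hd hS hx]
    refine lintegral_congr_ae ?_
    filter_upwards [hv x hx] with u hu
    rw [← mul_pow, ← enorm_mul, hu]
  -- the line `Re z = 0` of `ω` is controlled by the lines to its right
  obtain ⟨-, C, hC⟩ := hS 1 one_pos
  have h0 : ∫⁻ u, ‖χ u‖ₑ ^ 2 * ‖expKernel ((0 : ℝ) : ℝ) u‖ₑ ^ 2 ≤
      ENNReal.ofReal (2 * Real.pi)⁻¹ * C := by
    refine lintegral_le_of_forall_pos ((hχm.enorm.pow_const 2).mul
      ((continuous_expKernel _).enorm.measurable.pow_const 2).aemeasurable) fun x hx hx1 => ?_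
    have e : ∀ u, ‖χ u‖ₑ ^ 2 * ‖expKernel ((0 : ℝ) : ℝ) u‖ₑ ^ 2 *
        ENNReal.ofReal (Real.exp (-(2 * x) * u)) = ‖χ u‖ₑ ^ 2 * ‖expKernel (x : ℝ) u‖ₑ ^ 2 := by
      intro u
      rw [enorm_expKernel_sq, enorm_expKernel_sq]
      simp only [mul_zero, neg_zero, zero_mul, Real.exp_zero, ENNReal.ofReal_one, one_mul]
      ring
    refine (lintegral_congr e).le.trans ?_
    rw [hvn x hx]
    gcongr
    exact hC x ⟨hx, hx1⟩
  have hχ : MemLp χ 2 := by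
    refine memLp_two_of_lintegral_lt_top hχm ?_
    rw [← tsum_weight_mul_lintegral (hχm.enorm.pow_const 2)]
    rw [memLp_closedExt_iff] at hL
    have hfin := lintegral_sq_lt_top hL
    rw [lintegral_omega] at hfin
    set T : ℕ → ℝ≥0∞ := fun n => ENNReal.ofReal (2 ^ n / (n ! : ℝ)) *
      ∫⁻ y : ℝ, ‖rightHalfPlane.indicator F ((n : ℂ) / 2 + y * Complex.I)‖ₑ ^ 2 with hT
    have hle : ∀ n : ℕ, ENNReal.ofReal (2 ^ n / (n ! : ℝ)) *
        ∫⁻ u, ‖χ u‖ₑ ^ 2 * ‖expKernel ((n / 2 : ℝ) : ℝ) u‖ₑ ^ 2 ≤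
        (if n = 0 then ENNReal.ofReal (2 * Real.pi)⁻¹ * C else 0) +
          ENNReal.ofReal (2 * Real.pi)⁻¹ * T n := by
      intro n
      rcases Nat.eq_zero_or_pos n with rfl | hn
      · rw [if_pos rfl]
        refine le_trans ?_ le_self_add
        simpa using h0
      · have hx : (0 : ℝ) < n / 2 := by positivity
        rw [if_neg hn.ne', zero_add, hvn _ hx, mul_left_comm]
        refine (mul_le_mul_right (mul_le_mul_right (le_of_eq ?_) _) _)
        refine lintegral_congr fun y => ?_
        rw [line_cast, indicator_of_mem (line_mem hx y)]
    refine (ENNReal.tsum_le_tsum hle).trans_lt ?_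
    rw [ENNReal.tsum_add, tsum_ite_eq, ENNReal.tsum_mul_left]
    exact ENNReal.add_lt_top.2 ⟨by finiteness, ENNReal.mul_lt_top (by finiteness) hfin⟩
  refine ⟨χ, hχ, fun z hz => ?_⟩
  have hx : 0 < z.re := hz
  have h1 := integrable_mul_expKernel hχ (z := (z.re : ℂ)) (by simpa using hx)
  have h2 := memLp_mul_expKernel hχ (z := (z.re : ℂ)) (by simpa using hx.le)
  have hL1 : h2.toLp = v z.re hx :=
    Lp.ext (h2.coeFn_toLp.trans (hv z.re hx))
  have hF : FourierTransform.fourier (v z.re hx) = (memLp_vline hd hS hx).toLp :=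
    (Lp.fourierTransformₗᵢ ℝ ℂ).apply_symm_apply _
  have hae : FourierTransform.fourier (fun u => χ u * expKernel (z.re : ℝ) u) =ᵐ[volume]
      fun y => F (vline z.re y) := by
    refine (fourier_toLp_ae h1 h2).symm.trans ?_
    rw [hL1, hF]
    exact (memLp_vline hd hS hx).coeFn_toLp
  have heq := (continuous_fourier h1).ae_eq_iff_eq volume
    (continuous_comp_vline hd.continuousOn hx) |>.1 hae
  have hz' : z = z.re + z.im * Complex.I := (Complex.re_add_im z).symm
  have hpt := congrFun heq ((2 * Real.pi)⁻¹ * z.im)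
  conv_lhs => rw [hz']
  conv_rhs => rw [hz']
  rw [gammaTransform_line, hpt, vline, mul_inv_cancel_left₀ Real.two_pi_pos.ne']

/-! ### Completeness of the kernels at the positive integers -/

theorem integrable_mul_exp_neg_mul_sub_exp {χ : ℝ → ℂ} (hχ : MemLp χ 2) {s c : ℝ} (hs : 0 < s)
    (hc : 0 < c) : Integrable fun u => ‖χ u‖ * Real.exp (-s * u - c * Real.exp (-u)) := by
  have h : MemLp (fun u : ℝ => Real.exp (-s * u - c * Real.exp (-u))) 2 := by
    rw [memLp_two_iff_integrable_sq (Continuous.aestronglyMeasurable (by fun_prop))]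
    refine (integrable_exp_neg_mul_sub_exp (s := 2 * s) (c := 2 * c)
      (by linarith) (by linarith)).congr (Eventually.of_forall fun u => ?_)
    simp only
    rw [← Real.exp_nat_mul]
    congr 1
    push_cast
    ring
  exact hχ.norm.integrable_mul h

/-- If all moments of `χ(u) e^{-t}`, `t = e^{-u}`, vanish, then so do all moments of
`χ(u) e^{-t - ist}` for real `s`: the exponential series for `e^{-iht}` may be integrated term by
term when `|h|` is small, and `s` is reached in finitely many steps. -/
theorem integral_mul_expKernel_mul_exp_eq_zero {χ : ℝ → ℂ} (hχ : MemLp χ 2)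
    (h0 : ∀ k : ℕ, ∫ u, χ u * expKernel (k + 1) u = 0) (s : ℝ) (k : ℕ) :
    ∫ u, χ u * expKernel (k + 1) u * Complex.exp (-Complex.I * s * (Real.exp (-u) : ℝ)) = 0 := by
  let P : ℝ → Prop := fun s => ∀ k : ℕ,
    ∫ u, χ u * expKernel (k + 1) u * Complex.exp (-Complex.I * s * (Real.exp (-u) : ℝ)) = 0
  have hnorm : ∀ (k : ℕ) (u : ℝ), ‖expKernel (k + 1) u‖ =
      Real.exp (-(k + 1 : ℝ) * u - 1 * Real.exp (-u)) := fun k u => by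
    rw [norm_expKernel, one_mul]
    simp
  have hunit : ∀ s u : ℝ, ‖Complex.exp (-Complex.I * s * (Real.exp (-u) : ℝ))‖ = 1 := fun s u => by
    rw [Complex.norm_exp]
    have : (-Complex.I * s * (Real.exp (-u) : ℝ) : ℂ) =
        ((-(s * Real.exp (-u)) : ℝ) : ℂ) * Complex.I := by
      push_cast
      ring
    rw [this, Complex.re_ofReal_mul, Complex.I_re, mul_zero, Real.exp_zero]
  have step : ∀ s h : ℝ, |h| ≤ 1 / 2 → P s → P (s + h) := by
    intro s h hh hs k
    let t : ℝ → ℝ := fun u => Real.exp (-u)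
    have hbound : ∀ u, HasSum (fun n : ℕ => ‖χ u‖ * ‖expKernel (k + 1) u‖ * ((|h| * t u) ^ n / n !))
        (‖χ u‖ * ‖expKernel (k + 1) u‖ * Real.exp (|h| * t u)) := fun u => by
      refine HasSum.mul_left _ ?_
      rw [Real.exp_eq_exp_ℝ]
      exact NormedSpace.expSeries_div_hasSum_exp _
    have hterm : ∀ u, HasSum (fun n : ℕ => χ u * expKernel (k + 1) u *
        Complex.exp (-Complex.I * s * (Real.exp (-u) : ℝ)) *
          ((-Complex.I * h * (t u : ℝ)) ^ n / n !))
        (χ u * expKernel (k + 1) u *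
          Complex.exp (-Complex.I * (s + h : ℝ) * (Real.exp (-u) : ℝ))) :=
      fun u => by
        have e : Complex.exp (-Complex.I * (s + h : ℝ) * (Real.exp (-u) : ℝ)) =
            Complex.exp (-Complex.I * s * (Real.exp (-u) : ℝ)) *
              Complex.exp (-Complex.I * h * (t u : ℝ)) := by
          rw [← Complex.exp_add]
          congr 1
          simp only [t]
          push_cast
          ring
        rw [e, ← mul_assoc]
        refine HasSum.mul_left _ ?_
        rw [Complex.exp_eq_exp_ℂ]
        exact NormedSpace.expSeries_div_hasSum_exp _
    have key := hasSum_integral_of_dominated_convergence (μ := volume)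
      (F := fun (n : ℕ) u => χ u * expKernel (k + 1) u *
        Complex.exp (-Complex.I * s * (Real.exp (-u) : ℝ)) *
          ((-Complex.I * h * (t u : ℝ)) ^ n / n !))
      (fun n u => ‖χ u‖ * ‖expKernel (k + 1) u‖ * ((|h| * t u) ^ n / n !))
      (fun n => ((hχ.1.mul (continuous_expKernel _).aestronglyMeasurable).mul
        (Continuous.aestronglyMeasurable (by fun_prop))).mul
        (Continuous.aestronglyMeasurable (by simp only [t]; fun_prop)))
      (fun n => Eventually.of_forall fun u => ?_)
      (Eventually.of_forall fun u => (hbound u).summable) ?_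
      (Eventually.of_forall fun u => hterm u)
    · have hz : ∀ n : ℕ, ∫ u, χ u * expKernel (k + 1) u *
          Complex.exp (-Complex.I * s * (Real.exp (-u) : ℝ)) *
            ((-Complex.I * h * (t u : ℝ)) ^ n / n !) = 0 := by
        intro n
        have e : ∀ u, χ u * expKernel (k + 1) u *
            Complex.exp (-Complex.I * s * (Real.exp (-u) : ℝ)) *
            ((-Complex.I * h * (t u : ℝ)) ^ n / n !) = ((-Complex.I * h) ^ n / n !) *
            (χ u * expKernel ((k + n : ℕ) + 1) u *
              Complex.exp (-Complex.I * s * (Real.exp (-u) : ℝ))) := by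
          intro u
          have e1 : expKernel ((k + n : ℕ) + 1) u = expKernel (k + 1) u * (t u : ℂ) ^ n := by
            simp only [expKernel, t]
            rw [Complex.ofReal_exp, ← Complex.exp_nat_mul, ← Complex.exp_add]
            congr 1
            push_cast
            ring
          rw [e1, mul_pow]
          ring
        simp_rw [e]
        rw [integral_const_mul, hs (k + n), mul_zero]
      simp_rw [hz] at key
      exact key.unique hasSum_zero
    · rw [norm_mul, norm_mul, norm_mul, hunit, mul_one]
      refine le_of_eq ?_
      congr 1
      rw [norm_div, norm_pow, norm_mul, norm_mul, norm_neg, Complex.norm_I, one_mul,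
        Complex.norm_real, Complex.norm_real, Complex.norm_natCast, Real.norm_eq_abs,
        Real.norm_of_nonneg (Real.exp_pos _).le]
    · simp_rw [fun u => (hbound u).tsum_eq]
      refine (integrable_mul_exp_neg_mul_sub_exp hχ (s := k + 1) (c := 1 - |h|) (by positivity)
        (by linarith)).congr (Eventually.of_forall fun u => ?_)
      simp only
      rw [hnorm, mul_assoc, ← Real.exp_add]
      congr 2
      simp only [t]
      ring
  obtain ⟨N, hN⟩ := exists_nat_gt (2 * |s|)
  have hN0 : (0 : ℝ) < N := lt_of_le_of_lt (by positivity) hN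
  have hmul : ∀ n : ℕ, P (n * (s / N)) := by
    intro n
    induction n with
    | zero =>
      intro k
      simpa using h0 k
    | succ n ih =>
      have := step _ (s / N) ?_ ih
      · convert! this using 1
        push_cast
        ring
      · rw [abs_div, abs_of_pos hN0, div_le_iff₀ hN0]
        linarith
  have := hmul N k
  rwa [mul_div_cancel₀ _ hN0.ne'] at this

theorem ae_eq_zero_of_fourier_eq_zero {f : ℝ → ℂ} (hf : Integrable f)
    (h : FourierTransform.fourier f = 0) : f =ᵐ[volume] 0 := by
  refine ae_eq_zero_of_integral_contDiff_smul_eq_zero hf.locallyIntegrable fun g hg hc => ?_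
  have hg₁ : HasCompactSupport (Complex.ofRealCLM ∘ g) := hc.comp_left rfl
  have hg₂ : ContDiff ℝ (↑(⊤ : ℕ∞)) (Complex.ofRealCLM ∘ g) :=
    Complex.ofRealCLM.contDiff.comp hg
  set G : SchwartzMap ℝ ℂ := hg₁.toSchwartzMap hg₂
  have e : ∀ x, G x = (g x : ℂ) := fun x => by simp [G]
  set K : SchwartzMap ℝ ℂ := FourierTransform.fourierInv G
  have hK : FourierTransform.fourier (K : ℝ → ℂ) = G := by
    rw [← SchwartzMap.fourier_coe, FourierTransform.fourier_fourierInv_eq]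
  have h1 := integral_smul_fourier_eq hf K.integrable
  rw [h, hK] at h1
  simp only [Pi.zero_apply, smul_zero, integral_zero] at h1
  rw [h1]
  simp [e]

/-- A square integrable function orthogonal to the kernels at all positive integers vanishes. This
is the determinacy of the moment problem for the weight `e^{-t}` on `(0, ∞)`. -/
theorem ae_eq_zero_of_integral_mul_expKernel_eq_zero {χ : ℝ → ℂ} (hχ : MemLp χ 2)
    (h0 : ∀ k : ℕ, ∫ u, χ u * expKernel (k + 1) u = 0) : χ =ᵐ[volume] 0 := by
  -- after the substitution `t = e^{-u}` the vanishing integrals form the Fourier transform of `X`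
  let X : ℝ → ℂ := (Ioi 0).indicator fun t => χ (-Real.log t) * Real.exp (-t)
  have hinj : InjOn (fun u : ℝ => Real.exp (-u)) univ := fun a _ b _ h => by
    simpa using h
  have hder : ∀ u ∈ (univ : Set ℝ),
      HasDerivWithinAt (fun u : ℝ => Real.exp (-u)) (-Real.exp (-u)) univ u := fun u _ => by
    have h := (hasDerivAt_neg u).exp
    rw [mul_neg_one] at h
    exact h.hasDerivWithinAt
  have himg : (fun u : ℝ => Real.exp (-u)) '' univ = Ioi 0 := by
    rw [image_univ]
    ext t
    refine ⟨?_, fun ht => ⟨-Real.log t, by simp [Real.exp_log ht]⟩⟩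
    rintro ⟨u, rfl⟩
    exact Real.exp_pos _
  have hsubst : ∀ u, |-Real.exp (-u)| •
      (χ (-Real.log (Real.exp (-u))) * Real.exp (-Real.exp (-u))) =
      χ u * expKernel ((0 : ℕ) + 1) u := fun u => by
    rw [abs_neg, abs_of_pos (Real.exp_pos _), Real.log_exp, neg_neg, Complex.real_smul, expKernel,
      mul_left_comm]
    push_cast
    rw [← Complex.exp_add]
    congr 2
    ring
  have hint : Integrable X := by
    rw [integrable_indicator_iff measurableSet_Ioi, ← himg,
      integrableOn_image_iff_integrableOn_abs_deriv_smul MeasurableSet.univ hder hinj]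
    simp_rw [hsubst]
    rw [integrableOn_univ]
    exact integrable_mul_expKernel hχ (by simp)
  have hfour : FourierTransform.fourier X = 0 := by
    funext ξ
    rw [Real.fourier_eq', Pi.zero_apply,
      ← integral_mul_expKernel_mul_exp_eq_zero hχ h0 (2 * Real.pi * ξ) 0]
    have e : ∀ t : ℝ, Complex.exp ((-2 * Real.pi * inner ℝ t ξ : ℝ) * Complex.I) • X t =
        (Ioi 0).indicator (fun t => Complex.exp ((-2 * Real.pi * inner ℝ t ξ : ℝ) * Complex.I) *
          (χ (-Real.log t) * Real.exp (-t))) t := by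
      intro t
      by_cases ht : t ∈ Ioi (0 : ℝ)
      · simp only [X, indicator_of_mem ht, smul_eq_mul]
      · simp only [X, indicator_of_notMem ht, smul_zero]
    simp_rw [e]
    rw [integral_indicator measurableSet_Ioi, ← himg,
      integral_image_eq_integral_abs_deriv_smul MeasurableSet.univ hder hinj, setIntegral_univ]
    refine integral_congr_ae (Eventually.of_forall fun u => ?_)
    simp only
    rw [← hsubst, Complex.real_smul, Complex.real_smul, mul_left_comm,
      mul_comm _ (Complex.exp (-Complex.I * _ * _))]
    congr 2
    simp
    ring
  have hX := ae_eq_zero_of_fourier_eq_zero hint hfour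
  have hY : ∫⁻ u, ‖χ u * expKernel ((0 : ℕ) + 1) u‖ₑ = 0 := by
    simp_rw [← hsubst, enorm_smul]
    have := lintegral_image_eq_lintegral_abs_deriv_mul MeasurableSet.univ hder hinj
      (fun t => ‖χ (-Real.log t) * (Real.exp (-t) : ℝ)‖ₑ)
    rw [himg, setLIntegral_univ] at this
    simp_rw [← ofReal_norm (|_| : ℝ), Real.norm_eq_abs, abs_abs]
    rw [← this, ← lintegral_indicator measurableSet_Ioi]
    refine (lintegral_congr_ae ?_).trans lintegral_zero
    filter_upwards [hX] with t ht
    by_cases h : t ∈ Ioi (0 : ℝ)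
    · simp only [X, indicator_of_mem h] at ht
      rw [indicator_of_mem h, ht]
      simp
    · rw [indicator_of_notMem h]
  have hm : AEStronglyMeasurable (fun u => χ u * expKernel ((0 : ℕ) + 1) u) volume :=
    hχ.1.mul (continuous_expKernel _).aestronglyMeasurable
  rw [lintegral_eq_zero_iff' hm.enorm] at hY
  filter_upwards [hY] with u hu
  have hu' : χ u * expKernel ((0 : ℕ) + 1) u = 0 := by simpa using hu
  exact (mul_eq_zero.1 hu').resolve_right (Complex.exp_ne_zero _)

/-! ### Unitary maps between Hilbert spaces with total families -/

theorem denseRange_linearCombination {E : Type*} [NormedAddCommGroup E] [InnerProductSpace ℂ E]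
    [CompleteSpace E] {e : ℕ → E} (he : ∀ x, (∀ k, inner ℂ (e k) x = 0) → x = 0) :
    DenseRange (Finsupp.linearCombination ℂ e) := by
  have h : (Submodule.span ℂ (range e)).topologicalClosure = ⊤ := by
    rw [Submodule.topologicalClosure_eq_top_iff, Submodule.eq_bot_iff]
    intro x hx
    exact he x fun k => hx (e k) (Submodule.subset_span (mem_range_self k))
  have h2 := Submodule.dense_iff_topologicalClosure_eq_top.2 h
  rw [← Finsupp.range_linearCombination] at h2
  exact h2

/-- Two total families with the same Gram matrix are exchanged by a unitary map. -/
theorem exists_linearIsometryEquiv_of_inner_eq {E E' : Type*} [NormedAddCommGroup E]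
    [InnerProductSpace ℂ E] [CompleteSpace E] [NormedAddCommGroup E'] [InnerProductSpace ℂ E']
    [CompleteSpace E'] {e : ℕ → E} {f : ℕ → E'}
    (he : ∀ x, (∀ k, inner ℂ (e k) x = 0) → x = 0) (hf : ∀ x, (∀ k, inner ℂ (f k) x = 0) → x = 0)
    (h : ∀ j k, inner ℂ (e j) (e k) = inner ℂ (f j) (f k)) :
    ∃ J : E ≃ₗᵢ[ℂ] E', ∀ k, J (e k) = f k := by
  have hnorm : ∀ c : ℕ →₀ ℂ,
      ‖Finsupp.linearCombination ℂ f (LinearEquiv.refl ℂ (ℕ →₀ ℂ) c)‖ =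
        ‖Finsupp.linearCombination ℂ e c‖ := by
    intro c
    have : inner ℂ (Finsupp.linearCombination ℂ f c) (Finsupp.linearCombination ℂ f c) =
        inner ℂ (Finsupp.linearCombination ℂ e c) (Finsupp.linearCombination ℂ e c) := by
      simp only [Finsupp.linearCombination_apply, Finsupp.sum_inner, Finsupp.inner_sum,
        inner_smul_left, inner_smul_right, h]
    rw [inner_self_eq_norm_sq_to_K, inner_self_eq_norm_sq_to_K] at this
    have h2 : ‖Finsupp.linearCombination ℂ f c‖ ^ 2 = ‖Finsupp.linearCombination ℂ e c‖ ^ 2 := by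
      exact_mod_cast this
    exact (pow_left_inj₀ (norm_nonneg _) (norm_nonneg _) two_ne_zero).1 h2
  refine ⟨(LinearEquiv.refl ℂ (ℕ →₀ ℂ)).extendOfIsometry (Finsupp.linearCombination ℂ e)
    (Finsupp.linearCombination ℂ f) (denseRange_linearCombination he)
    (denseRange_linearCombination hf) hnorm, fun k => ?_⟩
  have := LinearEquiv.extendOfIsometry_eq (LinearEquiv.refl ℂ (ℕ →₀ ℂ))
    (Finsupp.linearCombination ℂ e) (Finsupp.linearCombination ℂ f)
    (denseRange_linearCombination he) (denseRange_linearCombination hf) hnorm (Finsupp.single k 1)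
  simpa using this

/-! ### The Bergman space as a closed subspace of `L²(Δ)` -/

theorem isOpen_disc : IsOpen disc := Metric.isOpen_ball

theorem measurableSet_disc : MeasurableSet disc := isOpen_disc.measurableSet

instance : IsFiniteMeasure ((volume : Measure ℂ).restrict disc) :=
  isFiniteMeasure_restrict.2 measure_ball_lt_top.ne

theorem bergmanSpace_integrableOn (f : bergmanSpace) : IntegrableOn (zeroExt f.1) disc :=
  f.2.2.integrable (by norm_num)

/-- The inclusion of the Bergman space in `L²(Δ)`. -/
noncomputable def bergmanToLp : bergmanSpace →ₗ[ℂ] Lp ℂ 2 ((volume : Measure ℂ).restrict disc) where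
  toFun f := f.2.2.toLp
  map_add' f g := by
    rw [← MemLp.toLp_add]
    exact MemLp.toLp_congr _ _ (Eventually.of_forall fun z => congrFun (zeroExt_add f.1 g.1) z)
  map_smul' c f := by
    rw [RingHom.id_apply, ← MemLp.toLp_const_smul]
    exact MemLp.toLp_congr _ _ (Eventually.of_forall fun z => congrFun (zeroExt_smul c f.1) z)

theorem coeFn_bergmanToLp (f : bergmanSpace) :
    bergmanToLp f =ᵐ[volume.restrict disc] zeroExt f.1 := f.2.2.coeFn_toLp

theorem norm_bergmanToLp_sq (f : bergmanSpace) :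
    ‖bergmanToLp f‖ ^ 2 = ∫ ζ in disc, ‖zeroExt f.1 ζ‖ ^ 2 := by
  have h : inner ℂ (bergmanToLp f) (bergmanToLp f) = ((‖bergmanToLp f‖ ^ 2 : ℝ) : ℂ) := by
    rw [inner_self_eq_norm_sq_to_K]
    push_cast
    rfl
  rw [L2.inner_def] at h
  apply Complex.ofReal_injective
  rw [← h, ← integral_complex_ofReal]
  refine integral_congr_ae ?_
  filter_upwards [coeFn_bergmanToLp f] with ζ hζ
  rw [hζ, inner_self_eq_norm_sq_to_K]
  push_cast
  rfl

theorem norm_bergmanToLp (f : bergmanSpace) :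
    ‖bergmanToLp f‖ = Real.sqrt Real.pi * bergmanNorm f := by
  rw [bergmanNorm, ← norm_bergmanToLp_sq, ← Real.sqrt_mul Real.pi_pos.le, ← mul_assoc,
    mul_one_div_cancel Real.pi_ne_zero, one_mul, Real.sqrt_sq (norm_nonneg _)]

/-- A holomorphic function on the disc orthogonal to all polynomials vanishes. -/
theorem bergmanSpace_eq_zero_of_integral_eq_zero {f : bergmanSpace}
    (h : ∀ k : ℕ, ∫ ζ in disc, conj ζ ^ k * zeroExt f.1 ζ = 0) : f = 0 := by
  obtain ⟨p, hp⟩ := exists_hasFPowerSeriesOnBall one_pos (show DifferentiableOn ℂ (zeroExt f.1)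
    (Metric.ball 1 1) from f.2.1)
  have hi := bergmanSpace_integrableOn f
  have hki : ∀ k : ℕ, IntegrableOn (fun ζ => conj ζ ^ k * zeroExt f.1 ζ) disc := fun k => by
    refine Integrable.bdd_mul (c := 2 ^ k) hi (by fun_prop) ?_
    refine ae_restrict_of_forall_mem measurableSet_disc fun ζ hζ => ?_
    rw [norm_pow, RCLike.norm_conj]
    refine pow_le_pow_left₀ (norm_nonneg _) ?_ k
    have h1 : ‖ζ - 1‖ < 1 := mem_ball_iff_norm.1 hζ
    have h2 := norm_add_le (ζ - 1) 1
    rw [sub_add_cancel, norm_one] at h2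
    linarith
  have hcoeff : ∀ m, p.coeff m = 0 := by
    intro m
    have h1 := integral_ball_conj_pow_mul one_pos hp hi m
    have h2 : ∫ ζ in Metric.ball 1 1, conj (ζ - 1) ^ m * zeroExt f.1 ζ = 0 := by
      have e : ∀ ζ : ℂ, conj (ζ - 1) ^ m * zeroExt f.1 ζ =
          ∑ k ∈ Finset.range (m + 1), ((-1) ^ (m - k) * m.choose k : ℂ) *
            (conj ζ ^ k * zeroExt f.1 ζ) := by
        intro ζ
        rw [map_sub, map_one, sub_eq_add_neg, add_pow, Finset.sum_mul]
        exact Finset.sum_congr rfl fun k _ => by ring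
      simp_rw [e]
      change ∫ ζ in disc, _ = 0
      rw [integral_finsetSum _ fun k _ => (hki k).const_mul _]
      refine Finset.sum_eq_zero fun k _ => ?_
      rw [integral_const_mul]
      exact mul_eq_zero_of_right _ (h k)
    rw [h2] at h1
    have hm : (m : ℂ) + 1 ≠ 0 := by exact_mod_cast Nat.succ_ne_zero m
    have hpi : (Real.pi : ℂ) ≠ 0 := by exact_mod_cast Real.pi_ne_zero
    refine (mul_eq_zero.1 h1.symm).resolve_left ?_
    simp [hm, hpi]
  ext ζ
  have hζ : (ζ : ℂ) - 1 ∈ Metric.eball (0 : ℂ) (ENNReal.ofReal 1) := by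
    rw [Metric.eball_ofReal, mem_ball_zero_iff]
    exact mem_ball_iff_norm.1 ζ.2
  have hs := hp.hasSum hζ
  have hz : ∀ n, (p n fun _ => (ζ : ℂ) - 1) = 0 := fun n => by
    rw [FormalMultilinearSeries.apply_eq_pow_smul_coeff, hcoeff, smul_zero]
  simp_rw [hz] at hs
  have := hs.unique hasSum_zero
  rw [add_sub_cancel, zeroExt_apply] at this
  exact this

theorem bergmanToLp_injective : Function.Injective bergmanToLp := by
  rw [injective_iff_map_eq_zero]
  intro f hf
  refine bergmanSpace_eq_zero_of_integral_eq_zero fun k => ?_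
  refine (integral_congr_ae ?_).trans (integral_zero ℂ ℂ)
  have h0 : bergmanToLp f =ᵐ[volume.restrict disc] 0 := by
    rw [hf]
    exact Lp.coeFn_zero _ _ _
  filter_upwards [coeFn_bergmanToLp f, h0] with ζ h1 h2
  rw [← h1, h2]
  simp

/-- A limit in `L²(Δ)` of holomorphic functions is holomorphic: by the area mean value property
the convergence is locally uniform. -/
theorem isClosed_range_bergmanToLp : IsClosed (bergmanToLp.range : Set (Lp ℂ 2
    ((volume : Measure ℂ).restrict disc))) := by
  refine IsSeqClosed.isClosed fun x y hx hxy => ?_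
  choose f hf using hx
  let r : ℂ → ℝ := fun z => 1 - dist z 1
  have hr : ∀ z ∈ disc, 0 < r z := fun z hz => sub_pos.2 hz
  have hsub : ∀ z, Metric.ball z (r z) ⊆ disc := fun z =>
    Metric.ball_subset_ball' (by simp [r])
  have hyi : IntegrableOn y disc := (Lp.memLp y).integrable (by norm_num)
  let g : ℂ → ℂ := fun z => (Real.pi * r z ^ 2 : ℂ)⁻¹ * ∫ ζ in Metric.ball z (r z), y ζ
  -- the L¹ distance on the disc controls pointwise values
  let d : ℕ → ℝ := fun n => ∫ ζ in disc, ‖zeroExt (f n).1 ζ - y ζ‖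
  have hd : Tendsto d atTop (𝓝 0) := by
    have h1 := (Lp.tendsto_Lp_iff_tendsto_eLpNorm' _ _).1 hxy
    have h2 : Tendsto (fun n => eLpNorm (⇑(x n) - ⇑y) 1 (volume.restrict disc)) atTop (𝓝 0) := by
      have h3 := ENNReal.Tendsto.mul_const (b := (volume.restrict disc) univ ^
        (1 / (1 : ℝ≥0∞).toReal - 1 / (2 : ℝ≥0∞).toReal)) h1 (Or.inr ?_)
      · rw [zero_mul] at h3
        refine tendsto_of_tendsto_of_tendsto_of_le_of_le tendsto_const_nhds h3
          (fun _ => zero_le) fun n => ?_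
        exact eLpNorm_le_eLpNorm_mul_rpow_measure_univ (by norm_num)
          ((Lp.aestronglyMeasurable _).sub (Lp.aestronglyMeasurable _))
      · exact ENNReal.rpow_ne_top_of_nonneg (by norm_num) (measure_ne_top _ _)
    have h4 := (ENNReal.tendsto_toReal ENNReal.zero_ne_top).comp h2
    rw [ENNReal.toReal_zero] at h4
    refine h4.congr fun n => ?_
    simp only [Function.comp, d]
    rw [eLpNorm_one_eq_lintegral_enorm, integral_norm_eq_lintegral_enorm]
    · congr 1
      refine lintegral_congr_ae ?_
      filter_upwards [coeFn_bergmanToLp (f n)] with ζ hζ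
      rw [← hζ, hf n, Pi.sub_apply]
    · exact (f n).2.2.1.sub (Lp.aestronglyMeasurable _)
  have hle : ∀ n, ∀ z ∈ disc, dist (g z) (zeroExt (f n).1 z) ≤ (Real.pi * r z ^ 2)⁻¹ * d n := by
    intro n z hz
    have hfi := bergmanSpace_integrableOn (f n)
    have hrz := hr z hz
    have hpos : 0 < Real.pi * r z ^ 2 := by positivity
    have hposC : (Real.pi * r z ^ 2 : ℂ) ≠ 0 := by exact_mod_cast hpos.ne'
    have hmv := integral_ball_eq_mul_center hrz ((f n).2.1.mono (hsub z)) (hfi.mono_set (hsub z))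
    have hval : zeroExt (f n).1 z = (Real.pi * r z ^ 2 : ℂ)⁻¹ *
        ∫ ζ in Metric.ball z (r z), zeroExt (f n).1 ζ := by
      rw [hmv, inv_mul_cancel_left₀ hposC]
    rw [dist_comm, dist_eq_norm, hval, ← mul_sub, ← integral_sub (hfi.mono_set (hsub z))
      (hyi.mono_set (hsub z)), norm_mul]
    have e : ‖(Real.pi * r z ^ 2 : ℂ)⁻¹‖ = (Real.pi * r z ^ 2)⁻¹ := by
      rw [norm_inv, ← Complex.ofReal_pow, ← Complex.ofReal_mul, Complex.norm_real,
        Real.norm_of_nonneg hpos.le]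
    rw [e]
    refine mul_le_mul_of_nonneg_left ((norm_integral_le_integral_norm _).trans ?_)
      (inv_pos.2 hpos).le
    exact setIntegral_mono_set (hfi.sub hyi).norm (Eventually.of_forall fun _ => norm_nonneg _)
      (hsub z).eventuallyLE
  have hloc : TendstoLocallyUniformlyOn (fun n => zeroExt (f n).1) g atTop disc := by
    rw [Metric.tendstoLocallyUniformlyOn_iff]
    intro ε hε z hz
    have hrz := hr z hz
    have hrc : Continuous r := by fun_prop
    refine ⟨{w | r z / 2 < r w} ∩ disc, inter_mem (mem_nhdsWithin_of_mem_nhds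
      ((isOpen_lt continuous_const hrc).mem_nhds (by simp only [mem_ofPred_eq]; linarith)))
      self_mem_nhdsWithin, ?_⟩
    have h1 := hd.const_mul (Real.pi * (r z / 2) ^ 2)⁻¹
    rw [mul_zero] at h1
    filter_upwards [h1.eventually (gt_mem_nhds hε)] with n hn w hw
    refine ((hle n w hw.2).trans ?_).trans_lt hn
    have hdn : 0 ≤ d n := integral_nonneg fun _ => norm_nonneg _
    refine mul_le_mul_of_nonneg_right (inv_anti₀ (by positivity) ?_) hdn
    have : r z / 2 ≤ r w := le_of_lt hw.1
    gcongr
  have hgd : DifferentiableOn ℂ g disc :=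
    hloc.differentiableOn (Eventually.of_forall fun n => (f n).2.1) isOpen_disc
  have hgy : g =ᵐ[volume.restrict disc] y := by
    obtain ⟨ns, hns, h1⟩ := (tendstoInMeasure_of_tendsto_Lp hxy).exists_seq_tendsto_ae
    have hall : ∀ᵐ ζ ∂(volume.restrict disc), ∀ n, x n ζ = zeroExt (f n).1 ζ :=
      ae_all_iff.2 fun n => by
        rw [← hf n]
        exact coeFn_bergmanToLp (f n)
    filter_upwards [h1, hall, ae_restrict_mem measurableSet_disc] with ζ h1 h2 h3
    have h4 := (hloc.tendsto_at h3).comp hns.tendsto_atTop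
    refine tendsto_nhds_unique (h4.congr fun n => ?_) h1
    simp only [Function.comp_apply, h2]
  let G : disc → ℂ := fun z => g z
  have hG : EqOn (zeroExt G) g disc := fun z hz => zeroExt_of_mem G hz
  have hGae : zeroExt G =ᵐ[volume.restrict disc] g :=
    ae_restrict_of_forall_mem measurableSet_disc hG
  have hGmem : MemLp (zeroExt G) 2 (volume.restrict disc) :=
    (memLp_congr_ae (hGae.trans hgy)).2 (Lp.memLp y)
  refine ⟨⟨G, hgd.congr hG, hGmem⟩, ?_⟩
  exact Lp.ext (hGmem.coeFn_toLp.trans (hGae.trans hgy))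

/-! ### The Mellin–Bergman transform on the disc -/

theorem ne_zero_of_mem_disc {w : ℂ} (hw : w ∈ disc) : w ≠ 0 := by
  rintro rfl
  have := mem_ball_iff_norm.1 hw
  simp at this

theorem norm_lt_two_of_mem_disc {w : ℂ} (hw : w ∈ disc) : ‖w‖ < 2 := by
  have h1 : ‖w - 1‖ < 1 := mem_ball_iff_norm.1 hw
  have h2 := norm_add_le (w - 1) 1
  rw [sub_add_cancel, norm_one] at h2
  linarith

theorem norm_sq_lt_of_mem_disc {w : ℂ} (hw : w ∈ disc) : ‖w‖ ^ 2 < 2 * w.re := by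
  have h1 : ‖w - 1‖ < 1 := mem_ball_iff_norm.1 hw
  have h2 : ‖w - 1‖ ^ 2 < 1 := by nlinarith [norm_nonneg (w - 1)]
  rw [Complex.sq_norm, Complex.normSq_apply] at h2 ⊢
  simp only [Complex.sub_re, Complex.one_re, Complex.sub_im, Complex.one_im, sub_zero] at h2
  linarith

theorem re_pos_of_mem_disc {w : ℂ} (hw : w ∈ disc) : 0 < w.re := by
  nlinarith [norm_sq_lt_of_mem_disc hw, sq_nonneg ‖w‖]

theorem conj_mem_disc {w : ℂ} : conj w ∈ disc ↔ w ∈ disc := by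
  rw [disc, mem_ball_iff_norm, mem_ball_iff_norm, ← RCLike.norm_conj (w - 1), map_sub, map_one]

/-- In the part of the disc outside the unit disc the argument is less than `π / 3` and
`log ‖w‖ < 0.7`, so that the factor `‖w‖ ^ (Re z - 1)` costs nothing; inside the unit disc that
factor is at most `‖w‖ ^ (δ - 1)`, and `|arg w| < π / 2`. -/
theorem norm_cpow_sub_one_le {δ : ℝ} {z : ℂ} (hz : δ ≤ z.re) {w : ℂ} (hw : w ∈ disc) :
    ‖w ^ (z - 1)‖ ≤ (1 + ‖w‖ ^ (δ - 1)) * Real.exp (Real.pi / 2 * ‖z‖) := by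
  have hw0 := ne_zero_of_mem_disc hw
  have hpos : 0 < ‖w‖ := norm_pos_iff.2 hw0
  have hpi := Real.pi_gt_three
  rw [Complex.norm_cpow_of_ne_zero hw0, div_eq_mul_inv, ← Real.exp_neg]
  simp only [Complex.sub_re, Complex.one_re, Complex.sub_im, Complex.one_im, sub_zero]
  have him := Complex.abs_im_le_norm z
  rcases le_or_gt 1 ‖w‖ with h | h
  · have hcos : 1 / 2 < Real.cos |w.arg| := by
      have h1 := norm_sq_lt_of_mem_disc hw
      rw [← Complex.norm_mul_cos_arg w] at h1
      rw [Real.cos_abs]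
      have : ‖w‖ * ‖w‖ < ‖w‖ * (2 * Real.cos w.arg) := by linarith
      have := lt_of_mul_lt_mul_left this hpos.le
      linarith
    have harg : |w.arg| < Real.pi / 3 := by
      by_contra! hcon
      have := Real.strictAntiOn_cos.antitoneOn ⟨by positivity, by linarith⟩
        ⟨abs_nonneg _, Complex.abs_arg_le_pi w⟩ hcon
      rw [Real.cos_pi_div_three] at this
      linarith
    have hl0 : 0 ≤ Real.log ‖w‖ := Real.log_nonneg h
    have hl1 : Real.log ‖w‖ < 0.7 :=
      (Real.log_lt_log hpos (norm_lt_two_of_mem_disc hw)).trans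
        (Real.log_two_lt_d9.trans (by norm_num))
    -- Cauchy–Schwarz for the vectors `(log ‖w‖, arg w)` and `(Re z, Im z)`
    have hkey : Real.log ‖w‖ * z.re + -(w.arg * z.im) ≤ Real.pi / 2 * ‖z‖ := by
      refine le_of_sq_le_sq ?_ (by positivity)
      rw [mul_pow, Complex.sq_norm, Complex.normSq_apply]
      have h1 : Real.log ‖w‖ ^ 2 < 0.5 := by nlinarith
      have h2 : w.arg ^ 2 < (Real.pi / 3) ^ 2 := by
        rw [← sq_abs]
        exact pow_lt_pow_left₀ harg (abs_nonneg _) (by norm_num)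
      have h3 : Real.log ‖w‖ ^ 2 + w.arg ^ 2 ≤ (Real.pi / 2) ^ 2 := by nlinarith
      calc _ ≤ (Real.log ‖w‖ ^ 2 + w.arg ^ 2) * (z.re * z.re + z.im * z.im) := by
            nlinarith [sq_nonneg (Real.log ‖w‖ * z.im + w.arg * z.re)]
        _ ≤ _ := mul_le_mul_of_nonneg_right h3
          (add_nonneg (mul_self_nonneg _) (mul_self_nonneg _))
    have h0 : 0 ≤ ‖w‖ ^ (δ - 1) := by positivity
    calc _ = Real.exp (Real.log ‖w‖ * z.re + -(w.arg * z.im) - Real.log ‖w‖) := by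
          rw [Real.rpow_def_of_pos hpos, ← Real.exp_add]
          ring_nf
      _ ≤ 1 * Real.exp (Real.pi / 2 * ‖z‖) := by
          rw [one_mul]
          exact Real.exp_le_exp.2 (by linarith)
      _ ≤ _ := by gcongr; linarith
  · have harg : |w.arg| < Real.pi / 2 :=
      Complex.abs_arg_lt_pi_div_two_iff.2 (Or.inl (re_pos_of_mem_disc hw))
    refine mul_le_mul ?_ (Real.exp_le_exp.2 ?_) (Real.exp_nonneg _) (by positivity)
    · have : ‖w‖ ^ (z.re - 1) ≤ ‖w‖ ^ (δ - 1) :=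
        Real.rpow_le_rpow_of_exponent_ge hpos h.le (by linarith)
      linarith
    · refine (neg_le_abs _).trans ?_
      rw [abs_mul]
      exact mul_le_mul harg.le him (abs_nonneg _) (by positivity)

/-- As `0` lies on the boundary of the disc, this is integrability of `r ^ (2δ - 2)` near `0` in the
plane, which needs `0 < δ`. -/
theorem memLp_norm_rpow {δ : ℝ} (hδ : 0 < δ) :
    MemLp (fun w : ℂ => ‖w‖ ^ (δ - 1)) 2 (volume.restrict disc) := by
  have hm : Measurable fun w : ℂ => ‖w‖ ^ (δ - 1) := by fun_prop
  rw [memLp_two_iff_integrable_sq hm.aestronglyMeasurable]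
  have hsub : disc ⊆ Metric.ball (0 : ℂ) 2 := fun w hw => by
    simpa using norm_lt_two_of_mem_disc hw
  refine IntegrableOn.mono_set (t := Metric.ball (0 : ℂ) 2) ?_ hsub
  refine (integrableOn_fun_norm_addHaar volume (f := fun y => (y ^ (δ - 1)) ^ 2)).2 ?_
  rw [Complex.finrank_real_complex]
  have h1 : IntervalIntegrable (fun x : ℝ => x ^ (2 * δ - 1)) volume 0 2 :=
    intervalIntegral.intervalIntegrable_rpow' (by linarith)
  rw [intervalIntegrable_iff_integrableOn_Ioo_of_le (by norm_num)] at h1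
  refine h1.congr_fun (fun y hy => ?_) measurableSet_Ioo
  have hy0 : 0 < y := hy.1
  simp only [Nat.add_one_sub_one, pow_one, smul_eq_mul]
  rw [← Real.rpow_natCast (y ^ (δ - 1)) 2, ← Real.rpow_mul hy0.le]
  nth_rewrite 2 [← Real.rpow_one y]
  rw [← Real.rpow_add hy0]
  congr 1
  push_cast
  ring

theorem memLp_conj_cpow {z : ℂ} (hz : 0 < z.re) :
    MemLp (fun w : ℂ => conj w ^ (z - 1)) 2 (volume.restrict disc) := by
  have h := ((memLp_const (1 : ℝ)).add (memLp_norm_rpow hz)).mul_const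
    (Real.exp (Real.pi / 2 * ‖z‖))
  refine h.mono (Measurable.aestronglyMeasurable (by fun_prop)) ?_
  refine ae_restrict_of_forall_mem measurableSet_disc fun w hw => ?_
  refine (norm_cpow_sub_one_le le_rfl (conj_mem_disc.2 hw)).trans ?_
  rw [RCLike.norm_conj]
  exact le_abs_self _

/-- A function `M_Δ f` grows at most like the kernel, hence is of exponential type at most
`π / 2`. -/
theorem exists_norm_mellinBergman_le (f : bergmanSpace) {δ : ℝ} (hδ : 0 < δ) :
    ∃ C : ℝ, ∀ z : ℂ, δ ≤ z.re → ‖mellinBergman f z‖ ≤ C * Real.exp (Real.pi / 2 * ‖z‖) := by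
  refine ⟨Real.pi⁻¹ * ∫ w in disc, ‖zeroExt f.1 w‖ * (1 + ‖w‖ ^ (δ - 1)), fun z hz => ?_⟩
  rw [mellinBergman, norm_mul, mul_assoc]
  have e : ‖1 / (Real.pi : ℂ)‖ = Real.pi⁻¹ := by
    rw [norm_div, norm_one, Complex.norm_real, Real.norm_of_nonneg Real.pi_pos.le, one_div]
  rw [e]
  refine mul_le_mul_of_nonneg_left ?_ (by positivity)
  rw [← integral_mul_const]
  refine norm_integral_le_of_norm_le ?_ ?_
  · refine Integrable.mul_const ?_ _
    exact f.2.2.norm.integrable_mul ((memLp_const (1 : ℝ)).add (memLp_norm_rpow hδ))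
  · refine ae_restrict_of_forall_mem measurableSet_disc fun w hw => ?_
    rw [norm_mul, mul_assoc]
    refine mul_le_mul_of_nonneg_left ?_ (norm_nonneg _)
    have := norm_cpow_sub_one_le hz (conj_mem_disc.2 hw)
    rwa [RCLike.norm_conj] at this

/-- The transform `M_Δ` at a point is an inner product against an element of `L²(Δ)`. -/
theorem exists_mellinBergman_eq_inner {z : ℂ} (hz : 0 < z.re) :
    ∃ κ : Lp ℂ 2 ((volume : Measure ℂ).restrict disc), ∀ f : bergmanSpace,
      mellinBergman f z = inner ℂ κ (bergmanToLp f) := by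
  have hκ : MemLp (fun w : ℂ => conj (conj w ^ (z - 1)) * (1 / (Real.pi : ℂ))) 2
      (volume.restrict disc) := (memLp_conj_cpow hz).star.mul_const _
  refine ⟨hκ.toLp, fun f => ?_⟩
  rw [mellinBergman, L2.inner_def, ← integral_const_mul]
  refine integral_congr_ae ?_
  filter_upwards [hκ.coeFn_toLp, coeFn_bergmanToLp f] with w h1 h2
  rw [h1, h2, RCLike.inner_apply, map_mul, Complex.conj_conj, map_div₀, map_one,
    Complex.conj_ofReal]
  ring

/-- The function `ζ ^ k` in the Bergman space. -/
noncomputable def bergmanPow (k : ℕ) : bergmanSpace :=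
  ⟨fun ζ => (ζ : ℂ) ^ k, by
    have h : EqOn (zeroExt fun ζ : disc => (ζ : ℂ) ^ k) (fun ζ => ζ ^ k) disc := fun ζ hζ =>
      zeroExt_of_mem _ hζ
    refine ⟨(Differentiable.differentiableOn (by fun_prop)).congr h, ?_⟩
    refine (memLp_congr_ae (ae_restrict_of_forall_mem measurableSet_disc h)).2 ?_
    refine MemLp.of_bound (Continuous.aestronglyMeasurable (by fun_prop)) (2 ^ k) ?_
    refine ae_restrict_of_forall_mem measurableSet_disc fun ζ hζ => ?_
    rw [norm_pow]
    exact pow_le_pow_left₀ (norm_nonneg _) (norm_lt_two_of_mem_disc hζ).le k⟩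

theorem zeroExt_bergmanPow (k : ℕ) {ζ : ℂ} (hζ : ζ ∈ disc) :
    zeroExt (bergmanPow k).1 ζ = ζ ^ k := zeroExt_of_mem _ hζ

theorem inner_bergmanPow (k : ℕ) (f : bergmanSpace) :
    inner ℂ (bergmanToLp (bergmanPow k)) (bergmanToLp f) =
      ∫ ζ in disc, conj ζ ^ k * zeroExt f.1 ζ := by
  rw [L2.inner_def]
  refine integral_congr_ae ?_
  filter_upwards [coeFn_bergmanToLp (bergmanPow k), coeFn_bergmanToLp f,
    ae_restrict_mem measurableSet_disc] with ζ h1 h2 h3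
  rw [h1, h2, zeroExt_bergmanPow k h3, RCLike.inner_apply, map_pow, mul_comm]

/-- The values of `M_Δ f` at the positive integers are the moments of `f`. -/
theorem mellinBergman_natCast_add_one (j : ℕ) (f : bergmanSpace) :
    mellinBergman f (j + 1) = 1 / (Real.pi : ℂ) *
      inner ℂ (bergmanToLp (bergmanPow j)) (bergmanToLp f) := by
  rw [inner_bergmanPow, mellinBergman]
  congr 1
  refine integral_congr_ae (Eventually.of_forall fun ζ => ?_)
  simp only [add_sub_cancel_right, Complex.cpow_natCast]
  rw [mul_comm]

theorem hasFPowerSeriesOnBall_cpow (a : ℂ) :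
    HasFPowerSeriesOnBall (fun w : ℂ => w ^ a) (binomialSeries ℂ a) 1 (ENNReal.ofReal 1) := by
  have := (Complex.one_add_cpow_hasFPowerSeriesOnBall_zero (a := a)).comp_sub 1
  simpa using this

theorem integral_disc_conj (f : ℂ → ℂ) : ∫ ζ in disc, f (conj ζ) = ∫ ζ in disc, f ζ := by
  have h := (LinearIsometryEquiv.measurePreserving Complex.conjLIE).setIntegral_preimage_emb
    Complex.conjLIE.toHomeomorph.measurableEmbedding f disc
  have e : Complex.conjLIE ⁻¹' disc = disc := by
    ext w
    exact conj_mem_disc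
  rw [e] at h
  exact h

/-- Vandermonde's identity in the form needed to transform `ζ ^ k`. -/
theorem sum_choose_mul_ringChoose (k : ℕ) (z : ℂ) :
    ∑ m ∈ Finset.range (k + 1), (k.choose m : ℂ) * (Ring.choose (z - 1) m / (m + 1)) =
      (ascPochhammer ℂ k).eval (1 + z) / (k + 1)! := by
  have h1 := Ring.add_choose_eq k (Commute.all (z - 1) ((k : ℂ) + 1))
  have h2 := Ring.factorial_nsmul_multichoose_eq_ascPochhammer (1 + z) k
  rw [Ring.multichoose_eq, Polynomial.ascPochhammer_smeval_eq_eval] at h2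
  rw [show z - 1 + ((k : ℂ) + 1) = 1 + z + k - 1 by ring] at h1
  rw [h1, Finset.Nat.sum_antidiagonal_eq_sum_range_succ_mk] at h2
  rw [← h2, nsmul_eq_mul, Nat.factorial_succ]
  have hk : ((k ! : ℕ) : ℂ) ≠ 0 := by exact_mod_cast k.factorial_ne_zero
  have hk1 : (k : ℂ) + 1 ≠ 0 := by exact_mod_cast k.succ_ne_zero
  push_cast
  rw [mul_comm ((k : ℂ) + 1), mul_div_mul_left _ _ hk, Finset.sum_div]
  refine Finset.sum_congr rfl fun m hm => ?_
  have hmk : m ≤ k := Nat.lt_succ_iff.1 (Finset.mem_range.1 hm)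
  have hm1 : (m : ℂ) + 1 ≠ 0 := by exact_mod_cast m.succ_ne_zero
  have h3 : Ring.choose ((k : ℂ) + 1) (k - m) = ((k + 1).choose (m + 1) : ℂ) := by
    rw [← Nat.cast_succ, Ring.choose_natCast, ← Nat.choose_symm_of_eq_add
      (show k + 1 = (m + 1) + (k - m) by lia)]
  have h4 : ((k + 1).choose (m + 1) : ℂ) * (m + 1) = (k + 1) * k.choose m := by
    exact_mod_cast (Nat.add_one_mul_choose_eq k m).symm
  rw [h3]
  field_simp
  linear_combination (-Ring.choose (z - 1) m) * h4

/-- The transform of `ζ ^ k` is the polynomial `(z + 1)(z + 2)⋯(z + k) / (k + 1)!`. -/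
theorem mellinBergman_bergmanPow (k : ℕ) {z : ℂ} (hz : 0 < z.re) :
    mellinBergman (bergmanPow k) z = (ascPochhammer ℂ k).eval (1 + z) / (k + 1)! := by
  have hint : IntegrableOn (fun w : ℂ => w ^ (z - 1)) disc := by
    have h := (memLp_conj_cpow hz).integrable (by norm_num)
    have e : Complex.conjLIE ⁻¹' disc = disc := by
      ext w
      exact conj_mem_disc
    have := ((LinearIsometryEquiv.measurePreserving Complex.conjLIE).integrableOn_comp_preimage
      Complex.conjLIE.toHomeomorph.measurableEmbedding
      (f := fun w : ℂ => w ^ (z - 1)) (s := disc)).1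
    rw [e] at this
    exact this h
  have hmom := fun m => integral_ball_conj_pow_mul one_pos
    (hasFPowerSeriesOnBall_cpow (z - 1)) hint m
  have hmom' : ∀ m : ℕ, ∫ ζ in disc, conj (ζ - 1) ^ m * ζ ^ (z - 1) =
      (Real.pi : ℂ) * (Ring.choose (z - 1) m / (m + 1)) := fun m => by
    rw [disc, hmom m, binomialSeries, FormalMultilinearSeries.coeff_ofScalars]
    push_cast
    ring
  have hmi : ∀ m : ℕ, IntegrableOn (fun ζ : ℂ => conj (ζ - 1) ^ m * ζ ^ (z - 1)) disc :=
    fun m => by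
    refine Integrable.bdd_mul (c := 1) hint (by fun_prop) ?_
    refine ae_restrict_of_forall_mem measurableSet_disc fun ζ hζ => ?_
    rw [norm_pow, RCLike.norm_conj]
    exact pow_le_one₀ (norm_nonneg _) (mem_ball_iff_norm.1 hζ).le
  have hpi : (Real.pi : ℂ) ≠ 0 := by exact_mod_cast Real.pi_ne_zero
  have h1 : ∫ ζ in disc, zeroExt (bergmanPow k).1 ζ * conj ζ ^ (z - 1) =
      ∫ ζ in disc, conj ζ ^ k * ζ ^ (z - 1) := by
    rw [← integral_disc_conj]
    refine setIntegral_congr_fun measurableSet_disc fun ζ hζ => ?_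
    simp only [zeroExt_bergmanPow k (conj_mem_disc.2 hζ), Complex.conj_conj]
  have e : ∀ ζ : ℂ, conj ζ ^ k * ζ ^ (z - 1) = ∑ m ∈ Finset.range (k + 1),
      (k.choose m : ℂ) * (conj (ζ - 1) ^ m * ζ ^ (z - 1)) := by
    intro ζ
    rw [show conj ζ = conj (ζ - 1) + 1 by simp, add_pow, Finset.sum_mul]
    exact Finset.sum_congr rfl fun m _ => by simp; ring
  rw [mellinBergman, h1]
  simp_rw [e]
  rw [integral_finsetSum _ fun m _ => (hmi m).const_mul _]
  simp_rw [integral_const_mul, hmom']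
  rw [← sum_choose_mul_ringChoose, Finset.mul_sum]
  refine Finset.sum_congr rfl fun m _ => ?_
  field_simp

theorem ascPochhammer_eval_one_add (k : ℕ) {z : ℂ} (hz : 0 < z.re) :
    (ascPochhammer ℂ k).eval (1 + z) = Complex.Gamma (z + (k + 1)) / Complex.Gamma (1 + z) := by
  rw [show z + ((k : ℂ) + 1) = 1 + z + k by ring, Complex.Gamma_add_nat_div_Gamma_eq]
  intro m hm
  have := congrArg Complex.re hm
  simp only [Complex.add_re, Complex.one_re, Complex.neg_re, Complex.natCast_re] at this
  linarith [(Nat.cast_nonneg m : (0 : ℝ) ≤ m)]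

/-! ### The space `ℋ` as a scaled copy of `L²(ℝ)` -/

theorem two_cpow_mul_half_cpow (s : ℂ) : (2 : ℂ) ^ s * (1 / 2 : ℂ) ^ s = 1 := by
  have h2 : (2 : ℂ) ≠ 0 := two_ne_zero
  rw [Complex.cpow_def_of_ne_zero h2, Complex.cpow_def_of_ne_zero (by norm_num),
    ← Complex.exp_add, one_div]
  have : Complex.log (2⁻¹ : ℂ) = -Complex.log 2 := by
    apply Complex.log_inv
    rw [Complex.ofNat_arg]
    exact Real.pi_pos.ne
  rw [this, neg_mul, add_neg_cancel, Complex.exp_zero]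

theorem gamma_one_add_ne_zero {z : ℂ} (hz : z ∈ rightHalfPlane) : Complex.Gamma (1 + z) ≠ 0 := by
  refine Complex.Gamma_ne_zero_of_re_pos ?_
  have : 0 < z.re := hz
  simp only [Complex.add_re, Complex.one_re]
  linarith

/-- The factor `2 ^ z / Γ(1 + z)` that inverts the weight in the definition of `ℋ`. -/
noncomputable def gammaFactor (z : ℂ) : ℂ := 2 ^ z / Complex.Gamma (1 + z)

theorem differentiableOn_gammaFactor : DifferentiableOn ℂ gammaFactor rightHalfPlane := by
  intro z hz
  refine (DifferentiableAt.fun_div (c := fun z => (2 : ℂ) ^ z)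
    (d := fun z => Complex.Gamma (1 + z)) ?_ ?_ (gamma_one_add_ne_zero hz)).differentiableWithinAt
  · exact differentiableAt_id.const_cpow (Or.inl two_ne_zero)
  · refine (Complex.differentiableAt_Gamma _ fun m hm => ?_).comp z (by fun_prop)
    have h1 := congrArg Complex.re hm
    have h2 : 0 < z.re := hz
    simp only [Complex.add_re, Complex.one_re, Complex.neg_re, Complex.natCast_re] at h1
    linarith [(Nat.cast_nonneg m : (0 : ℝ) ≤ m)]

theorem gamma_div_mul_gammaFactor {z : ℂ} (hz : z ∈ rightHalfPlane) :
    Complex.Gamma (1 + z) / 2 ^ z * gammaFactor z = 1 := by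
  have h1 := gamma_one_add_ne_zero hz
  have h2 : (2 : ℂ) ^ z ≠ 0 := by simp [Complex.cpow_eq_zero_iff]
  rw [gammaFactor]
  field_simp

theorem conj_two_cpow (z : ℂ) : conj ((2 : ℂ) ^ z) = 2 ^ conj z := by
  rw [Complex.cpow_conj _ _ (by rw [Complex.ofNat_arg]; exact Real.pi_pos.ne), map_ofNat]

theorem conj_gammaFactor (z : ℂ) : conj (gammaFactor z) = gammaFactor (conj z) := by
  rw [gammaFactor, gammaFactor, map_div₀, conj_two_cpow, ← Complex.Gamma_conj, map_add, map_one]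

theorem gammaTransform_congr {χ ψ : ℝ → ℂ} (h : χ =ᵐ[volume] ψ) :
    gammaTransform χ = gammaTransform ψ := by
  funext z
  refine integral_congr_ae ?_
  filter_upwards [h] with u hu
  rw [hu]

/-- The function `u ↦ exp (-z u - exp (-u))` as an element of `L²(ℝ)`. -/
noncomputable def expKernelLp {z : ℂ} (hz : 0 < z.re) : Lp ℂ 2 (volume : Measure ℝ) :=
  (memLp_expKernel hz).toLp

/-- Evaluation of the transform at `z` is the inner product with the kernel at `conj z`. -/
theorem inner_expKernelLp_conj {z : ℂ} (hz : 0 < (conj z).re) (χ : Lp ℂ 2 (volume : Measure ℝ)) :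
    inner ℂ (expKernelLp hz) χ = gammaTransform χ z := by
  rw [L2.inner_def, gammaTransform]
  refine integral_congr_ae ?_
  filter_upwards [(memLp_expKernel hz).coeFn_toLp] with u hu
  rw [expKernelLp, hu, RCLike.inner_apply, conj_expKernel, Complex.conj_conj]

theorem gammaTransform_expKernelLp {w z : ℂ} (hw : 0 < w.re) (hz : 0 < z.re) :
    gammaTransform (expKernelLp hw) z = (1 / 2) ^ (w + z) * Complex.Gamma (w + z) := by
  rw [expKernelLp, gammaTransform_congr (memLp_expKernel hw).coeFn_toLp, gammaTransform,
    integral_expKernel_mul (by rw [Complex.add_re]; linarith)]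

theorem gammaTransform_add (χ ψ : Lp ℂ 2 (volume : Measure ℝ)) {z : ℂ} (hz : 0 < z.re) :
    gammaTransform (χ + ψ : Lp ℂ 2 (volume : Measure ℝ)) z =
      gammaTransform χ z + gammaTransform ψ z := by
  have h : 0 < (conj z).re := by rwa [Complex.conj_re]
  rw [← inner_expKernelLp_conj h, ← inner_expKernelLp_conj h, ← inner_expKernelLp_conj h,
    inner_add_right]

theorem gammaTransform_smul (c : ℂ) (χ : Lp ℂ 2 (volume : Measure ℝ)) {z : ℂ} (hz : 0 < z.re) :
    gammaTransform (c • χ : Lp ℂ 2 (volume : Measure ℝ)) z = c * gammaTransform χ z := by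
  have h : 0 < (conj z).re := by rwa [Complex.conj_re]
  rw [← inner_expKernelLp_conj h, ← inner_expKernelLp_conj h, inner_smul_right]

/-- The function `2 ^ z / Γ(1 + z) * ∫ χ(u) exp (-z u - exp (-u)) du` of `z`. -/
noncomputable def gammaSynthesis (χ : Lp ℂ 2 (volume : Measure ℝ)) (z : rightHalfPlane) : ℂ :=
  gammaFactor z * gammaTransform χ z

theorem eqOn_zeroExt_gammaWeight_gammaSynthesis (χ : Lp ℂ 2 (volume : Measure ℝ)) :
    EqOn (zeroExt (gammaWeight (gammaSynthesis χ))) (gammaTransform χ) rightHalfPlane := by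
  intro z hz
  rw [zeroExt_of_mem _ hz, gammaWeight, gammaSynthesis, ← mul_assoc,
    gamma_div_mul_gammaFactor hz, one_mul]

theorem eqOn_zeroExt_gammaSynthesis (χ : Lp ℂ 2 (volume : Measure ℝ)) :
    EqOn (zeroExt (gammaSynthesis χ)) (fun z => gammaFactor z * gammaTransform χ z)
      rightHalfPlane := fun _ hz => zeroExt_of_mem _ hz

theorem gammaSynthesis_mem (χ : Lp ℂ 2 (volume : Measure ℝ)) : gammaSynthesis χ ∈ hSubmodule := by
  have hχ := Lp.memLp χ
  have hF := eqOn_zeroExt_gammaWeight_gammaSynthesis χ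
  exact ⟨(differentiableOn_gammaFactor.mul (differentiableOn_gammaTransform hχ)).congr
    (eqOn_zeroExt_gammaSynthesis χ), (differentiableOn_gammaTransform hχ).congr hF,
    fun b _ => isHardyStrip_of_eqOn hχ hF b, memLp_closedExt hχ hF⟩

theorem MBSpace.ext {g h : MBSpace} (H : ∀ z, g.val z = h.val z) : g = h :=
  Subtype.ext (funext H)

theorem MBSpace.val_add (g h : MBSpace) (z : rightHalfPlane) : (g + h).val z = g.val z + h.val z :=
  rfl

theorem MBSpace.val_smul (c : ℂ) (g : MBSpace) (z : rightHalfPlane) :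
    (c • g).val z = c * g.val z := rfl

/-- The map `gammaSynthesis` as a linear map to `ℋ`. -/
noncomputable def synthesisLinear : Lp ℂ 2 (volume : Measure ℝ) →ₗ[ℂ] MBSpace where
  toFun χ := (⟨gammaSynthesis χ, gammaSynthesis_mem χ⟩ : hSubmodule)
  map_add' χ ψ := MBSpace.ext fun z => by
    change gammaSynthesis (χ + ψ) z = gammaSynthesis χ z + gammaSynthesis ψ z
    rw [gammaSynthesis, gammaTransform_add _ _ z.2, mul_add]
    rfl
  map_smul' c χ := MBSpace.ext fun z => by
    change gammaSynthesis (c • χ) z = c * gammaSynthesis χ z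
    rw [gammaSynthesis, gammaTransform_smul _ _ z.2, mul_left_comm]
    rfl

theorem synthesisLinear_val (χ : Lp ℂ 2 (volume : Measure ℝ)) (z : rightHalfPlane) :
    (synthesisLinear χ).val z = gammaFactor z * gammaTransform χ z := rfl

theorem hInner_synthesisLinear (χ ψ : Lp ℂ 2 (volume : Measure ℝ)) :
    hInner (synthesisLinear χ) (synthesisLinear ψ) = 2 * Real.pi * inner ℂ χ ψ := by
  refine (integral_omega_conj_closedExt (Lp.memLp χ) (Lp.memLp ψ)
    (eqOn_zeroExt_gammaWeight_gammaSynthesis χ)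
    (eqOn_zeroExt_gammaWeight_gammaSynthesis ψ)).trans ?_
  rw [L2.inner_def]
  congr 1
  refine integral_congr_ae (Eventually.of_forall fun u => ?_)
  simp only [RCLike.inner_apply]
  rw [mul_comm]

theorem synthesisLinear_injective : Function.Injective synthesisLinear := by
  rw [injective_iff_map_eq_zero]
  intro χ hχ
  have h := hInner_synthesisLinear χ χ
  rw [hχ, ← map_zero synthesisLinear, hInner_synthesisLinear, inner_zero_left, mul_zero] at h
  have hpi : (2 * Real.pi : ℂ) ≠ 0 := by
    simp [Real.pi_ne_zero]
  exact inner_self_eq_zero.1 ((mul_eq_zero.1 h.symm).resolve_left hpi)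

theorem synthesisLinear_surjective : Function.Surjective synthesisLinear := by
  intro g
  obtain ⟨χ, hχ, hF⟩ := exists_gammaTransform_eqOn g.2.2.1 g.2.2.2.1 g.2.2.2.2
  refine ⟨hχ.toLp, MBSpace.ext fun z => ?_⟩
  rw [synthesisLinear_val, gammaTransform_congr hχ.coeFn_toLp, ← hF z.2, zeroExt_apply,
    gammaWeight, ← mul_assoc, mul_comm (gammaFactor z), gamma_div_mul_gammaFactor z.2, one_mul]
  rfl

/-- The linear isomorphism of `L²(ℝ)` with `ℋ`, which multiplies inner products by `2π`. -/
noncomputable def synthesisEquiv : Lp ℂ 2 (volume : Measure ℝ) ≃ₗ[ℂ] MBSpace :=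
  LinearEquiv.ofBijective synthesisLinear ⟨synthesisLinear_injective, synthesisLinear_surjective⟩

theorem synthesisEquiv_val (χ : Lp ℂ 2 (volume : Measure ℝ)) (z : rightHalfPlane) :
    (synthesisEquiv χ).val z = gammaFactor z * gammaTransform χ z := rfl

theorem hInner_eq (g h : MBSpace) :
    hInner g h = 2 * Real.pi * inner ℂ (synthesisEquiv.symm g) (synthesisEquiv.symm h) := by
  rw [← hInner_synthesisLinear]
  exact (congrArg₂ hInner (synthesisEquiv.apply_symm_apply g)
    (synthesisEquiv.apply_symm_apply h)).symm

/-- The inner product of `ℋ`; its axioms are transported from `L²(ℝ)`. -/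
@[reducible] noncomputable def hCore : InnerProductSpace.Core ℂ MBSpace where
  inner := hInner
  conj_inner_symm g h := by
    rw [hInner_eq, hInner_eq, map_mul, inner_conj_symm, map_mul, map_ofNat, Complex.conj_ofReal]
  re_inner_nonneg g := by
    rw [hInner_eq, inner_self_eq_norm_sq_to_K]
    have : (2 * Real.pi * ((‖synthesisEquiv.symm g‖ : ℝ) : ℂ) ^ 2 : ℂ) =
        ((2 * Real.pi * ‖synthesisEquiv.symm g‖ ^ 2 : ℝ) : ℂ) := by push_cast; rfl
    refine le_of_le_of_eq ?_ (congrArg RCLike.re this).symm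
    rw [show RCLike.re ((2 * Real.pi * ‖synthesisEquiv.symm g‖ ^ 2 : ℝ) : ℂ) =
      2 * Real.pi * ‖synthesisEquiv.symm g‖ ^ 2 from Complex.ofReal_re _]
    positivity
  add_left f g h := by
    rw [hInner_eq, hInner_eq, hInner_eq, map_add, inner_add_left, mul_add]
  smul_left f g c := by
    rw [hInner_eq, hInner_eq, map_smul, inner_smul_left, mul_left_comm]
  definite g h := by
    have hpi : (2 * Real.pi : ℂ) ≠ 0 := by simp [Real.pi_ne_zero]
    rw [hInner_eq] at h
    have := inner_self_eq_zero.1 ((mul_eq_zero.1 h).resolve_left hpi)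
    rwa [LinearEquiv.map_eq_zero_iff] at this

noncomputable instance : NormedAddCommGroup MBSpace := hCore.toNormedAddCommGroup

noncomputable instance : InnerProductSpace ℂ MBSpace := InnerProductSpace.ofCore hCore.toCore

theorem inner_synthesisEquiv (χ ψ : Lp ℂ 2 (volume : Measure ℝ)) :
    inner ℂ (synthesisEquiv χ) (synthesisEquiv ψ) = 2 * Real.pi * inner ℂ χ ψ :=
  hInner_synthesisLinear χ ψ

theorem norm_synthesisEquiv (χ : Lp ℂ 2 (volume : Measure ℝ)) :
    ‖synthesisEquiv χ‖ = Real.sqrt (2 * Real.pi) * ‖χ‖ := by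
  have h := inner_synthesisEquiv χ χ
  rw [inner_self_eq_norm_sq_to_K, inner_self_eq_norm_sq_to_K] at h
  have h' : ‖synthesisEquiv χ‖ ^ 2 = 2 * Real.pi * ‖χ‖ ^ 2 := by
    apply Complex.ofReal_injective
    push_cast
    exact h
  rw [← Real.sqrt_sq (norm_nonneg (synthesisEquiv χ)), h', Real.sqrt_mul (by positivity),
    Real.sqrt_sq (norm_nonneg _)]

theorem sqrt_two_pi_pos : 0 < Real.sqrt (2 * Real.pi) := Real.sqrt_pos.2 (by positivity)

/-- The normalized isometric isomorphism of `L²(ℝ)` with `ℋ`. -/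
noncomputable def synthesisIsometry : Lp ℂ 2 (volume : Measure ℝ) ≃ₗᵢ[ℂ] MBSpace where
  toLinearEquiv := (LinearEquiv.smulOfNeZero ℂ (Lp ℂ 2 (volume : Measure ℝ))
    ((Real.sqrt (2 * Real.pi) : ℂ)⁻¹)
    (inv_ne_zero (Complex.ofReal_ne_zero.2 sqrt_two_pi_pos.ne'))).trans synthesisEquiv
  norm_map' χ := by
    change ‖synthesisEquiv ((Real.sqrt (2 * Real.pi) : ℂ)⁻¹ • χ)‖ = _
    rw [norm_synthesisEquiv, norm_smul, norm_inv, Complex.norm_real,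
      Real.norm_of_nonneg sqrt_two_pi_pos.le, mul_inv_cancel_left₀ sqrt_two_pi_pos.ne']

instance : CompleteSpace MBSpace := synthesisIsometry.symm.toIsometryEquiv.completeSpace

/-! ### The reproducing kernel -/

/-- The reproducing element of `ℋ` at the point `w`. -/
noncomputable def hKernel (w : rightHalfPlane) : MBSpace :=
  synthesisEquiv ((gammaFactor (conj (w : ℂ)) / (2 * Real.pi)) •
    expKernelLp (z := conj (w : ℂ)) (by rw [Complex.conj_re]; exact w.2))

theorem inner_hKernel (w : rightHalfPlane) (g : MBSpace) : inner ℂ (hKernel w) g = g.val w := by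
  obtain ⟨χ, rfl⟩ := synthesisEquiv.surjective g
  have hpi : (Real.pi : ℂ) ≠ 0 := by exact_mod_cast Real.pi_ne_zero
  rw [hKernel, inner_synthesisEquiv, inner_smul_left, inner_expKernelLp_conj, synthesisEquiv_val,
    map_div₀, conj_gammaFactor, Complex.conj_conj, map_mul, map_ofNat, Complex.conj_ofReal]
  field_simp

theorem hKernel_val (w z : rightHalfPlane) : (hKernel w).val z =
    1 / (2 * (Real.pi : ℂ)) * (Complex.Gamma ((z : ℂ) + conj (w : ℂ)) /
      (Complex.Gamma (1 + (z : ℂ)) * Complex.Gamma (1 + conj (w : ℂ)))) := by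
  have h := two_cpow_mul_half_cpow ((z : ℂ) + conj (w : ℂ))
  rw [Complex.cpow_add _ _ two_ne_zero] at h
  rw [hKernel, synthesisEquiv_val, gammaTransform_smul _ _ z.2, gammaTransform_expKernelLp _ z.2,
    add_comm (conj (w : ℂ)), gammaFactor, gammaFactor]
  linear_combination (1 / (2 * (Real.pi : ℂ)) * (Complex.Gamma ((z : ℂ) + conj (w : ℂ)) /
      (Complex.Gamma (1 + (z : ℂ)) * Complex.Gamma (1 + conj (w : ℂ))))) * h

noncomputable instance : RKHS ℂ MBSpace rightHalfPlane ℂ where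
  coeCLM :=
    { toFun := fun g z => g.val z
      map_add' := fun _ _ => rfl
      map_smul' := fun _ _ => rfl
      cont := continuous_pi fun w => by
        simp_rw [← inner_hKernel]
        fun_prop }
  coeCLM_injective := fun _ _ h => MBSpace.ext fun z => congrFun h z

theorem rkhs_kernel_eq (z w : rightHalfPlane) :
    RKHS.kernel MBSpace z w 1 = (hKernel w).val z := by
  have : RKHS.kerFun MBSpace w 1 = hKernel w := by
    refine ext_inner_right ℂ fun g => ?_
    rw [RKHS.kerFun_inner, inner_hKernel, RCLike.inner_apply, map_one, mul_one]
    rfl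
  rw [← RKHS.kerFun_apply, this]
  rfl

/-! ### The unitary map from the Bergman space to `L²(ℝ)` -/

theorem natCast_add_one_re_pos (k : ℕ) : 0 < ((k : ℂ) + 1).re := by
  simp only [Complex.add_re, Complex.natCast_re, Complex.one_re]
  positivity

theorem re_conj_natCast_add_one (k : ℕ) : 0 < (conj ((k : ℂ) + 1)).re := by
  rw [Complex.conj_re]
  exact natCast_add_one_re_pos k

/-- The element of `L²(ℝ)` whose synthesis is the transform of `ζ ^ k`. -/
noncomputable def linePow (k : ℕ) : Lp ℂ 2 (volume : Measure ℝ) :=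
  (2 ^ (k + 1) / ((k + 1)! : ℂ)) • expKernelLp (natCast_add_one_re_pos k)

theorem gammaFactor_natCast_add_one (k : ℕ) :
    gammaFactor ((k : ℂ) + 1) = 2 ^ (k + 1) / ((k + 1)! : ℂ) := by
  rw [gammaFactor, add_comm 1, ← Nat.cast_succ, Complex.Gamma_nat_eq_factorial,
    Complex.cpow_natCast]

theorem inner_linePow (k : ℕ) (χ : Lp ℂ 2 (volume : Measure ℝ)) :
    inner ℂ (linePow k) χ = gammaFactor (k + 1) * gammaTransform χ (k + 1) := by
  have e : conj ((k : ℂ) + 1) = k + 1 := by simp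
  have h := inner_expKernelLp_conj (re_conj_natCast_add_one k) χ
  simp only [e] at h
  rw [linePow, inner_smul_left, h, gammaFactor_natCast_add_one, map_div₀, map_pow, map_ofNat,
    map_natCast]

theorem gammaFactor_mul_gammaTransform_linePow (k : ℕ) {z : ℂ} (hz : 0 < z.re) :
    gammaFactor z * gammaTransform (linePow k) z = mellinBergman (bergmanPow k) z := by
  rw [mellinBergman_bergmanPow k hz, ascPochhammer_eval_one_add k hz, linePow,
    gammaTransform_smul _ _ hz, gammaTransform_expKernelLp _ hz, gammaFactor]
  have h1 := two_cpow_mul_half_cpow (((k + 1 : ℕ) : ℂ) + z)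
  rw [Complex.cpow_add _ _ two_ne_zero, Complex.cpow_natCast] at h1
  push_cast at h1
  rw [add_comm z ((k : ℂ) + 1)]
  linear_combination (Complex.Gamma ((k : ℂ) + 1 + z) / Complex.Gamma (1 + z) / (k + 1)!) * h1

/-- The Gram matrices agree up to the factor `π`: evaluating the common transform of `linePow k` and
`ζ ^ k` at the point `j + 1` gives a multiple of either inner product. -/
theorem inner_linePow_linePow (j k : ℕ) : inner ℂ (linePow j) (linePow k) =
    1 / (Real.pi : ℂ) * inner ℂ (bergmanToLp (bergmanPow j)) (bergmanToLp (bergmanPow k)) := by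
  rw [inner_linePow, gammaFactor_mul_gammaTransform_linePow k (natCast_add_one_re_pos j),
    mellinBergman_natCast_add_one]

/-- The functions `linePow k` are total in `L²(ℝ)`. -/
theorem eq_zero_of_inner_linePow_eq_zero {χ : Lp ℂ 2 (volume : Measure ℝ)}
    (h : ∀ k, inner ℂ (linePow k) χ = 0) : χ = 0 := by
  refine (Lp.eq_zero_iff_ae_eq_zero).2
    (ae_eq_zero_of_integral_mul_expKernel_eq_zero (Lp.memLp χ) fun k => ?_)
  have hk := h k
  rw [inner_linePow] at hk
  refine (mul_eq_zero.1 hk).resolve_left ?_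
  rw [gammaFactor_natCast_add_one]
  have : (((k + 1)! : ℕ) : ℂ) ≠ 0 := by exact_mod_cast (k + 1).factorial_ne_zero
  exact div_ne_zero (pow_ne_zero _ two_ne_zero) this

/-- Two continuous linear functionals that agree on a total family are equal, since their difference
is the inner product with a vector orthogonal to the family. -/
theorem clm_eq_of_total {E : Type*} [NormedAddCommGroup E] [InnerProductSpace ℂ E]
    [CompleteSpace E] {e : ℕ → E} (he : ∀ x : E, (∀ k, inner ℂ (e k) x = 0) → x = 0)
    {Φ Ψ : E →L[ℂ] ℂ} (h : ∀ k, Φ (e k) = Ψ (e k)) : Φ = Ψ := by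
  obtain ⟨x, hx⟩ := (InnerProductSpace.toDual ℂ E).surjective (Φ - Ψ)
  have hxe : ∀ k, inner ℂ x (e k) = 0 := fun k => by
    rw [← InnerProductSpace.toDual_apply_apply, hx, sub_apply, h, sub_self]
  have hx0 : x = 0 := he x fun k => inner_eq_zero_symm.1 (hxe k)
  rw [hx0, map_zero] at hx
  exact (sub_eq_zero.1 hx.symm)

/-- The image of the Bergman space in `L²(Δ)`, which is closed, hence a Hilbert space. -/
noncomputable abbrev bergmanRange : Submodule ℂ (Lp ℂ 2 ((volume : Measure ℂ).restrict disc)) :=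
  bergmanToLp.range

instance : CompleteSpace bergmanRange := isClosed_range_bergmanToLp.completeSpace_coe

/-- The linear isomorphism of the Bergman space with its image in `L²(Δ)`. -/
noncomputable def bergmanEquivRange : bergmanSpace ≃ₗ[ℂ] bergmanRange :=
  LinearEquiv.ofInjective bergmanToLp bergmanToLp_injective

theorem eq_zero_of_inner_bergmanPow_eq_zero {x : bergmanRange}
    (h : ∀ k, inner ℂ (bergmanEquivRange (bergmanPow k)) x = 0) : x = 0 := by
  obtain ⟨f, rfl⟩ := bergmanEquivRange.surjective x
  have h0 : f = 0 := bergmanSpace_eq_zero_of_integral_eq_zero fun k => by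
    rw [← inner_bergmanPow]
    exact h k
  rw [h0, map_zero]

theorem sqrt_pi_ne_zero : (Real.sqrt Real.pi : ℂ) ≠ 0 :=
  Complex.ofReal_ne_zero.2 (Real.sqrt_pos.2 Real.pi_pos).ne'

/-- The normalization `√π` makes the Gram matrices of the two families equal. -/
theorem exists_isometry_bergmanRange : ∃ J : bergmanRange ≃ₗᵢ[ℂ] Lp ℂ 2 (volume : Measure ℝ),
    ∀ k, J (bergmanEquivRange (bergmanPow k)) = (Real.sqrt Real.pi : ℂ) • linePow k := by
  refine exists_linearIsometryEquiv_of_inner_eq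
    (fun x => eq_zero_of_inner_bergmanPow_eq_zero) (fun χ h => ?_) fun j k => ?_
  · refine eq_zero_of_inner_linePow_eq_zero fun k => ?_
    have := h k
    rw [inner_smul_left, Complex.conj_ofReal] at this
    exact (mul_eq_zero.1 this).resolve_left sqrt_pi_ne_zero
  · rw [inner_smul_left, inner_smul_right, Complex.conj_ofReal, inner_linePow_linePow,
      ← mul_assoc, ← mul_assoc, ← Complex.ofReal_mul, Real.mul_self_sqrt Real.pi_pos.le,
      mul_one_div_cancel (Complex.ofReal_ne_zero.2 Real.pi_ne_zero), one_mul]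
    rfl

/-- The transform `M_Δ` factors through `L²(ℝ)`, as both sides are continuous in `f` and agree on
the powers `ζ ^ k`. -/
theorem gammaFactor_mul_gammaTransform_eq
    {J : bergmanRange ≃ₗᵢ[ℂ] Lp ℂ 2 (volume : Measure ℝ)}
    (hJ : ∀ k, J (bergmanEquivRange (bergmanPow k)) = (Real.sqrt Real.pi : ℂ) • linePow k)
    (f : bergmanSpace) {z : ℂ} (hz : 0 < z.re) :
    gammaFactor z * gammaTransform ((Real.sqrt Real.pi : ℂ)⁻¹ • J (bergmanEquivRange f) :
      Lp ℂ 2 (volume : Measure ℝ)) z = mellinBergman f z := by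
  obtain ⟨κ, hκ⟩ := exists_mellinBergman_eq_inner hz
  have hz' : 0 < (conj z).re := by rwa [Complex.conj_re]
  let Φ : bergmanRange →L[ℂ] ℂ := (gammaFactor z * (Real.sqrt Real.pi : ℂ)⁻¹) •
    (innerSL ℂ (expKernelLp hz')).comp (J.toContinuousLinearEquiv : bergmanRange →L[ℂ] _)
  let Ψ : bergmanRange →L[ℂ] ℂ := (innerSL ℂ κ).comp bergmanRange.subtypeL
  have hΦ : ∀ f, Φ (bergmanEquivRange f) = gammaFactor z *
      gammaTransform ((Real.sqrt Real.pi : ℂ)⁻¹ • J (bergmanEquivRange f) :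
        Lp ℂ 2 (volume : Measure ℝ)) z := fun f => by
    rw [gammaTransform_smul _ _ hz, ← inner_expKernelLp_conj hz', ← mul_assoc]
    rfl
  have hΨ : ∀ f, Ψ (bergmanEquivRange f) = mellinBergman f z := fun f => (hκ f).symm
  have : Φ = Ψ := clm_eq_of_total (fun x => eq_zero_of_inner_bergmanPow_eq_zero) fun k => by
    rw [hΦ, hΨ, hJ, smul_smul, inv_mul_cancel₀ sqrt_pi_ne_zero, one_smul,
      gammaFactor_mul_gammaTransform_linePow k hz]
  rw [← hΦ, this, hΨ]

/-- The Mellin–Bergman transform is, up to the factor `√(2π)`, a unitary map of the Bergman space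
onto `ℋ`. -/
theorem exists_linearEquiv_mellinBergman : ∃ U : bergmanSpace ≃ₗ[ℂ] MBSpace,
    (∀ (f : bergmanSpace) (z : rightHalfPlane), (U f).val z = mellinBergman f z) ∧
    ∀ f : bergmanSpace, ‖U f‖ = Real.sqrt (2 * Real.pi) * bergmanNorm f := by
  obtain ⟨J, hJ⟩ := exists_isometry_bergmanRange
  refine ⟨bergmanEquivRange.trans (J.toLinearEquiv.trans
    ((LinearEquiv.smulOfNeZero ℂ (Lp ℂ 2 (volume : Measure ℝ)) ((Real.sqrt Real.pi : ℂ)⁻¹)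
      (inv_ne_zero sqrt_pi_ne_zero)).trans synthesisEquiv)), fun f z => ?_, fun f => ?_⟩
  · exact gammaFactor_mul_gammaTransform_eq hJ f z.2
  · change ‖synthesisEquiv ((Real.sqrt Real.pi : ℂ)⁻¹ • J (bergmanEquivRange f))‖ = _
    rw [norm_synthesisEquiv, norm_smul, J.norm_map, norm_inv, Complex.norm_real,
      Real.norm_of_nonneg (Real.sqrt_nonneg _)]
    change _ * (_ * ‖bergmanToLp f‖) = _
    rw [norm_bergmanToLp, inv_mul_cancel_left₀ (Real.sqrt_pos.2 Real.pi_pos).ne']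

theorem expTypeAtMost_val (g : MBSpace) : ExpTypeAtMost (Real.pi / 2) g.val := by
  obtain ⟨U, hU, -⟩ := exists_linearEquiv_mellinBergman
  obtain ⟨f, rfl⟩ := U.surjective g
  intro δ hδ ε hε
  obtain ⟨C, hC⟩ := exists_norm_mellinBergman_le f hδ
  refine ⟨|C|, fun z hz => ?_⟩
  rw [hU]
  refine (hC z hz).trans ?_
  gcongr
  · exact le_abs_self C
  · linarith

/-! ### Polynomials in `ℋ` -/

theorem synthesisEquiv_linePow_val (k : ℕ) (z : rightHalfPlane) :
    (synthesisEquiv (linePow k)).val z = (ascPochhammer ℂ k).eval (1 + (z : ℂ)) / (k + 1)! := by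
  rw [synthesisEquiv_val, gammaFactor_mul_gammaTransform_linePow k z.2,
    mellinBergman_bergmanPow k z.2]

/-- The polynomials whose restriction to the right half-plane is in `ℋ`. -/
noncomputable def polynomialsInH : Submodule ℂ (Polynomial ℂ) where
  carrier := {p | ∃ g : MBSpace, ∀ z : rightHalfPlane, g.val z = p.eval (z : ℂ)}
  add_mem' := by
    rintro p q ⟨g, hg⟩ ⟨h, hh⟩
    exact ⟨g + h, fun z => by rw [MBSpace.val_add, hg, hh, Polynomial.eval_add]⟩
  zero_mem' := ⟨0, fun z => by rw [Polynomial.eval_zero]; rfl⟩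
  smul_mem' := by
    rintro c p ⟨g, hg⟩
    exact ⟨c • g, fun z => by rw [MBSpace.val_smul, hg, Polynomial.eval_smul, smul_eq_mul]⟩

/-- The polynomials `(X + 1)(X + 2)⋯(X + k)`. -/
noncomputable def shiftedPochhammer : Polynomial.Sequence ℂ where
  elems' k := (ascPochhammer ℂ k).comp (1 + Polynomial.X)
  degree_eq' k := by
    have h : (1 + Polynomial.X : Polynomial ℂ) = Polynomial.X + Polynomial.C 1 := by
      rw [add_comm, Polynomial.C_1]
    rw [h, Polynomial.degree_eq_iff_natDegree_eq, Polynomial.natDegree_comp,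
      ascPochhammer_natDegree, Polynomial.natDegree_X_add_C, mul_one]
    exact ((monic_ascPochhammer ℂ k).comp_X_add_C 1).ne_zero

/-- The polynomials `(X + 1)⋯(X + k)`, whose multiples are the transforms of `ζ ^ k`, span all
polynomials. -/
theorem polynomialsInH_eq_top : polynomialsInH = ⊤ := by
  rw [eq_top_iff, ← shiftedPochhammer.span fun i => isUnit_iff_ne_zero.2
    (Polynomial.leadingCoeff_ne_zero.2 (shiftedPochhammer.ne_zero i)), Submodule.span_le]
  rintro _ ⟨k, rfl⟩
  refine ⟨((k + 1)! : ℂ) • synthesisEquiv (linePow k), fun z => ?_⟩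
  have hk : (((k + 1)! : ℕ) : ℂ) ≠ 0 := by exact_mod_cast (k + 1).factorial_ne_zero
  rw [MBSpace.val_smul, synthesisEquiv_linePow_val, mul_div_cancel₀ _ hk]
  change _ = ((ascPochhammer ℂ k).comp (1 + Polynomial.X)).eval (z : ℂ)
  simp [Polynomial.eval_comp]

theorem exists_val_eq_eval (p : Polynomial ℂ) :
    ∃ g : MBSpace, ∀ z : rightHalfPlane, g.val z = p.eval (z : ℂ) := by
  have : p ∈ polynomialsInH := polynomialsInH_eq_top ▸ Submodule.mem_top
  exact this

/-- The elements of `ℋ` that are restrictions of polynomials. -/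
noncomputable def polynomialSubmodule : Submodule ℂ MBSpace where
  carrier := {g | ∃ p : Polynomial ℂ, ∀ z : rightHalfPlane, g.val z = p.eval (z : ℂ)}
  add_mem' := by
    rintro g h ⟨p, hp⟩ ⟨q, hq⟩
    exact ⟨p + q, fun z => by rw [MBSpace.val_add, hp, hq, Polynomial.eval_add]⟩
  zero_mem' := ⟨0, fun z => by rw [Polynomial.eval_zero]; rfl⟩
  smul_mem' := by
    rintro c g ⟨p, hp⟩
    exact ⟨c • p, fun z => by rw [MBSpace.val_smul, hp, Polynomial.eval_smul, smul_eq_mul]⟩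

theorem synthesisEquiv_linePow_mem (k : ℕ) : synthesisEquiv (linePow k) ∈ polynomialSubmodule := by
  refine ⟨Polynomial.C ((k + 1)! : ℂ)⁻¹ * (ascPochhammer ℂ k).comp (1 + Polynomial.X), fun z => ?_⟩
  rw [synthesisEquiv_linePow_val, div_eq_inv_mul]
  simp [Polynomial.eval_comp]

/-- The polynomials contain the images of the total family `linePow`. -/
theorem dense_polynomialSubmodule : Dense (polynomialSubmodule : Set MBSpace) := by
  rw [Submodule.dense_iff_topologicalClosure_eq_top, Submodule.topologicalClosure_eq_top_iff,
    Submodule.eq_bot_iff]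
  intro g hg
  obtain ⟨χ, rfl⟩ := synthesisEquiv.surjective g
  have hpi : (2 * Real.pi : ℂ) ≠ 0 := by simp [Real.pi_ne_zero]
  have h0 : χ = 0 := eq_zero_of_inner_linePow_eq_zero fun k => by
    have := Submodule.inner_right_of_mem_orthogonal (synthesisEquiv_linePow_mem k) hg
    rw [inner_synthesisEquiv] at this
    exact (mul_eq_zero.1 this).resolve_left hpi
  rw [h0, map_zero]

theorem exists_isBoundaryValue (g : MBSpace) :
    ∃ u : ℝ → ℂ, IsBoundaryValue (zeroExt (gammaWeight g.val)) u := by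
  obtain ⟨χ, rfl⟩ := synthesisEquiv.surjective g
  exact ⟨_, isBoundaryValue_gammaBoundary (Lp.memLp χ)
    (eqOn_zeroExt_gammaWeight_gammaSynthesis χ)⟩

end MellinBergman

theorem mainTheorem1 :
    (∀ g : MBSpace, ∃ u : ℝ → ℂ, IsBoundaryValue (zeroExt (gammaWeight g.val)) u) ∧
    (∀ g : MBSpace, ExpTypeAtMost (Real.pi / 2) g.val) ∧
    ∃ c : InnerProductSpace.Core ℂ MBSpace,
      (∀ g h : MBSpace, c.inner g h = hInner g h) ∧
      letI : NormedAddCommGroup MBSpace := c.toNormedAddCommGroup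
      letI : InnerProductSpace ℂ MBSpace := InnerProductSpace.ofCore c.toCore
      (∃ U : bergmanSpace ≃ₗ[ℂ] MBSpace,
        (∀ (f : bergmanSpace) (z : rightHalfPlane), (U f).val z = mellinBergman f z) ∧
        ∀ f : bergmanSpace, ‖U f‖ = Real.sqrt (2 * Real.pi) * bergmanNorm f) ∧
      (∀ p : Polynomial ℂ, ∃ g : MBSpace, ∀ z : rightHalfPlane, g.val z = p.eval (z : ℂ)) ∧
      Dense {g : MBSpace | ∃ p : Polynomial ℂ, ∀ z : rightHalfPlane,
        g.val z = p.eval (z : ℂ)} ∧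
      ∃ (_ : CompleteSpace MBSpace) (R : RKHS ℂ MBSpace rightHalfPlane ℂ),
        (∀ (g : MBSpace) (z : rightHalfPlane), R.coeCLM g z = g.val z) ∧
        ∀ z w : rightHalfPlane,
          RKHS.kernel MBSpace z w 1 =
            1 / (2 * (Real.pi : ℂ)) * (Complex.Gamma ((z : ℂ) + conj (w : ℂ)) /
              (Complex.Gamma (1 + (z : ℂ)) * Complex.Gamma (1 + conj (w : ℂ)))) := by
  exact ⟨exists_isBoundaryValue, expTypeAtMost_val, hCore, fun _ _ => rfl,
    exists_linearEquiv_mellinBergman, exists_val_eq_eval, dense_polynomialSubmodule,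
    inferInstance, inferInstance, fun _ _ => rfl,
    fun z w => (rkhs_kernel_eq z w).trans (hKernel_val w z)⟩
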